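/- Hypergroups are locally compact Hausdorff spaces $X$ with an associative, weakly continuous convolution $*$ of bounded measures, a neutral element $e$ and an involution $x\mapsto x^-$, satisfying the usual axioms: $\varepsilon_x*\varepsilon_y$ is a probability measure with compact support; $\varepsilon_x*\varepsilon_e=\varepsilon_e*\varepsilon_x=\varepsilon_x$; the involution is continuous, $(\varepsilon_x*\varepsilon_y)^-=\varepsilon_{y^-}*\varepsilon_{x^-}$, and $e\in\operatorname{supp}(\varepsilon_x*\varepsilon_y)$ if and only if $y=x^-$; and $(x,y)\mapsto\operatorname{supp}(\varepsilon_x*\varepsilon_y)$ is continuous for the Michael topology. For a compact hypergroup $H$ let $\hat H$ be the set of classes of irreducible (Hilbert space) representations of $H$, put $\operatorname{ch}(\pi)(h)=\frac{1}{\dim\pi}\operatorname{tr}\pi(h)$ for $\pi\in\hat H$, and let $\mathcal K(\hat H)=\{\operatorname{ch}(\pi):\pi\in\hat H\}$, with the discrete topology. $H$ is called strong if $\mathcal K(\hat H)$ is a hypergroup whose convolution is the pointwise product of characters, that is, $\operatorname{ch}(\pi_i)*\operatorname{ch}(\pi_j)$ is the probability measure $\sum_k a_k\,\varepsilon_{\operatorname{ch}(\pi_k)}$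 with $\operatorname{ch}(\pi_i)\operatorname{ch}(\pi_j)=\sum_k a_k\operatorname{ch}(\pi_k)$. Let $H$ be a strong compact hypergroup with a countable basis of its topology, and $H_0$ a closed subhypergroup of $H$ which is strong and for which the set $H/H_0$ of cosets $x*H_0$ is finite. Let $\operatorname{res}$ be the restriction of functions from $H$ to $H_0$. For $\tau\in\widehat{H_0}$ let $\operatorname{ind}\tau$ be the induced representation, on the space of all $\xi\in L^2(H,\mathcal H(\tau))$ (with respect to the normalized Haar measure $\omega$ of $H$) such that $(\varepsilon_{h_0}*\varepsilon_x)(\xi)=\tau(h_0)\xi(x)$ for all $h_0\in H_0$, with $((\operatorname{ind}\tau)(h)\xi)(x)=(\varepsilon_x*\varepsilon_h)(\xi)$. With its decomposition $\operatorname{ind}\tau\cong\pi_1\oplus\dots\oplus\pi_m$ into irreducible representations of $H$, the induced character is $$\operatorname{ind}\operatorname{ch}(\tau)=\sum_{j=1}^m\frac{d(\pi_j)}{d(\pi_1)+\dots+d(\pi_m)}\operatorname{ch}(\pi_j),$$ where $d(\pi)$ is the hyperdimension of $\pi\in\hat H$, i.e. $\int_H|\langle\pi(x)u,v\rangle|^2\,\omega(dx)=1/d(\pi)$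 for all unit vectors $u,v$. Extend $\operatorname{ind}$ linearly to the linear combinations of characters $\operatorname{ch}(\tau)$, $\tau\in\widehat{H_0}$. Let $0<q\le 1$. On the discrete space $$\mathcal K(\hat H\cup\widehat{H_0},\mathbb Z_q(2))=\{(\operatorname{ch}(\pi),\circ),(\operatorname{ch}(\tau),\bullet):\pi\in\hat H,\ \tau\in\widehat{H_0}\}$$ the $q$-twisted convolution is $$(\operatorname{ch}(\pi_i),\circ)*(\operatorname{ch}(\pi_j),\circ)=(\operatorname{ch}(\pi_i)\operatorname{ch}(\pi_j),\circ),$$ $$(\operatorname{ch}(\pi),\circ)*(\operatorname{ch}(\tau),\bullet)=((\operatorname{res}\operatorname{ch}(\pi))\operatorname{ch}(\tau),\bullet),\qquad (\operatorname{ch}(\tau),\bullet)*(\operatorname{ch}(\pi),\circ)=(\operatorname{ch}(\tau)(\operatorname{res}\operatorname{ch}(\pi)),\bullet),$$ $$(\operatorname{ch}(\tau_i),\bullet)*(\operatorname{ch}(\tau_j),\bullet)=q\,(\operatorname{ind}(\operatorname{ch}(\tau_i)\operatorname{ch}(\tau_j)),\circ)+(1-q)(\operatorname{ch}(\tau_i)\operatorname{ch}(\tau_j),\bullet),$$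 where the functions on the right-hand sides are expanded into characters. Theorem. $\mathcal K(\hat H\cup\widehat{H_0},\mathbb Z_q(2))$ with the $q$-twisted convolution is a hypergroup if and only if $(H,H_0)$ is an admissible hypergroup pair, that is: (1) $\operatorname{ind}\big((\operatorname{res}\operatorname{ch}(\pi))\operatorname{ch}(\tau)\big)=\operatorname{ch}(\pi)\operatorname{ind}\operatorname{ch}(\tau)$ for all $\pi\in\hat H$ and $\tau\in\widehat{H_0}$, and (2) $\operatorname{res}(\operatorname{ind}\operatorname{ch}(\tau))=\operatorname{ch}(\tau)\operatorname{res}(\operatorname{ind}\operatorname{ch}(\tau_0))$ for all $\tau\in\widehat{H_0}$, where $\tau_0$ is the trivial representation of $H_0$. -/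

import Mathlib

open MeasureTheory Topology TopologicalSpace
open scoped BoundedContinuousFunction InnerProductSpace

universe u

noncomputable section

/-! ## Hypergroups -/

/-- A hypergroup: a locally compact Hausdorff space `X` with a weakly continuous, associative
convolution of bounded measures. The bilinear convolution is given by the measures
`conv x y = ε_x * ε_y`, through `μ * ν = ∫∫ ε_x * ε_y μ(dx) ν(dy)`. -/
class Hypergroup (X : Type u) [TopologicalSpace X] [T2Space X] [LocallyCompactSpace X]
    [MeasurableSpace X] [BorelSpace X] where
  /-- `conv x y` is the measure `ε_x * ε_y`. -/
  conv : X → X → Measure X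
  /-- The neutral element. -/
  e : X
  /-- The involution `x ↦ x⁻`. -/
  inv : X → X
  isProbabilityMeasure : ∀ x y, IsProbabilityMeasure (conv x y)
  regular : ∀ x y, (conv x y).Regular
  isCompact_support : ∀ x y, IsCompact (conv x y).support
  weaklyContinuous : ∀ f : X →ᵇ ℝ, Continuous fun p : X × X => ∫ z, f z ∂(conv p.1 p.2)
  /-- `(ε_x * ε_y) * ε_z = ε_x * (ε_y * ε_z)`, tested on bounded continuous functions. -/
  assoc : ∀ (x y z : X) (f : X →ᵇ ℝ),
    ∫ w, (∫ t, f t ∂(conv w z)) ∂(conv x y) = ∫ w, (∫ t, f t ∂(conv x w)) ∂(conv y z)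
  conv_e : ∀ x, conv x e = Measure.dirac x
  e_conv : ∀ x, conv e x = Measure.dirac x
  continuous_inv : Continuous inv
  inv_inv : ∀ x, inv (inv x) = x
  e_mem_support_iff : ∀ x y, e ∈ (conv x y).support ↔ y = inv x
  map_inv_conv : ∀ x y, (conv x y).map inv = conv (inv y) (inv x)
  /-- Continuity of `(x, y) ↦ supp (ε_x * ε_y)` for the Michael (Vietoris) topology. -/
  continuous_support : @Continuous (X × X) (Set X) _ (TopologicalSpace.vietoris X)
    fun p => (conv p.1 p.2).support

attribute [instance] Hypergroup.isProbabilityMeasure Hypergroup.regular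

section Compact

variable {H : Type u} [TopologicalSpace H] [CompactSpace H] [T2Space H]
  [MeasurableSpace H] [BorelSpace H]

/-- A normalized Haar measure of a compact hypergroup: a probability measure `ω` with
`∫ (ε_x * ε_y)(f) ω(dy) = ∫ f dω` for all `x` and all continuous `f`. -/
def IsNormalizedHaar [Hypergroup H] (ω : Measure H) : Prop :=
  IsProbabilityMeasure ω ∧ ω.Regular ∧
    ∀ (f : C(H, ℝ)) (x : H), ∫ y, (∫ z, f z ∂(Hypergroup.conv x y)) ∂ω = ∫ y, f y ∂ω

variable (H) in
open Classical in
/-- The normalized Haar measure of a compact hypergroup. -/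
def hgHaar [Hypergroup H] : Measure H :=
  if h : ∃ ω : Measure H, IsNormalizedHaar ω then h.choose else 0

/-! ## Representations, characters, hyperdimension -/

variable (H) in
/-- A representation of a compact hypergroup on a separable Hilbert space, given by the operators
`π(x) = π(ε_x)`; on a bounded measure, `π(μ) = ∫ π(x) μ(dx)` weakly. -/
structure HGRep [Hypergroup H] where
  /-- The representing Hilbert space. -/
  E : Type
  [normed : NormedAddCommGroup E]
  [inner : InnerProductSpace ℂ E]
  [complete : CompleteSpace E]
  [separable : SeparableSpace E]
  /-- The operators `π(ε_x)`. -/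
  op : H → E →L[ℂ] E
  op_e : op Hypergroup.e = 1
  op_inv : ∀ x, op (Hypergroup.inv x) = ContinuousLinearMap.adjoint (op x)
  op_conv : ∀ (x y : H) (v w : E),
    ∫ z, ⟪v, op z w⟫_ℂ ∂(Hypergroup.conv x y) = ⟪v, op x (op y w)⟫_ℂ
  continuous_op : ∀ v w : E, Continuous fun x => ⟪v, op x w⟫_ℂ

attribute [instance] HGRep.normed HGRep.inner HGRep.complete HGRep.separable

variable (H) in
/-- An irreducible representation: nonzero, without nontrivial closed invariant subspace. -/
structure HGIrrep [Hypergroup H] extends HGRep H where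
  nontrivial : Nontrivial E
  irreducible : ∀ W : Submodule ℂ E, IsClosed (W : Set E) →
    (∀ x, ∀ w ∈ W, op x w ∈ W) → W = ⊥ ∨ W = ⊤

/-- The normalized character `ch(π)(x) = tr π(x) / dim π`. -/
def HGRep.ch [Hypergroup H] (π : HGRep H) (x : H) : ℂ :=
  LinearMap.trace ℂ π.E (π.op x).toLinearMap / (Module.finrank ℂ π.E : ℂ)

/-- The hyperdimension of an irreducible representation: the constant `d` such that
`∫ |π_{ij}|² dω = 1 / d` for all matrix coefficients of `π` in an orthonormal basis. It is written
here through the mean of these `(dim π)²` equal integrals, where `∑_{ij} |π_{ij}|² = tr(π* π)`. -/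
def HGIrrep.hyperdim [Hypergroup H] (π : HGIrrep H) : ℝ :=
  (Module.finrank ℂ π.E : ℝ) ^ 2 / ∫ x,
    (LinearMap.trace ℂ π.E (ContinuousLinearMap.adjoint (π.op x) * π.op x).toLinearMap).re ∂(hgHaar H)

variable (H) in
/-- The trivial irreducible representation `x ↦ 1` on `ℂ`. -/
def HGIrrep.trivial [Hypergroup H] : HGIrrep H where
  E := ℂ
  op := fun _ => 1
  op_e := rfl
  op_inv := fun _ => by
    ext
    simp [← ContinuousLinearMap.star_eq_adjoint]
  op_conv := fun x y v w => by simp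
  continuous_op := fun v w => continuous_const
  nontrivial := inferInstance
  irreducible := fun W _ _ => eq_bot_or_eq_top W

/-! ## The set of characters and strong hypergroups -/

variable (H) in
/-- The set `K(Ĥ) = {ch(π) : π ∈ Ĥ}` of normalized characters, with the discrete topology. -/
def CharSpace [Hypergroup H] : Type u :=
  {f : H → ℂ // ∃ π : HGIrrep H, f = π.ch}

instance [Hypergroup H] : TopologicalSpace (CharSpace H) := ⊥
instance [Hypergroup H] : DiscreteTopology (CharSpace H) := ⟨rfl⟩
instance [Hypergroup H] : MeasurableSpace (CharSpace H) := ⊤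
instance [Hypergroup H] : BorelSpace (CharSpace H) :=
  ⟨by rw [borel_eq_top_of_discrete]; rfl⟩

variable (H) in
/-- `H` is of strong type: `K(Ĥ)` is a (discrete) hypergroup, the convolution of two characters
being their pointwise product, written as a mixture of characters. -/
def IsStrong [Hypergroup H] : Prop :=
  ∃ K : Hypergroup (CharSpace H), ∀ (χ ψ : CharSpace H) (x : H),
    ∫ ρ, ρ.1 x ∂(K.conv χ ψ) = χ.1 x * ψ.1 x

/-! ## Subhypergroups -/

variable (H) in
/-- A (closed) subhypergroup. -/
structure Subhypergroup [Hypergroup H] where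
  /-- The underlying set. -/
  carrier : Set H
  isClosed : IsClosed carrier
  nonempty : carrier.Nonempty
  inv_mem : ∀ x ∈ carrier, Hypergroup.inv x ∈ carrier
  support_subset : ∀ x ∈ carrier, ∀ y ∈ carrier, (Hypergroup.conv x y).support ⊆ carrier

instance [Hypergroup H] : CoeSort (Subhypergroup H) (Type u) := ⟨fun S => ↥S.carrier⟩

namespace Subhypergroup

variable [Hypergroup H] (S : Subhypergroup H)

instance : CompactSpace S := isCompact_iff_compactSpace.mp S.isClosed.isCompact

theorem e_mem : (Hypergroup.e : H) ∈ S.carrier := by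
  obtain ⟨x, hx⟩ := S.nonempty
  exact S.support_subset x hx _ (S.inv_mem x hx)
    ((Hypergroup.e_mem_support_iff x (Hypergroup.inv x)).2 rfl)

theorem mEmb : MeasurableEmbedding (Subtype.val : S → H) :=
  MeasurableEmbedding.subtype_coe S.isClosed.measurableSet

theorem conv_compl (x y : S) : Hypergroup.conv (x : H) (y : H) S.carrierᶜ = 0 :=
  measure_mono_null (Set.compl_subset_compl.2 (S.support_subset x x.2 y y.2))
    Measure.measure_compl_support_of_regular

/-- The convolution of `H` restricted to a subhypergroup. -/
def subConv (x y : S) : Measure S := (Hypergroup.conv (x : H) (y : H)).comap Subtype.val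

theorem map_subConv (x y : S) : (S.subConv x y).map Subtype.val = Hypergroup.conv (x : H) y := by
  rw [subConv, S.mEmb.map_comap, Subtype.range_coe, Measure.restrict_eq_self_of_ae_mem]
  exact mem_ae_iff.2 (S.conv_compl x y)

theorem integral_subConv {F : Type*} [NormedAddCommGroup F] [NormedSpace ℝ F] (x y : S)
    (f : H → F) : ∫ z : S, f z ∂(S.subConv x y) = ∫ z, f z ∂(Hypergroup.conv (x : H) y) := by
  rw [← S.map_subConv, S.mEmb.integral_map]

theorem subConv_preimage (x y : S) (U : Set H) :
    S.subConv x y (Subtype.val ⁻¹' U) = Hypergroup.conv (x : H) y U := by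
  rw [← S.map_subConv, S.mEmb.map_apply]

theorem support_subConv (x y : S) :
    (S.subConv x y).support = Subtype.val ⁻¹' (Hypergroup.conv (x : H) (y : H)).support := by
  ext z
  have hb := (𝓝 (z : H)).basis_sets.comap (Subtype.val : S → H)
  rw [← nhds_subtype] at hb
  rw [Set.mem_preimage, (𝓝 (z : H)).basis_sets.mem_measureSupport, hb.mem_measureSupport]
  simp only [id, subConv_preimage]

theorem regular_subConv (x y : S) : (S.subConv x y).Regular := by
  have hfin : ∀ s : Set S, S.subConv x y s = Hypergroup.conv (x : H) (y : H) (Subtype.val '' s) :=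
    fun s => S.mEmb.comap_apply _ s
  refine { lt_top_of_isCompact := fun K _ => ?_, outerRegular := fun A hA r hr => ?_,
           innerRegular := fun U hU r hr => ?_ }
  · rw [hfin]
    exact measure_lt_top _ _
  · rw [hfin] at hr
    obtain ⟨U, hAU, hU, hUr⟩ := Set.exists_isOpen_lt_of_lt _ _ hr
    refine ⟨Subtype.val ⁻¹' U, Set.image_subset_iff.1 hAU,
      hU.preimage continuous_subtype_val, ?_⟩
    rwa [subConv_preimage]
  · rw [hfin] at hr
    obtain ⟨K, hKU, hK, hrK⟩ := (S.mEmb.measurableSet_image.2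
      hU.measurableSet).exists_lt_isCompact_of_ne_top (measure_ne_top _ _) hr
    refine ⟨Subtype.val ⁻¹' K, ?_,
      S.isClosed.isClosedEmbedding_subtypeVal.isCompact_preimage hK, ?_⟩
    · intro z hz
      obtain ⟨w, hw, hwz⟩ := hKU hz
      rwa [← Subtype.ext hwz]
    · rwa [subConv_preimage]

theorem exists_extension (f : S →ᵇ ℝ) : ∃ g : H →ᵇ ℝ, ∀ z : S, g z = f z := by
  obtain ⟨g, -, hg⟩ := BoundedContinuousFunction.exists_extension_norm_eq_of_isClosedEmbedding f
    S.isClosed.isClosedEmbedding_subtypeVal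
  exact ⟨g, fun z => congrFun hg z⟩

/-- A subhypergroup is a hypergroup with the restricted convolution. -/
instance hypergroup : Hypergroup S where
  conv := S.subConv
  e := ⟨Hypergroup.e, S.e_mem⟩
  inv x := ⟨Hypergroup.inv (x : H), S.inv_mem x x.2⟩
  isProbabilityMeasure x y := ⟨by
    rw [← Set.preimage_univ (f := (Subtype.val : S → H)), subConv_preimage, measure_univ]⟩
  regular x y := S.regular_subConv x y
  isCompact_support x y := Measure.isClosed_support.isCompact
  weaklyContinuous f := by
    obtain ⟨g, hg⟩ := S.exists_extension f
    simp_rw [← hg, S.integral_subConv _ _ g]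
    exact (Hypergroup.weaklyContinuous g).comp
      ((continuous_subtype_val.comp continuous_fst).prodMk
        (continuous_subtype_val.comp continuous_snd))
  assoc x y z f := by
    obtain ⟨g, hg⟩ := S.exists_extension f
    simp_rw [← hg, S.integral_subConv _ _ g]
    rw [S.integral_subConv x y fun w => ∫ t, g t ∂(Hypergroup.conv w (z : H)),
      S.integral_subConv y z fun w => ∫ t, g t ∂(Hypergroup.conv (x : H) w)]
    exact Hypergroup.assoc _ _ _ g
  conv_e x := by
    ext s hs
    rw [subConv, S.mEmb.comap_apply, Hypergroup.conv_e,
      Measure.dirac_apply' _ (S.mEmb.measurableSet_image.2 hs), Measure.dirac_apply' _ hs]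
    by_cases h : x ∈ s <;> simp [h]
  e_conv x := by
    ext s hs
    rw [subConv, S.mEmb.comap_apply, Hypergroup.e_conv,
      Measure.dirac_apply' _ (S.mEmb.measurableSet_image.2 hs), Measure.dirac_apply' _ hs]
    by_cases h : x ∈ s <;> simp [h]
  continuous_inv := (Hypergroup.continuous_inv.comp continuous_subtype_val).subtype_mk _
  inv_inv x := Subtype.ext (Hypergroup.inv_inv _)
  e_mem_support_iff x y := by
    rw [support_subConv, Set.mem_preimage, Hypergroup.e_mem_support_iff, Subtype.ext_iff]
  map_inv_conv x y := by
    have hc : Continuous fun x : S => (⟨Hypergroup.inv (x : H), S.inv_mem x x.2⟩ : S) :=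
      (Hypergroup.continuous_inv.comp continuous_subtype_val).subtype_mk _
    ext s hs
    obtain ⟨t, ht, rfl⟩ := hs
    rw [Measure.map_apply hc.measurable (measurable_subtype_coe ht), subConv_preimage,
      ← Hypergroup.map_inv_conv, Measure.map_apply Hypergroup.continuous_inv.measurable ht,
      ← subConv_preimage]
    rfl
  continuous_support := by
    have hc : Continuous fun p : S × S => ((p.1 : H), (p.2 : H)) :=
      (continuous_subtype_val.comp continuous_fst).prodMk
        (continuous_subtype_val.comp continuous_snd)
    have key := (Hypergroup.continuous_support (X := H))
    refine continuous_generateFrom_iff.2 ?_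
    have key' := continuous_generateFrom_iff.1 key
    rintro _ (⟨_, ⟨V, hV, rfl⟩, rfl⟩ | ⟨_, ⟨V, hV, rfl⟩, rfl⟩)
    · convert (key' _ (Or.inl ⟨V, hV, rfl⟩)).preimage hc using 1
      ext p
      simp only [Set.mem_preimage, Set.mem_powerset_iff, support_subConv]
      exact ⟨fun h z hz => h (a := ⟨z, S.support_subset _ p.1.2 _ p.2.2 hz⟩) hz,
        fun h z hz => h hz⟩
    · convert (key' _ (Or.inr ⟨V, hV, rfl⟩)).preimage hc using 1
      ext p
      simp only [Set.mem_preimage, support_subConv]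
      exact ⟨fun ⟨z, hz⟩ => ⟨z, hz⟩,
        fun ⟨z, hz⟩ => ⟨⟨z, S.support_subset _ p.1.2 _ p.2.2 hz.1⟩, hz⟩⟩

/-- `|H / H₀| < ∞`: there are finitely many cosets `x * H₀ = ⋃_{h ∈ H₀} supp (ε_x * ε_h)`. -/
def HasFiniteQuotient : Prop :=
  (Set.range fun x : H => ⋃ h ∈ S.carrier, (Hypergroup.conv x h).support).Finite

/-! ## Induced representations and induced characters -/

variable {S}

/-- The space of the induced representation: all `ξ ∈ L²(H, E_τ)` with
`(ε_h * ε_x)(ξ) = τ(h) ξ(x)` for `h ∈ H₀` and (almost) all `x`. -/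
def indSpace (τ : HGRep S) : Set (Lp τ.E 2 (hgHaar H)) :=
  {ξ | ∀ h : S, ∀ᵐ x ∂(hgHaar H), ∫ z, ξ z ∂(Hypergroup.conv (h : H) x) = τ.op h (ξ x)}

/-- `ind τ ≅ π_1 ⊕ ⋯ ⊕ π_m`: a unitary map from the Hilbert sum of the `π_j` onto the space of the
induced representation, which intertwines `π_1 ⊕ ⋯ ⊕ π_m` with the action
`(ind τ (h) ξ)(x) = (ε_x * ε_h)(ξ)`. -/
def IsIndDecomposition (τ : HGRep S) {m : ℕ} (π : Fin m → HGIrrep H) : Prop :=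
  ∃ T : PiLp 2 (fun j => (π j).E) →ₗᵢ[ℂ] Lp τ.E 2 (hgHaar H),
    Set.range T = indSpace τ ∧
    ∀ (h : H) (v : PiLp 2 (fun j => (π j).E)),
      (T (WithLp.toLp 2 fun j => (π j).op h (v j)) : H → τ.E) =ᵐ[hgHaar H]
        fun x => ∫ z, (T v) z ∂(Hypergroup.conv x h)

open Classical in
/-- The induced character
`ind ch(τ) = ∑_j (d(π_j) / d(π)) ch(π_j)`, where `ind τ ≅ π_1 ⊕ ⋯ ⊕ π_m` and
`d(π) = d(π_1) + ⋯ + d(π_m)`. -/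
def indCh (τ : HGIrrep S) (x : H) : ℂ :=
  if h : ∃ D : (m : ℕ) × (Fin m → HGIrrep H), IsIndDecomposition τ.toHGRep D.2 then
    ∑ j, (((h.choose.2 j).hyperdim / ∑ i, (h.choose.2 i).hyperdim : ℝ) : ℂ) * (h.choose.2 j).ch x
  else 0

open Classical in
/-- Linear extension of the induction of characters: for `f = ∑_k a_k ch(τ_k)`, with irreducible
`τ_k`, `ind f = ∑_k a_k ind ch(τ_k)`. -/
def ind (f : S → ℂ) (x : H) : ℂ :=
  if h : ∃ D : (m : ℕ) × (Fin m → ℂ) × (Fin m → HGIrrep S),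
      ∀ y, f y = ∑ k, D.2.1 k * (D.2.2 k).ch y then
    ∑ k, h.choose.2.1 k * indCh (h.choose.2.2 k) x
  else 0

/-- Restriction of functions from `H` to `H₀`. -/
def res (f : H → ℂ) (y : S) : ℂ := f y

variable (S)

/-- `(H, H₀)` is an admissible hypergroup pair. -/
def IsAdmissiblePair : Prop :=
  (∀ (π : HGIrrep H) (τ : HGIrrep S),
    ind (res (S := S) π.ch * τ.ch) = π.ch * ind τ.ch) ∧
  (∀ τ : HGIrrep S,
    res (S := S) (ind τ.ch) = τ.ch * res (ind (HGIrrep.trivial S).ch))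

/-! ## The twisted convolution -/

/-- The set `K(Ĥ ∪ Ĥ₀, ℤ_q(2))` of the elements `(ch(π), ∘)` (left) and `(ch(τ), •)` (right), with
the discrete topology. -/
def TwistedSpace : Type u := CharSpace H ⊕ CharSpace S

instance : TopologicalSpace S.TwistedSpace := ⊥
instance : DiscreteTopology S.TwistedSpace := ⟨rfl⟩
instance : MeasurableSpace S.TwistedSpace := ⊤
instance : BorelSpace S.TwistedSpace := ⟨by rw [borel_eq_top_of_discrete]; rfl⟩

variable {S}

/-- The `q`-twisted product of two elements of `K(Ĥ ∪ Ĥ₀, ℤ_q(2))`; the pair `(f, g)` stands for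
`(f, ∘) + (g, •)`. -/
def twistedProd (q : ℝ) : S.TwistedSpace → S.TwistedSpace → (H → ℂ) × (S → ℂ)
  | .inl χ, .inl ψ => (χ.1 * ψ.1, 0)
  | .inl χ, .inr σ => (0, res χ.1 * σ.1)
  | .inr σ, .inl χ => (0, σ.1 * res χ.1)
  | .inr σ, .inr ρ => ((q : ℂ) • ind (σ.1 * ρ.1), (1 - q : ℂ) • (σ.1 * ρ.1))

/-- The function on `H` of an element of `K(Ĥ ∪ Ĥ₀, ℤ_q(2))`: `ch(π)` for `(ch(π), ∘)`, and `0`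
for `(ch(τ), •)`. -/
def TwistedSpace.circ : S.TwistedSpace → H → ℂ
  | .inl χ => χ.1
  | .inr _ => 0

/-- The function on `H₀` of an element of `K(Ĥ ∪ Ĥ₀, ℤ_q(2))`: `0` for `(ch(π), ∘)`, and `ch(τ)`
for `(ch(τ), •)`. -/
def TwistedSpace.bullet : S.TwistedSpace → S → ℂ
  | .inl _ => 0
  | .inr σ => σ.1

/-- `conv` is the `q`-twisted convolution on `K(Ĥ ∪ Ĥ₀, ℤ_q(2))`: the measure `conv a b` is the
expansion of the twisted product of `a` and `b` as a mixture of elements `(ch(π), ∘)` and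
`(ch(τ), •)`. -/
def IsTwistedConvolution (q : ℝ)
    (conv : S.TwistedSpace → S.TwistedSpace → Measure S.TwistedSpace) : Prop :=
  ∀ a b : S.TwistedSpace,
    (∀ x : H, ∫ k, k.circ x ∂(conv a b) = (twistedProd q a b).1 x) ∧
    (∀ y : S, ∫ k, k.bullet y ∂(conv a b) = (twistedProd q a b).2 y)

end Subhypergroup

end Compact

end

/-!
The twisted convolution is the restriction to characters of a bilinear product on pairs `(f, g)` of a
combination `f` of characters of `H` and a combination `g` of characters of `H₀` (`twistedMul`),
`(f, g) (f', g') = (f f' + q ind (g g'), res f g' + g res f' + (1 - q) g g')`.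
The characters of a strong hypergroup are linearly independent, so a convolution realizing this product
is associative exactly if the product is associative on characters (`structureConstants_assoc_iff`).
Comparing first components for the triple `(π, ∘), (τ, •), (τ₀, •)` gives the first condition of an
admissible pair, and comparing second components for `(τ, •), (τ₀, •), (τ₀, •)` gives the second one
(`isAdmissiblePair_of_hypergroup`). Conversely the two conditions extend to linear combinations of
characters and yield associativity (`IsAdmissibleInduction.twistedMul_assoc`).

For the other axioms of a hypergroup, the conditions have to be complemented by facts on induction.

* Induction has to be a linear map: an induced character depends on the character `ch τ` only, since
  irreducible representations with equal characters are unitarily equivalent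
  (`HGIrrep.exists_linearIsometryEquiv`, a consequence of Burnside's theorem).
* The coefficients are nonnegative: restrictions of representations are completely reducible
  (`HGRep.exists_decomposition`), and induced characters are mixtures by definition.
* The total mass is `1`: by the second condition, `ind τ` takes the value `1` at `e` as soon as `ind τ₀`
  does, that is, as soon as the representation induced from the trivial one decomposes
  (`HasFiniteQuotient.exists_isIndDecomposition`). Its space consists of the functions constant on the
  finitely many cosets `H₀ * x`, on which `H` acts by a finite matrix that is a `*`-representation by a
  detailed balance relation (`CosetMap.weight_mul_transition`).
* The neutral element occurs in a product exactly if the factors are conjugate to each other: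
  `∫ ind g dω_H = c ∫ g dω_{H₀}` with `c > 0` (`IsInduction.exists_integral_eq`), because a translation
  invariant function in the induced space is constant, so that the trivial representation is contained
  in `ind τ` only for trivial `τ`.
* The involution reverses products: induction commutes with complex conjugation, as one sees on Fourier
  coefficients (`IsAdmissibleInduction.conj_apply`).

All this rests on orthogonality of characters, which needs the Haar measure. It is obtained from a
stationary measure of a probability measure of full support (`exists_stationary`), whose translates
agree by the maximum principle (`eq_of_harmonic`).
-/

set_option linter.unusedSectionVars false

/-! ### Supports and the convolution kernel -/

open ProbabilityTheory in
theorem integral_bind_kernel {α β E : Type*} [MeasurableSpace α] [MeasurableSpace β]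
    [NormedAddCommGroup E] [NormedSpace ℝ E] (κ : Kernel α β) (μ : Measure α) {f : β → E}
    (hf : Integrable f (μ.bind κ)) :
    ∫ z, f z ∂(μ.bind κ) = ∫ x, ∫ z, f z ∂(κ x) ∂μ := by
  rw [Measure.comp_eq_comp_const_apply] at hf ⊢
  rw [Kernel.integral_comp hf, Kernel.const_apply]

theorem Continuous.integrable_of_compactSpace {Y E : Type*} [TopologicalSpace Y] [CompactSpace Y]
    [MeasurableSpace Y] [OpensMeasurableSpace Y] [NormedAddCommGroup E]
    {f : Y → E} (hf : Continuous f) (μ : Measure Y) [IsFiniteMeasure μ] : Integrable f μ :=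
  hf.integrable_of_hasCompactSupport (HasCompactSupport.of_compactSpace f)

theorem integral_eq_zero_iff_support {X : Type*} [TopologicalSpace X] [CompactSpace X]
    [MeasurableSpace X] [OpensMeasurableSpace X] (μ : Measure X) [IsFiniteMeasure μ]
    (hμ : μ μ.supportᶜ = 0) {f : X → ℝ} (hfc : Continuous f) (hf : ∀ x, 0 ≤ f x) :
    ∫ x, f x ∂μ = 0 ↔ ∀ x ∈ μ.support, f x = 0 := by
  rw [integral_eq_zero_iff_of_nonneg hf (hfc.integrable_of_compactSpace μ)]
  constructor
  · intro h x hx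
    by_contra hne
    have hU : f ⁻¹' {0}ᶜ ∈ 𝓝 x := (isOpen_compl_singleton.preimage hfc).mem_nhds hne
    exact (Measure.mem_support_iff_forall x |>.1 hx _ hU).ne' (mem_ae_iff.1 h)
  · intro h
    refine mem_ae_iff.2 (measure_mono_null (fun x hx => ?_) hμ)
    exact fun hx' => hx (h x hx')

theorem measure_ext_of_continuous {X : Type*} [TopologicalSpace X] [CompactSpace X] [T2Space X]
    [SecondCountableTopology X] [MeasurableSpace X] [BorelSpace X]
    {μ ν : Measure X} [IsFiniteMeasure μ] [IsFiniteMeasure ν]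
    (h : ∀ f : X → ℝ, Continuous f → ∫ x, f x ∂μ = ∫ x, f x ∂ν) : μ = ν :=
  ext_of_forall_integral_eq_of_IsFiniteMeasure fun f => h f f.continuous

namespace Hypergroup

section Basic

variable {X : Type u} [TopologicalSpace X] [CompactSpace X] [T2Space X] [MeasurableSpace X]
  [BorelSpace X] [Hypergroup X]

/-- The support of `ε_x * ε_y`. -/
def supp (x y : X) : Set X := (conv x y).support

theorem conv_compl_supp (x y : X) : conv x y (supp x y)ᶜ = 0 :=
  Measure.measure_compl_support_of_regular

theorem isClosed_supp (x y : X) : IsClosed (supp x y) := Measure.isClosed_support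

theorem supp_nonempty (x y : X) : (supp x y).Nonempty := by
  by_contra h
  have h1 := conv_compl_supp x y
  rw [Set.not_nonempty_iff_eq_empty.1 h, Set.compl_empty, measure_univ] at h1
  exact one_ne_zero h1

theorem ae_mem_supp (x y : X) : ∀ᵐ z ∂(conv x y), z ∈ supp x y :=
  mem_ae_iff.2 (conv_compl_supp x y)

theorem continuous_integral_conv_real {f : X → ℝ} (hf : Continuous f) :
    Continuous fun p : X × X => ∫ z, f z ∂(conv p.1 p.2) :=
  weaklyContinuous (BoundedContinuousFunction.mkOfCompact ⟨f, hf⟩)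

theorem continuous_integral_conv_real_comp {Y : Type*} [TopologicalSpace Y] {f : X → ℝ}
    (hf : Continuous f) {a b : Y → X} (ha : Continuous a) (hb : Continuous b) :
    Continuous fun y => ∫ z, f z ∂(conv (a y) (b y)) :=
  (continuous_integral_conv_real hf).comp (ha.prodMk hb)

theorem assoc_real (x y z : X) {f : X → ℝ} (hf : Continuous f) :
    ∫ w, (∫ t, f t ∂(conv w z)) ∂(conv x y) = ∫ w, (∫ t, f t ∂(conv x w)) ∂(conv y z) :=
  assoc x y z (BoundedContinuousFunction.mkOfCompact ⟨f, hf⟩)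

theorem supp_e (x : X) : supp x e = {x} := by
  ext z
  rw [supp, conv_e, Measure.mem_support_iff_forall]
  constructor
  · intro h
    by_contra hz
    have := h _ (isOpen_compl_singleton.mem_nhds hz)
    rw [Measure.dirac_apply' _ isOpen_compl_singleton.measurableSet] at this
    simp at this
  · rintro rfl U hU
    rw [Measure.dirac_apply_of_mem (mem_of_mem_nhds hU)]
    exact one_pos

theorem e_supp (x : X) : supp e x = {x} := by
  rw [← supp_e, supp, supp, e_conv, conv_e]

theorem mem_supp_inv {x y z : X} : z ∈ supp x y ↔ inv z ∈ supp (inv y) (inv x) := by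
  have key : ∀ {x y z : X}, z ∈ supp x y → inv z ∈ supp (inv y) (inv x) := by
    intro x y z hz
    rw [supp, ← map_inv_conv, Measure.mem_support_iff_forall]
    intro U hU
    obtain ⟨V, hVU, hV, hzV⟩ := mem_nhds_iff.1 hU
    refine lt_of_lt_of_le ?_ (measure_mono hVU)
    rw [Measure.map_apply continuous_inv.measurable hV.measurableSet]
    exact (Measure.mem_support_iff_forall _).1 hz _
      ((hV.preimage continuous_inv).mem_nhds hzV)
  refine ⟨key, fun h => ?_⟩
  have := key h
  simpa only [inv_inv] using this

theorem isClosed_setOf_mem_supp : IsClosed {p : (X × X) × X | p.2 ∈ supp p.1.1 p.1.2} := by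
  rw [← isOpen_compl_iff, isOpen_iff_mem_nhds]
  rintro ⟨p, z⟩ hz
  obtain ⟨U, V, hU, hV, hsU, hzV, hUV⟩ := SeparatedNhds.of_isCompact_isClosed
    (isClosed_supp p.1 p.2).isCompact (isClosed_singleton (x := z))
    (Set.disjoint_singleton_right.2 hz)
  have hO := (vietoris.continuous_iff.1 (continuous_support (X := X))).1 U hU
  filter_upwards [(hO.prod hV).mem_nhds ⟨hsU, hzV rfl⟩]
  rintro ⟨p', z'⟩ ⟨h1, h2⟩ h3
  exact Set.disjoint_left.1 hUV (h1 h3) h2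

/-- The product set `A * {y}`. -/
def mulRight (A : Set X) (y : X) : Set X := ⋃ a ∈ A, supp a y

/-- The product set `{x} * A`. -/
def mulLeft (x : X) (A : Set X) : Set X := ⋃ a ∈ A, supp x a

theorem isClosed_mulRight {A : Set X} (hA : IsClosed A) (y : X) : IsClosed (mulRight A y) := by
  have h : IsClosed ({p : X × X | p.1 ∈ A} ∩ {p : X × X | p.2 ∈ supp p.1 y}) :=
    (hA.preimage continuous_fst).inter
      (isClosed_setOf_mem_supp.preimage
        ((continuous_fst.prodMk continuous_const).prodMk continuous_snd))
  convert isClosedMap_snd_of_compactSpace _ h using 1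
  ext z
  simp [mulRight]

theorem isClosed_mulLeft (x : X) {A : Set X} (hA : IsClosed A) : IsClosed (mulLeft x A) := by
  have h : IsClosed ({p : X × X | p.1 ∈ A} ∩ {p : X × X | p.2 ∈ supp x p.1}) :=
    (hA.preimage continuous_fst).inter
      (isClosed_setOf_mem_supp.preimage
        ((continuous_const.prodMk continuous_fst).prodMk continuous_snd))
  convert isClosedMap_snd_of_compactSpace _ h using 1
  ext z
  simp [mulLeft]

theorem iterated_integral_eq_zero_iff {x y : X} {F : X → X × X} (hF : Continuous F)
    {f : X → ℝ} (hfc : Continuous f) (hf : ∀ x, 0 ≤ f x) :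
    ∫ w, (∫ t, f t ∂(conv (F w).1 (F w).2)) ∂(conv x y) = 0 ↔
      ∀ t ∈ ⋃ w ∈ supp x y, supp (F w).1 (F w).2, f t = 0 := by
  have h := integral_eq_zero_iff_support _ (conv_compl_supp x y)
    ((continuous_integral_conv_real hfc).comp hF) fun w => integral_nonneg hf
  refine h.trans ?_
  simp only [Set.mem_iUnion, Function.comp_apply]
  constructor
  · rintro h t ⟨w, hw, ht⟩
    exact (integral_eq_zero_iff_support _ (conv_compl_supp _ _) hfc hf).1 (h w hw) t ht
  · intro h w hw
    exact (integral_eq_zero_iff_support _ (conv_compl_supp _ _) hfc hf).2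
      fun t ht => h t ⟨w, hw, ht⟩

theorem isClosed_eq_of_forall_vanish {Y : Type*} [TopologicalSpace Y] [CompactSpace Y] [T2Space Y]
    {A B : Set Y} (hA : IsClosed A) (hB : IsClosed B)
    (h : ∀ f : Y → ℝ, Continuous f → (∀ x, 0 ≤ f x) →
      ((∀ t ∈ A, f t = 0) ↔ ∀ t ∈ B, f t = 0)) : A = B := by
  have key : ∀ {A B : Set Y}, IsClosed A → (∀ f : Y → ℝ, Continuous f → (∀ x, 0 ≤ f x) →
      (∀ t ∈ A, f t = 0) → ∀ t ∈ B, f t = 0) → B ⊆ A := by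
    intro A B hA h x hxB
    by_contra hxA
    obtain ⟨f, hf0, hf1, hf⟩ := exists_continuous_zero_one_of_isClosed hA
      (isClosed_singleton (x := x)) (Set.disjoint_singleton_right.2 hxA)
    have := h f f.continuous (fun y => (hf y).1) hf0 x hxB
    rw [hf1 rfl] at this
    exact one_ne_zero this
  exact (key hB fun f a b c => (h f a b).2 c).antisymm (key hA fun f a b c => (h f a b).1 c)

/-- Associativity of the convolution, for supports. -/
theorem mulRight_supp (x y z : X) : mulRight (supp x y) z = mulLeft x (supp y z) := by
  refine isClosed_eq_of_forall_vanish (isClosed_mulRight (isClosed_supp x y) z)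
    (isClosed_mulLeft x (isClosed_supp y z)) fun f hfc hf => ?_
  have h1 := iterated_integral_eq_zero_iff (x := x) (y := y) (F := fun w => (w, z))
    (by fun_prop) hfc hf
  have h2 := iterated_integral_eq_zero_iff (x := y) (y := z) (F := fun w => (x, w))
    (by fun_prop) hfc hf
  rw [mulRight, mulLeft, ← h1, ← h2, assoc_real x y z hfc]

theorem mem_supp_left {x y z : X} : z ∈ supp x y ↔ y ∈ supp (inv x) z := by
  have key : ∀ {x y z : X}, z ∈ supp x y → y ∈ supp (inv x) z := by
    intro x y z hz
    have h1 : e ∈ mulLeft (inv z) (supp x y) := by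
      refine Set.mem_biUnion hz ?_
      exact (e_mem_support_iff _ _).2 (inv_inv z).symm
    rw [← mulRight_supp] at h1
    obtain ⟨w, hw, hew⟩ := Set.mem_iUnion₂.1 h1
    rw [(e_mem_support_iff _ _).1 hew]
    have := mem_supp_inv.1 hw
    rwa [inv_inv] at this
  refine ⟨key, fun h => ?_⟩
  have := key h
  rwa [inv_inv] at this

theorem mem_supp_right {x y z : X} : z ∈ supp x y ↔ x ∈ supp z (inv y) := by
  rw [mem_supp_inv, mem_supp_left, inv_inv, mem_supp_inv (x := z), inv_inv]

theorem exists_mem_supp_left (x z : X) : ∃ y, z ∈ supp x y := by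
  obtain ⟨y, hy⟩ := supp_nonempty (inv x) z
  exact ⟨y, mem_supp_left.2 hy⟩

theorem exists_mem_supp_right (y z : X) : ∃ x, z ∈ supp x y := by
  obtain ⟨x, hx⟩ := supp_nonempty z (inv y)
  exact ⟨x, mem_supp_right.2 hx⟩

end Basic

section Kernel

open ProbabilityTheory Filter

variable {X : Type u} [TopologicalSpace X] [CompactSpace X] [T2Space X]
  [SecondCountableTopology X] [MeasurableSpace X] [BorelSpace X] [Hypergroup X]

theorem measurable_conv : Measurable fun p : X × X => conv p.1 p.2 := by
  refine Measurable.measure_of_isPiSystem_of_isProbabilityMeasure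
    (S := {F : Set X | IsClosed F}) ?_ isPiSystem_isClosed fun F hF => ?_
  · rw [BorelSpace.measurable_eq (α := X), borel_eq_generateFrom_isClosed]
  · refine measurable_of_tendsto_metrizable (f := fun n p => ∫⁻ x, hF.apprSeq n x ∂conv p.1 p.2)
      (fun n => ?_) (tendsto_pi_nhds.2 fun p =>
        HasOuterApproxClosed.tendsto_lintegral_apprSeq hF (conv p.1 p.2))
    have hc : Continuous fun x => ((hF.apprSeq n x : NNReal) : ℝ) := by fun_prop
    have h := (continuous_integral_conv_real hc).measurable.ennreal_ofReal
    convert h using 2 with p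
    rw [ofReal_integral_eq_lintegral_ofReal (hc.integrable_of_compactSpace _)
      (ae_of_all _ fun x => NNReal.coe_nonneg _)]
    simp

variable (X) in
/-- The convolution `(x, y) ↦ ε_x * ε_y` as a Markov kernel. -/
noncomputable def convKernel : Kernel (X × X) X := ⟨fun p => conv p.1 p.2, measurable_conv⟩

instance : IsMarkovKernel (convKernel X) := ⟨fun p => isProbabilityMeasure p.1 p.2⟩

/-- The kernel `x ↦ ε_x * ε_y`. -/
noncomputable def kernelRight (y : X) : Kernel X X :=
  ⟨fun x => conv x y, measurable_conv.comp (measurable_id.prodMk measurable_const)⟩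

/-- The kernel `y ↦ ε_x * ε_y`. -/
noncomputable def kernelLeft (x : X) : Kernel X X :=
  ⟨fun y => conv x y, measurable_conv.comp (measurable_const.prodMk measurable_id)⟩

instance (y : X) : IsMarkovKernel (kernelRight y) := ⟨fun x => isProbabilityMeasure x y⟩
instance (x : X) : IsMarkovKernel (kernelLeft x) := ⟨fun y => isProbabilityMeasure x y⟩

theorem kernelRight_apply (x y : X) : kernelRight y x = conv x y := rfl
end Kernel

end Hypergroup

/-! ### Haar measure -/

namespace Hypergroup

open ProbabilityTheory Filter

variable {X : Type u} [TopologicalSpace X] [CompactSpace X] [T2Space X]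
  [SecondCountableTopology X] [MeasurableSpace X] [BorelSpace X] [Hypergroup X]

theorem exists_isProbabilityMeasure_isOpenPosMeasure (Y : Type*) [TopologicalSpace Y]
    [SeparableSpace Y] [Nonempty Y] [MeasurableSpace Y] [BorelSpace Y] :
    ∃ ρ : Measure Y, IsProbabilityMeasure ρ ∧ ρ.IsOpenPosMeasure := by
  obtain ⟨ν, hν, hpos⟩ : ∃ ν : Measure ℕ, IsProbabilityMeasure ν ∧ ∀ n, 0 < ν {n} := by
    let w : ℕ → ENNReal := fun n => 2⁻¹ ^ (n + 1)
    let p : PMF ℕ := ⟨w, by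
      have h : ∑' n, w n = 1 := by
        rw [ENNReal.tsum_geometric_add_one, ENNReal.one_sub_inv_two, _root_.inv_inv]
        exact ENNReal.inv_mul_cancel two_ne_zero ENNReal.ofNat_ne_top
      exact h ▸ ENNReal.summable.hasSum⟩
    refine ⟨p.toMeasure, inferInstance, fun n => ?_⟩
    rw [PMF.toMeasure_apply_singleton _ _ (measurableSet_singleton n)]
    exact ENNReal.pow_pos (by simp) _
  have hm : Measurable (denseSeq Y) := measurable_from_nat
  refine ⟨ν.map (denseSeq Y), Measure.isProbabilityMeasure_map hm.aemeasurable, ⟨?_⟩⟩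
  intro U hU hne
  obtain ⟨_, hyU, ⟨n, rfl⟩⟩ := (denseRange_denseSeq Y).inter_open_nonempty U hU hne
  rw [Measure.map_apply hm hU.measurableSet]
  exact ((hpos n).trans_le (measure_mono (Set.singleton_subset_iff.2 hyU))).ne'

theorem continuous_integral_left {Y Z E : Type*} [TopologicalSpace Y] [FirstCountableTopology Y]
    [LocallyCompactSpace Y] [TopologicalSpace Z] [CompactSpace Z]
    [MeasurableSpace Z] [OpensMeasurableSpace Z] [SecondCountableTopology Z]
    [NormedAddCommGroup E] [NormedSpace ℝ E] (μ : Measure Z) [IsFiniteMeasure μ] {f : Y → Z → E}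
    (hf : Continuous (Function.uncurry f)) : Continuous fun y => ∫ z, f y z ∂μ := by
  simpa using continuous_parametric_integral_of_continuous (μ := μ) hf isCompact_univ

/-- A continuous function that is a mean of its translates with respect to a measure of full
support is constant: its maximum propagates to the whole space. -/
theorem eq_of_harmonic {ρ : Measure X} [IsProbabilityMeasure ρ] [ρ.IsOpenPosMeasure] {g : X → ℝ}
    (hg : Continuous g) (h : ∀ x, g x = ∫ y, ∫ z, g z ∂(conv x y) ∂ρ) (x z : X) : g x = g z := by
  have : Nonempty X := ⟨e⟩
  obtain ⟨m, -, hm⟩ := isCompact_univ.exists_isMaxOn Set.univ_nonempty hg.continuousOn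
  have hm' : ∀ t, 0 ≤ g m - g t := fun t => sub_nonneg.2 (hm (Set.mem_univ t))
  have hc : Continuous fun t => g m - g t := continuous_const.sub hg
  have hin : ∀ y, ∫ z, (g m - g z) ∂(conv m y) = g m - ∫ z, g z ∂(conv m y) := fun y => by
    rw [integral_sub (integrable_const _) (hg.integrable_of_compactSpace _)]
    simp
  have hc2 : Continuous fun y => ∫ z, (g m - g z) ∂(conv m y) :=
    (continuous_integral_conv_real hc).comp (continuous_const.prodMk continuous_id)
  have hc3 : Continuous fun y => ∫ z, g z ∂(conv m y) :=
    (continuous_integral_conv_real hg).comp (continuous_const.prodMk continuous_id)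
  have h0 : ∫ y, ∫ z, (g m - g z) ∂(conv m y) ∂ρ = 0 := by
    simp_rw [hin]
    rw [integral_sub (integrable_const _) (hc3.integrable_of_compactSpace _), ← h m]
    simp
  have h1 : ∀ y, ∫ z, (g m - g z) ∂(conv m y) = 0 := by
    rw [integral_eq_zero_iff_of_nonneg (fun y => integral_nonneg hm')
      (hc2.integrable_of_compactSpace _)] at h0
    exact fun y => congrFun ((Continuous.ae_eq_iff_eq ρ hc2 continuous_const).1 h0) y
  have h2 : ∀ t, g t = g m := fun t => by
    obtain ⟨y, hy⟩ := exists_mem_supp_left m t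
    have := (integral_eq_zero_iff_support _ (conv_compl_supp m y) hc hm').1 (h1 y) t hy
    linarith
  rw [h2 x, h2 z]

/-- Every probability measure `ρ` has a stationary measure `ω = ρ * ω`, a limit of Cesàro means of
the convolution powers of `ρ`. -/
theorem exists_stationary (ρ : Measure X) [IsProbabilityMeasure ρ] :
    ∃ ω : Measure X, IsProbabilityMeasure ω ∧ ∀ f : X → ℝ, Continuous f →
      ∫ t, ∫ y, ∫ z, f z ∂(conv y t) ∂ρ ∂ω = ∫ t, f t ∂ω := by
  -- the convolution powers
  let ν : ℕ → ProbabilityMeasure X := fun n => Nat.rec ⟨Measure.dirac e, inferInstance⟩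
    (fun _ μ => ⟨(ρ.prod (μ : Measure X)).bind (convKernel X), inferInstance⟩) n
  let P : (X → ℝ) → X → ℝ := fun f t => ∫ y, ∫ z, f z ∂(conv y t) ∂ρ
  have hPc : ∀ f, Continuous f → Continuous (P f) := fun f hf => by
    have h2 := continuous_integral_conv_real hf
    exact continuous_integral_left ρ (f := fun t y => ∫ z, f z ∂(conv y t))
      (h2.comp continuous_swap)
  have hstep : ∀ f : X → ℝ, Continuous f → ∀ n : ℕ,
      ∫ t : X, P f t ∂(ν n).toMeasure =
      ∫ t, f t ∂(ν (n + 1) : Measure X) := fun f hf n => by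
    change _ = ∫ t, f t ∂((ρ.prod (ν n : Measure X)).bind (convKernel X))
    rw [integral_bind_kernel _ _ (hf.integrable_of_compactSpace _), integral_prod_symm]
    · rfl
    · exact (continuous_integral_conv_real hf).integrable_of_compactSpace _
  -- the Cesàro means
  have hces : ∀ n : ℕ, ∃ μ : ProbabilityMeasure X, ∀ f : X → ℝ, Continuous f →
      ∫ t, f t ∂(μ : Measure X) =
        (n + 1 : ℝ)⁻¹ * ∑ k ∈ Finset.range (n + 1), ∫ t, f t ∂(ν k).toMeasure := fun n => by
    let μ : Measure X := ((n + 1 : NNReal)⁻¹ : NNReal) •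
      ∑ k ∈ Finset.range (n + 1), (ν k : Measure X)
    have hμ : IsProbabilityMeasure μ := ⟨by
      simp only [μ, Measure.smul_apply, Measure.finsetSum_apply, measure_univ, Finset.sum_const,
        Finset.card_range, nsmul_eq_mul, mul_one]
      rw [ENNReal.smul_def, smul_eq_mul]
      have : ((n + 1 : ℕ) : ENNReal) = ((n + 1 : NNReal) : ENNReal) := by push_cast; rfl
      rw [this, ← ENNReal.coe_mul, inv_mul_cancel₀ (by positivity), ENNReal.coe_one]⟩
    refine ⟨⟨μ, hμ⟩, fun f hf => ?_⟩
    change ∫ t, f t ∂μ = _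
    rw [integral_smul_nnreal_measure, integral_finsetSum_measure fun k _ =>
      hf.integrable_of_compactSpace _]
    rw [NNReal.smul_def]
    push_cast
    rfl
  choose μ hμ using hces
  let U : Ultrafilter ℕ := hyperfilter ℕ
  obtain ⟨ω, -, hω⟩ := isCompact_univ.ultrafilter_le_nhds (U.map μ) (by simp)
  have hlim : ∀ f : X → ℝ, Continuous f → Tendsto (fun n => ∫ t, f t ∂(μ n : Measure X)) U
      (𝓝 (∫ t, f t ∂(ω : Measure X))) := fun f hf =>
    ProbabilityMeasure.tendsto_iff_forall_integral_tendsto.1 hω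
      (BoundedContinuousFunction.mkOfCompact ⟨f, hf⟩)
  refine ⟨ω, inferInstance, fun f hf => ?_⟩
  have h1 := (hlim _ (hPc f hf)).sub (hlim f hf)
  -- the two Cesàro sums differ by two boundary terms
  obtain ⟨C, hC⟩ : ∃ C, ∀ k : ℕ, ‖∫ t, f t ∂(ν k).toMeasure‖ ≤ C := by
    obtain ⟨C, hC⟩ := isCompact_univ.exists_bound_of_continuousOn hf.continuousOn
    exact ⟨C, fun k => by
      simpa using norm_integral_le_of_norm_le_const (μ := (ν k : Measure X))
        (ae_of_all _ fun x => hC x (Set.mem_univ x))⟩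
  have h2 : Tendsto (fun n : ℕ => ∫ t, P f t ∂(μ n : Measure X) - ∫ t, f t ∂(μ n : Measure X))
      atTop (𝓝 0) := by
    have h3 : ∀ n : ℕ, ∫ t, P f t ∂(μ n : Measure X) - ∫ t, f t ∂(μ n : Measure X) =
        (n + 1 : ℝ)⁻¹ * (∫ t, f t ∂(ν (n + 1) : Measure X) - ∫ t, f t ∂(ν 0).toMeasure) :=
      fun n => by
        rw [hμ n _ (hPc f hf), hμ n f hf, ← mul_sub, ← Finset.sum_sub_distrib]
        simp_rw [hstep f hf]
        rw [Finset.sum_range_sub (fun k => ∫ t, f t ∂(ν k : Measure X))]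
    simp_rw [h3]
    refine squeeze_zero_norm (a := fun n : ℕ => (1 / ((n : ℝ) + 1)) * (C + C)) (fun n => ?_) ?_
    · rw [norm_mul, norm_inv, Real.norm_of_nonneg (by positivity : (0 : ℝ) ≤ n + 1), one_div]
      gcongr
      exact (norm_sub_le _ _).trans (add_le_add (hC (n + 1)) (hC 0))
    · simpa using tendsto_one_div_add_atTop_nhds_zero_nat.mul_const (C + C)
  have h4 := tendsto_nhds_unique h1 (h2.mono_left (by
    rw [← Nat.cofinite_eq_atTop]; exact hyperfilter_le_cofinite))
  exact sub_eq_zero.1 h4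

theorem exists_isNormalizedHaar : ∃ ω : Measure X, IsNormalizedHaar ω := by
  have : Nonempty X := ⟨e⟩
  obtain ⟨ρ, hρ, hρ'⟩ := exists_isProbabilityMeasure_isOpenPosMeasure X
  obtain ⟨ω, hω, hst⟩ := exists_stationary ρ
  refine ⟨ω, hω, inferInstance, fun f x => ?_⟩
  have hf := f.continuous
  have hc := continuous_integral_conv_real hf
  let g : X → ℝ := fun x => ∫ y, ∫ z, f z ∂(conv x y) ∂ω
  have hg : Continuous g := continuous_integral_left ω hc
  have hgx : g x = g e := by
    refine eq_of_harmonic (ρ := ρ) hg (fun x => ?_) x e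
    have hF : Continuous fun w => ∫ z, f z ∂(conv x w) :=
      continuous_integral_conv_real_comp hf continuous_const continuous_id
    have h1 := hst _ hF
    change ∫ w, (∫ z, f z ∂(conv x w)) ∂ω = _
    rw [← h1]
    simp_rw [← assoc_real _ _ _ hf]
    have hswap : ∀ y, ∫ t, ∫ w, ∫ z, f z ∂(conv w t) ∂(conv x y) ∂ω =
        ∫ w, g w ∂(conv x y) := fun y =>
      integral_integral_swap (f := fun t w => ∫ z, f z ∂(conv w t))
        ((hc.comp continuous_swap).integrable_of_compactSpace _)
    rw [integral_integral_swap (f := fun t y => ∫ w, ∫ z, f z ∂(conv w t) ∂(conv x y))]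
    · simp_rw [hswap]
    · refine Continuous.integrable_of_compactSpace ?_ _
      have h2 : ∀ p : X × X, (∫ w, ∫ z, f z ∂(conv w p.1) ∂(conv x p.2)) =
          ∫ w, ∫ z, f z ∂(conv x w) ∂(conv p.2 p.1) := fun p => assoc_real _ _ _ hf
      change Continuous fun p : X × X => ∫ w, ∫ z, f z ∂(conv w p.1) ∂(conv x p.2)
      simp_rw [h2]
      exact (continuous_integral_conv_real hF).comp continuous_swap
  change g x = _
  rw [hgx]
  simp only [g, e_conv, integral_dirac]

variable (X) in
theorem isNormalizedHaar_hgHaar : IsNormalizedHaar (hgHaar X) := by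
  rw [hgHaar, dif_pos exists_isNormalizedHaar]
  exact exists_isNormalizedHaar.choose_spec

instance : IsProbabilityMeasure (hgHaar X) := (isNormalizedHaar_hgHaar X).1
instance : (hgHaar X).Regular := (isNormalizedHaar_hgHaar X).2.1

theorem bind_kernelLeft_hgHaar (x : X) : (hgHaar X).bind (kernelLeft x) = hgHaar X := by
  refine measure_ext_of_continuous fun f hf => ?_
  rw [integral_bind_kernel _ _ (hf.integrable_of_compactSpace _)]
  exact (isNormalizedHaar_hgHaar X).2.2 ⟨f, hf⟩ x

/-- The image of a left invariant measure under the involution is right invariant, and a left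
invariant and a right invariant probability measure agree by Fubini. -/
theorem bind_kernelRight_hgHaar (y : X) : (hgHaar X).bind (kernelRight y) = hgHaar X := by
  have hm : Measurable (inv : X → X) := continuous_inv.measurable
  let η : Measure X := (hgHaar X).map inv
  have : IsProbabilityMeasure η := Measure.isProbabilityMeasure_map hm.aemeasurable
  have hinv : ∀ f : X → ℝ, Continuous f → ∀ y, ∫ x, ∫ z, f z ∂(conv x y) ∂η = ∫ x, f x ∂η := by
    intro f hf y
    have hc : Continuous fun x => ∫ z, f z ∂(conv x y)  :=
      continuous_integral_conv_real_comp hf continuous_id continuous_const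
    rw [integral_map hm.aemeasurable hc.aestronglyMeasurable,
      integral_map hm.aemeasurable hf.aestronglyMeasurable]
    have h0 := (isNormalizedHaar_hgHaar X).2.2 ⟨_, hf.comp continuous_inv⟩ (inv y)
    simp only [ContinuousMap.coe_mk, Function.comp_apply] at h0
    rw [← h0]
    refine integral_congr_ae (ae_of_all _ fun x => ?_)
    have h1 : conv (inv x) y = (conv (inv y) x).map inv := by
      rw [map_inv_conv, inv_inv]
    simp only [h1]
    rw [integral_map hm.aemeasurable hf.aestronglyMeasurable]
  have heq : η = hgHaar X := by
    refine measure_ext_of_continuous fun f hf => ?_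
    have h1 : ∫ x, ∫ y, ∫ z, f z ∂(conv x y) ∂(hgHaar X) ∂η = ∫ x, f x ∂(hgHaar X) := by
      have := fun x => (isNormalizedHaar_hgHaar X).2.2 ⟨f, hf⟩ x
      simp only [ContinuousMap.coe_mk] at this
      simp_rw [this]
      simp
    rw [← h1, integral_integral_swap
      ((continuous_integral_conv_real hf).integrable_of_compactSpace _)]
    simp_rw [hinv f hf]
    simp
  refine measure_ext_of_continuous fun f hf => ?_
  rw [integral_bind_kernel _ _ (hf.integrable_of_compactSpace _), ← heq]
  exact hinv f hf y

theorem ae_ae_conv_left (x : X) {p : X → Prop} (h : ∀ᵐ z ∂(hgHaar X), p z) :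
    ∀ᵐ y ∂(hgHaar X), ∀ᵐ z ∂(conv x y), p z := by
  rw [← bind_kernelLeft_hgHaar x] at h
  exact Measure.ae_ae_of_ae_comp h

theorem ae_ae_conv_right (y : X) {p : X → Prop} (h : ∀ᵐ z ∂(hgHaar X), p z) :
    ∀ᵐ x ∂(hgHaar X), ∀ᵐ z ∂(conv x y), p z := by
  rw [← bind_kernelRight_hgHaar y] at h
  exact Measure.ae_ae_of_ae_comp h

theorem integral_hgHaar_left {E : Type*} [NormedAddCommGroup E] [NormedSpace ℝ E] {f : X → E}
    (hf : Integrable f (hgHaar X)) (x : X) :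
    ∫ y, ∫ z, f z ∂(conv x y) ∂(hgHaar X) = ∫ y, f y ∂(hgHaar X) := by
  conv_rhs => rw [← bind_kernelLeft_hgHaar x]
  rw [integral_bind_kernel _ _ (by rwa [bind_kernelLeft_hgHaar])]
  rfl

instance : (hgHaar X).IsOpenPosMeasure := by
  refine ⟨fun U hU hne h0 => ?_⟩
  obtain ⟨x, hxU⟩ := hne
  obtain ⟨y, hy⟩ := Measure.nonempty_support (μ := hgHaar X) (IsProbabilityMeasure.ne_zero _)
  obtain ⟨f, hf0, hf1, hf⟩ := exists_continuous_zero_one_of_isClosed hU.isClosed_compl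
    (isClosed_singleton (x := x)) (Set.disjoint_singleton_right.2 fun h => h hxU)
  have hf' : ∀ x, 0 ≤ f x := fun x => (hf x).1
  have h1 : ∫ z, f z ∂(hgHaar X) = 0 := by
    refine integral_eq_zero_of_ae (Filter.eventuallyEq_of_mem (s := Uᶜ) ?_ fun z hz => hf0 hz)
    rw [mem_ae_iff, compl_compl, h0]
  obtain ⟨w, hw⟩ := exists_mem_supp_right y x
  have hc : Continuous fun y => ∫ z, f z ∂(conv w y) :=
    continuous_integral_conv_real_comp f.continuous continuous_const continuous_id
  rw [← (isNormalizedHaar_hgHaar X).2.2 f w, integral_eq_zero_iff_support _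
    Measure.measure_compl_support_of_regular hc fun y => integral_nonneg hf'] at h1
  have h2 := (integral_eq_zero_iff_support _ (conv_compl_supp w y) f.continuous hf').1
    (h1 y hy) x hw
  rw [hf1 rfl] at h2
  exact one_ne_zero h2

end Hypergroup

/-! ### Finite-dimensional representations and their characters -/

open Hypergroup

namespace HGRep

variable {X : Type u} [TopologicalSpace X] [CompactSpace X] [T2Space X]
  [MeasurableSpace X] [BorelSpace X] [Hypergroup X]

theorem inner_op_left (π : HGRep X) (x : X) (v w : π.E) :
    ⟪π.op x v, w⟫_ℂ = ⟪v, π.op (inv x) w⟫_ℂ := by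
  rw [π.op_inv, ContinuousLinearMap.adjoint_inner_right]

theorem ch_eq_sum (π : HGRep X) {ι : Type*} [Fintype ι] (b : OrthonormalBasis ι ℂ π.E) (x : X) :
    π.ch x = (∑ i, ⟪b i, π.op x (b i)⟫_ℂ) / (Module.finrank ℂ π.E : ℂ) := by
  rw [ch, LinearMap.trace_eq_sum_inner _ b]
  rfl

theorem continuous_ch (π : HGRep X) [FiniteDimensional ℂ π.E] : Continuous π.ch := by
  have h : π.ch = _ := funext (π.ch_eq_sum (stdOrthonormalBasis ℂ π.E))
  rw [h]
  exact (continuous_finsetSum _ fun i _ => π.continuous_op _ _).div_const _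

theorem ch_eq_zero (π : HGRep X) (h : Module.finrank ℂ π.E = 0) : π.ch = 0 := by
  ext x
  simp [ch, h]

theorem ch_e (π : HGRep X) (h : Module.finrank ℂ π.E ≠ 0) : π.ch e = 1 := by
  have : FiniteDimensional ℂ π.E := Module.finite_of_finrank_pos (Nat.pos_of_ne_zero h)
  rw [ch, π.op_e]
  change LinearMap.trace ℂ π.E LinearMap.id / _ = 1
  rw [LinearMap.trace_id, div_self (Nat.cast_ne_zero.2 h)]

theorem ch_eq_one_of_op_eq_one (π : HGRep X) (h : Module.finrank ℂ π.E ≠ 0)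
    (hop : ∀ x, π.op x = 1) : π.ch = 1 := by
  ext x
  have := π.ch_e h
  rw [ch, π.op_e] at this
  rw [ch, hop x, this]
  rfl

theorem trivial_ch : (HGIrrep.trivial X).ch = 1 :=
  ch_eq_one_of_op_eq_one _ (by
    change Module.finrank ℂ ℂ ≠ 0
    simp) fun _ => rfl

end HGRep

/-- Coordinatewise conjugation in an orthonormal basis, an antiunitary involution. -/
noncomputable def OrthonormalBasis.conjMap {ι E : Type*} [Fintype ι] [NormedAddCommGroup E]
    [InnerProductSpace ℂ E] (b : OrthonormalBasis ι ℂ E) : E →ₛₗ[starRingEnd ℂ] E where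
  toFun v := ∑ i, starRingEnd ℂ ⟪b i, v⟫_ℂ • b i
  map_add' v w := by simp [add_smul, Finset.sum_add_distrib]
  map_smul' a v := by simp [mul_smul, Finset.smul_sum]

namespace OrthonormalBasis

variable {ι E : Type*} [Fintype ι] [NormedAddCommGroup E] [InnerProductSpace ℂ E]
  (b : OrthonormalBasis ι ℂ E)

theorem inner_conjMap_right (i : ι) (v : E) :
    ⟪b i, b.conjMap v⟫_ℂ = starRingEnd ℂ ⟪b i, v⟫_ℂ := by
  classical
  change ⟪b i, ∑ j, starRingEnd ℂ ⟪b j, v⟫_ℂ • b j⟫_ℂ = _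
  simp [OrthonormalBasis.inner_eq_ite]

theorem conjMap_conjMap (v : E) : b.conjMap (b.conjMap v) = v := by
  change ∑ i, starRingEnd ℂ ⟪b i, b.conjMap v⟫_ℂ • b i = v
  simp_rw [inner_conjMap_right, Complex.conj_conj]
  exact b.sum_repr' v

theorem conjMap_self (i : ι) : b.conjMap (b i) = b i := by
  classical
  change ∑ j, starRingEnd ℂ ⟪b j, b i⟫_ℂ • b j = b i
  simp [b.inner_eq_ite]

theorem inner_conjMap (v w : E) : ⟪v, b.conjMap w⟫_ℂ = starRingEnd ℂ ⟪b.conjMap v, w⟫_ℂ := by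
  rw [← b.sum_inner_mul_inner v, ← b.sum_inner_mul_inner (b.conjMap v), map_sum]
  refine Finset.sum_congr rfl fun i _ => ?_
  rw [inner_conjMap_right, map_mul, ← inner_conj_symm (b.conjMap v), inner_conjMap_right,
    Complex.conj_conj, ← inner_conj_symm v, inner_conj_symm]

end OrthonormalBasis

namespace HGRep

variable {X : Type u} [TopologicalSpace X] [CompactSpace X] [T2Space X]
  [MeasurableSpace X] [BorelSpace X] [Hypergroup X]

/-- The complex conjugate of a finite-dimensional representation. It acts on the same Hilbert space,
by the operators whose matrices in a fixed orthonormal basis are the conjugate ones. -/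
noncomputable def conj (π : HGRep X) [FiniteDimensional ℂ π.E] : HGRep X where
  E := π.E
  op x := LinearMap.toContinuousLinearMap
    ((stdOrthonormalBasis ℂ π.E).conjMap.comp
      ((π.op x).toLinearMap.comp (stdOrthonormalBasis ℂ π.E).conjMap))
  op_e := by
    ext v
    change (stdOrthonormalBasis ℂ π.E).conjMap (π.op e _) = v
    rw [π.op_e]
    exact OrthonormalBasis.conjMap_conjMap _ v
  op_inv x := by
    rw [ContinuousLinearMap.eq_adjoint_iff]
    intro v w
    set b := stdOrthonormalBasis ℂ π.E
    change ⟪b.conjMap (π.op (inv x) (b.conjMap v)), w⟫_ℂ = ⟪v, b.conjMap (π.op x (b.conjMap w))⟫_ℂ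
    rw [b.inner_conjMap, ← inner_conj_symm, b.inner_conjMap, Complex.conj_conj,
      ← inner_conj_symm (b.conjMap v), π.inner_op_left, inner_conj_symm]
    rw [← inner_conj_symm, π.inner_op_left, Hypergroup.inv_inv]
  op_conv x y v w := by
    set b := stdOrthonormalBasis ℂ π.E
    change ∫ z, ⟪v, b.conjMap (π.op z (b.conjMap w))⟫_ℂ ∂(Hypergroup.conv x y) =
      ⟪v, b.conjMap (π.op x (b.conjMap (b.conjMap (π.op y (b.conjMap w)))))⟫_ℂ
    simp_rw [b.inner_conjMap v, integral_conj, π.op_conv, b.conjMap_conjMap]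
  continuous_op v w := by
    set b := stdOrthonormalBasis ℂ π.E
    change Continuous fun x => ⟪v, b.conjMap (π.op x (b.conjMap w))⟫_ℂ
    simp_rw [b.inner_conjMap v]
    exact Complex.continuous_conj.comp (π.continuous_op _ _)

theorem conj_ch (π : HGRep X) [FiniteDimensional ℂ π.E] (x : X) :
    π.conj.ch x = starRingEnd ℂ (π.ch x) := by
  set b := stdOrthonormalBasis ℂ π.E with hb
  rw [π.ch_eq_sum b, π.conj.ch_eq_sum b, map_div₀, map_sum, Complex.conj_natCast]
  congr 1
  refine Finset.sum_congr rfl fun i _ => ?_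
  change ⟪b i, b.conjMap (π.op x (b.conjMap (b i)))⟫_ℂ = _
  rw [b.inner_conjMap, b.conjMap_self]

end HGRep

namespace HGIrrep

variable {X : Type u} [TopologicalSpace X] [CompactSpace X] [T2Space X]
  [MeasurableSpace X] [BorelSpace X] [Hypergroup X]

attribute [instance] HGIrrep.nontrivial

theorem eq_bot_or_eq_top_of_conjMap (π : HGIrrep X) [FiniteDimensional ℂ π.E] {ι : Type*}
    [Fintype ι] (b : OrthonormalBasis ι ℂ π.E) (W : Submodule ℂ π.E)
    (hW : ∀ x, ∀ w ∈ W, b.conjMap (π.op x (b.conjMap w)) ∈ W) : W = ⊥ ∨ W = ⊤ := by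
  let W' : Submodule ℂ π.E := Submodule.comap b.conjMap W
  have hmem : ∀ w, w ∈ W → b.conjMap w ∈ W' := fun w hw => by
    change b.conjMap (b.conjMap w) ∈ W
    rwa [b.conjMap_conjMap]
  rcases π.irreducible W' W'.closed_of_finiteDimensional (fun x w hw => by
    change b.conjMap (π.op x w) ∈ W
    have := hW x _ hw
    rwa [b.conjMap_conjMap] at this) with h | h
  · left
    refine (Submodule.eq_bot_iff _).2 fun w hw => ?_
    have h1 := hmem w hw
    rw [h, Submodule.mem_bot] at h1
    rw [← b.conjMap_conjMap w, h1, map_zero]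
  · right
    refine Submodule.eq_top_iff'.2 fun w => ?_
    have h1 : b.conjMap w ∈ W' := h ▸ Submodule.mem_top
    have h2 : b.conjMap (b.conjMap w) ∈ W := h1
    rwa [b.conjMap_conjMap] at h2

/-- The complex conjugate of a finite-dimensional irreducible representation. -/
noncomputable def conj (π : HGIrrep X) [FiniteDimensional ℂ π.E] : HGIrrep X where
  toHGRep := π.toHGRep.conj
  nontrivial := π.nontrivial
  irreducible W _ hW := π.eq_bot_or_eq_top_of_conjMap (stdOrthonormalBasis ℂ π.E) W hW

theorem op_eq_one_of_fixed (π : HGIrrep X) {u : π.E} (hu : u ≠ 0) (h : ∀ x, π.op x u = u) (x : X) :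
    π.op x = 1 := by
  have hfix : ∀ w ∈ Submodule.span ℂ {u}, ∀ x, π.op x w = w := fun w hw x => by
    obtain ⟨c, rfl⟩ := Submodule.mem_span_singleton.1 hw
    rw [map_smul, h]
  have h1 : Submodule.span ℂ {u} = ⊤ :=
    (π.irreducible (Submodule.span ℂ {u}) (Submodule.closed_of_finiteDimensional _)
      fun x w hw => (hfix w hw x).symm ▸ hw).resolve_left fun h => hu (by simpa using h)
  ext w
  exact hfix w (h1 ▸ Submodule.mem_top) x

theorem finrank_ne_zero (π : HGIrrep X) [FiniteDimensional ℂ π.E] : Module.finrank ℂ π.E ≠ 0 :=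
  Module.finrank_pos.ne'

/-- The Haar integral of a nontrivial irreducible representation vanishes, as its range consists
of fixed vectors. -/
theorem integral_ch_eq_zero [SecondCountableTopology X] (π : HGIrrep X) [FiniteDimensional ℂ π.E]
    (hπ : π.ch ≠ 1) : ∫ x, π.ch x ∂(hgHaar X) = 0 := by
  set b := stdOrthonormalBasis ℂ π.E with hb
  have key : ∀ v w, ∫ x, ⟪v, π.op x w⟫_ℂ ∂(hgHaar X) = 0 := by
    intro v w
    have hint : ∀ v w : π.E, Integrable (fun x => ⟪v, π.op x w⟫_ℂ) (hgHaar X) := fun v w =>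
      (π.continuous_op v w).integrable_of_compactSpace _
    let u : π.E := ∑ i, (∫ x, ⟪b i, π.op x w⟫_ℂ ∂(hgHaar X)) • b i
    have hu : ∀ v, ⟪v, u⟫_ℂ = ∫ x, ⟪v, π.op x w⟫_ℂ ∂(hgHaar X) := fun v => by
      have h1 : ∀ x, ⟪v, π.op x w⟫_ℂ = ∑ i, ⟪v, b i⟫_ℂ * ⟪b i, π.op x w⟫_ℂ := fun x =>
        (b.sum_inner_mul_inner v _).symm
      simp_rw [h1]
      rw [integral_finsetSum _ fun i _ => (hint _ _).const_mul _]
      simp only [u, inner_sum, inner_smul_right, integral_const_mul]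
      exact Finset.sum_congr rfl fun i _ => mul_comm _ _
    have hfix : ∀ y, π.op y u = u := fun y => ext_inner_left ℂ fun v => by
      rw [hu]
      have h1 : ⟪v, π.op y u⟫_ℂ = ⟪π.op (inv y) v, u⟫_ℂ := by rw [π.inner_op_left, Hypergroup.inv_inv]
      rw [h1, hu]
      have h2 : ∀ x, ⟪π.op (inv y) v, π.op x w⟫_ℂ =
          ∫ z, ⟪v, π.op z w⟫_ℂ ∂(Hypergroup.conv y x) := fun x => by
        rw [π.inner_op_left, Hypergroup.inv_inv, π.op_conv]
      simp_rw [h2]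
      exact integral_hgHaar_left (hint v w) y
    have h0 : u = 0 := by
      by_contra hne
      exact hπ (π.toHGRep.ch_eq_one_of_op_eq_one π.finrank_ne_zero (π.op_eq_one_of_fixed hne hfix))
    rw [← hu, h0, inner_zero_right]
  simp_rw [π.toHGRep.ch_eq_sum b]
  rw [integral_div, integral_finsetSum _ fun i _ =>
    (π.continuous_op _ _).integrable_of_compactSpace _]
  simp [key]

end HGIrrep

/-! ### Measures on discrete spaces -/

theorem Measure.mem_support_iff_discrete {Y : Type*} [TopologicalSpace Y] [DiscreteTopology Y]
    [MeasurableSpace Y] {μ : Measure Y} {k : Y} : k ∈ μ.support ↔ μ {k} ≠ 0 := by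
  rw [Measure.mem_support_iff_forall]
  constructor
  · exact fun h => (h {k} (by simp)).ne'
  · exact fun h U hU => (pos_iff_ne_zero.2 h).trans_le
      (measure_mono (Set.singleton_subset_iff.2 (mem_of_mem_nhds hU)))

/-- A regular probability measure with compact support on a discrete space is a finite convex
combination of point masses. -/
theorem exists_finsupp_of_discrete {Y : Type*} [TopologicalSpace Y] [DiscreteTopology Y]
    [MeasurableSpace Y] [BorelSpace Y] [MeasurableSingletonClass Y] (μ : Measure Y)
    [IsProbabilityMeasure μ] [μ.Regular]
    (hμ : IsCompact μ.support) : ∃ c : Y →₀ ℝ, (∀ k, 0 ≤ c k) ∧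
      (∀ k, c k ≠ 0 ↔ k ∈ μ.support) ∧
      ∀ {E : Type} [NormedAddCommGroup E] [NormedSpace ℝ E] [CompleteSpace E] (f : Y → E),
        ∫ k, f k ∂μ = c.sum fun k a => a • f k := by
  classical
  have hfin : μ.support.Finite := isCompact_iff_finite.1 hμ
  let c : Y →₀ ℝ := Finsupp.onFinset hfin.toFinset (fun k => μ.real {k}) fun k hk => by
    rw [Set.Finite.mem_toFinset, Measure.mem_support_iff_discrete]
    exact fun h => hk (by simp [Measure.real, h])
  have hck : ∀ k, c k = μ.real {k} := fun k => rfl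
  have hiff : ∀ k, c k ≠ 0 ↔ k ∈ μ.support := fun k => by
    rw [hck, Measure.mem_support_iff_discrete, Ne, measureReal_eq_zero_iff]
  refine ⟨c, fun k => measureReal_nonneg, hiff, fun {E} _ _ _ f => ?_⟩
  have h1 : μ = μ.restrict (hfin.toFinset : Set Y) := by
    rw [Measure.restrict_eq_self_of_ae_mem]
    rw [Set.Finite.coe_toFinset]
    exact mem_ae_iff.2 Measure.measure_compl_support_of_regular
  rw [h1, setIntegral_finset]
  · rw [Finsupp.onFinset_sum]
    · exact fun k => zero_smul _ _
  · exact IntegrableOn.finset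

/-! ### Orthogonality of characters -/

namespace CharSpace

variable {X : Type u} [TopologicalSpace X] [CompactSpace X] [T2Space X]
  [MeasurableSpace X] [BorelSpace X] [Hypergroup X]

/-- The function on the hypergroup that a character is. -/
def fn (χ : CharSpace X) : X → ℂ := χ.1

theorem ext {χ ψ : CharSpace X} (h : ∀ x, χ.fn x = ψ.fn x) : χ = ψ := Subtype.ext (funext h)

variable (X) in
/-- The trivial character. -/
noncomputable def triv : CharSpace X := ⟨1, HGIrrep.trivial X, HGRep.trivial_ch.symm⟩

/-- The character of an irreducible representation. -/
noncomputable def ofRep (π : HGIrrep X) : CharSpace X := ⟨π.ch, π, rfl⟩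

theorem triv_fn (x : X) : (triv X).fn x = 1 := rfl

theorem exists_ofRep (χ : CharSpace X) : ∃ π : HGIrrep X, χ = ofRep π := by
  obtain ⟨_, π, rfl⟩ := χ
  exact ⟨π, rfl⟩

end CharSpace

namespace IsStrong

variable {X : Type u} [TopologicalSpace X] [CompactSpace X] [T2Space X]
  [MeasurableSpace X] [BorelSpace X] [Hypergroup X]

/-- An irreducible representation of infinite dimension would have the zero function for its
normalized trace, which cannot belong to the hypergroup of characters: the convolution of `0` with
its involute would be concentrated at `0`, so that `0` would be the neutral element. -/
theorem finrank_ne_zero (hX : IsStrong X) (π : HGIrrep X) : Module.finrank ℂ π.E ≠ 0 := by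
  intro h
  obtain ⟨K, hK⟩ := hX
  replace hK : ∀ (χ ψ : CharSpace X) x, ∫ ρ, ρ.fn x ∂(K.conv χ ψ) = χ.fn x * ψ.fn x := hK
  let χ : CharSpace X := CharSpace.ofRep π
  have hχ : χ.fn = 0 := π.toHGRep.ch_eq_zero h
  have h01 : ∀ ρ : CharSpace X, ρ.fn e = 1 ∨ ρ = χ := by
    intro ρ
    obtain ⟨σ, rfl⟩ := ρ.exists_ofRep
    by_cases hσ : Module.finrank ℂ σ.E = 0
    · right
      exact Subtype.ext ((σ.toHGRep.ch_eq_zero hσ).trans hχ.symm)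
    · exact Or.inl (σ.toHGRep.ch_e hσ)
  have hre : ∀ ρ : CharSpace X, 0 ≤ (ρ.fn e).re := fun ρ => by
    rcases h01 ρ with h | rfl
    · rw [h]; exact zero_le_one
    · rw [hχ]; exact le_rfl
  have hsupp : K.e ∈ (K.conv χ (K.inv χ)).support := (K.e_mem_support_iff _ _).2 rfl
  have heχ : K.e = χ := by
    have := K.isProbabilityMeasure χ (K.inv χ)
    have := K.regular χ (K.inv χ)
    obtain ⟨c, hc0, hc1, hc⟩ := exists_finsupp_of_discrete (K.conv χ (K.inv χ))
      (K.isCompact_support _ _)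
    have h1 := hK χ (K.inv χ) e
    rw [hc fun ρ => ρ.fn e, hχ, Pi.zero_apply, zero_mul] at h1
    have h2 : ∑ ρ ∈ c.support, c ρ * (ρ.fn e).re = 0 := by
      have := congrArg Complex.re h1
      simpa [Finsupp.sum, Complex.re_sum] using this
    rw [Finset.sum_eq_zero_iff_of_nonneg fun ρ _ => mul_nonneg (hc0 ρ) (hre ρ)] at h2
    have h3 := (hc1 _).2 hsupp
    have h4 := h2 _ (Finsupp.mem_support_iff.2 h3)
    refine (h01 K.e).resolve_left fun h5 => ?_
    rw [h5, Complex.one_re, mul_one] at h4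
    exact h3 h4
  have h1 := hK χ (CharSpace.triv X) e
  rw [← heχ, K.e_conv, integral_dirac, heχ, hχ] at h1
  simp [CharSpace.triv_fn] at h1

theorem finiteDimensional (hX : IsStrong X) (π : HGIrrep X) : FiniteDimensional ℂ π.E :=
  Module.finite_of_finrank_pos (Nat.pos_of_ne_zero (hX.finrank_ne_zero π))

theorem char_e (hX : IsStrong X) (χ : CharSpace X) : χ.fn e = 1 := by
  obtain ⟨π, rfl⟩ := χ.exists_ofRep
  exact π.toHGRep.ch_e (hX.finrank_ne_zero π)

theorem continuous_char (hX : IsStrong X) (χ : CharSpace X) : Continuous χ.fn := by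
  obtain ⟨π, rfl⟩ := χ.exists_ofRep
  have := hX.finiteDimensional π
  exact π.toHGRep.continuous_ch

/-- The complex conjugate of a character. -/
noncomputable def conj (hX : IsStrong X) (χ : CharSpace X) : CharSpace X :=
  ⟨fun x => starRingEnd ℂ (χ.fn x), by
    obtain ⟨π, rfl⟩ := χ.exists_ofRep
    have := hX.finiteDimensional π
    exact ⟨π.conj, funext fun x => (π.toHGRep.conj_ch x).symm⟩⟩

theorem conj_apply (hX : IsStrong X) (χ : CharSpace X) (x : X) :
    (hX.conj χ).fn x = starRingEnd ℂ (χ.fn x) := rfl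

theorem conj_conj (hX : IsStrong X) (χ : CharSpace X) : hX.conj (hX.conj χ) = χ :=
  CharSpace.ext (fun _ => Complex.conj_conj _)

variable [SecondCountableTopology X]

theorem integral_char (hX : IsStrong X) (χ : CharSpace X) (hχ : χ ≠ CharSpace.triv X) :
    ∫ x, χ.fn x ∂(hgHaar X) = 0 := by
  obtain ⟨π, rfl⟩ := χ.exists_ofRep
  have := hX.finiteDimensional π
  exact π.integral_ch_eq_zero fun h => hχ (Subtype.ext h)

theorem integral_finsupp_sum (hX : IsStrong X) (c : CharSpace X →₀ ℝ) :
    ∫ x, c.sum (fun ρ a => a • ρ.fn x) ∂(hgHaar X) = c (CharSpace.triv X) := by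
  classical
  simp only [Finsupp.sum]
  rw [integral_finsetSum (f := fun ρ x => c ρ • ρ.fn x) _ fun ρ _ =>
    ((hX.continuous_char ρ).const_smul (c ρ)).integrable_of_compactSpace _]
  simp_rw [integral_smul]
  rw [Finset.sum_eq_single (CharSpace.triv X)]
  · simp [CharSpace.triv_fn]
  · intro ρ _ hρ
    rw [hX.integral_char ρ hρ, smul_zero]
  · intro h
    rw [Finsupp.notMem_support_iff.1 h, zero_smul]

/-- Products of characters are convex combinations of characters; the trivial character occurs
exactly in the product of a character with its conjugate. -/
theorem exists_mul_eq (hX : IsStrong X) (χ ψ : CharSpace X) :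
    ∃ c : CharSpace X →₀ ℝ, (∀ ρ, 0 ≤ c ρ) ∧ c.sum (fun _ a => a) = 1 ∧
      (∀ x, χ.fn x * ψ.fn x = c.sum fun ρ a => a • ρ.fn x) ∧
      (c (CharSpace.triv X) ≠ 0 ↔ ψ = hX.conj χ) := by
  have key : ∃ K : CharSpace X → CharSpace X, ∀ χ ψ : CharSpace X,
      ∃ c : CharSpace X →₀ ℝ, (∀ ρ, 0 ≤ c ρ) ∧ c.sum (fun _ a => a) = 1 ∧
      (∀ x, χ.fn x * ψ.fn x = c.sum fun ρ a => a • ρ.fn x) ∧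
      (c (CharSpace.triv X) ≠ 0 ↔ ψ = K χ) := by
    obtain ⟨K, hK⟩ := id hX
    replace hK : ∀ (χ ψ : CharSpace X) x, ∫ ρ, ρ.fn x ∂(K.conv χ ψ) = χ.fn x * ψ.fn x := hK
    have he : K.e = CharSpace.triv X := by
      refine CharSpace.ext fun x => ?_
      have h1 := hK K.e (CharSpace.triv X) x
      rw [K.e_conv, integral_dirac] at h1
      simpa [CharSpace.triv_fn] using h1.symm
    refine ⟨K.inv, fun χ ψ => ?_⟩
    have := K.isProbabilityMeasure χ ψ
    have := K.regular χ ψ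
    obtain ⟨c, hc0, hc1, hc⟩ := exists_finsupp_of_discrete (K.conv χ ψ) (K.isCompact_support _ _)
    refine ⟨c, hc0, ?_, fun x => ?_, ?_⟩
    · have := hc fun _ => (1 : ℝ)
      simpa using this.symm
    · rw [← hK χ ψ x, hc]
    · rw [hc1, ← he, K.e_mem_support_iff]
  obtain ⟨K, hK⟩ := key
  suffices h : K χ = hX.conj χ by
    rw [← h]; exact hK χ ψ
  obtain ⟨c, -, -, hc, hiff⟩ := hK χ (hX.conj χ)
  refine (hiff.1 ?_).symm
  have h1 := hX.integral_finsupp_sum c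
  simp_rw [← hc, conj_apply, Complex.mul_conj] at h1
  rw [integral_complex_ofReal] at h1
  rw [← Complex.ofReal_injective h1]
  have hcont : Continuous fun x => Complex.normSq (χ.fn x) :=
    Complex.continuous_normSq.comp (hX.continuous_char χ)
  refine (hcont.integral_pos_of_hasCompactSupport_nonneg_nonzero
    (HasCompactSupport.of_compactSpace _) (fun x => Complex.normSq_nonneg _) (x := e) ?_).ne'
  rw [hX.char_e]
  simp

theorem integral_mul_conj_eq_zero (hX : IsStrong X) {χ ψ : CharSpace X} (h : χ ≠ ψ) :
    ∫ x, χ.fn x * starRingEnd ℂ (ψ.fn x) ∂(hgHaar X) = 0 := by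
  obtain ⟨c, -, -, hc, hiff⟩ := hX.exists_mul_eq χ (hX.conj ψ)
  have h1 := hX.integral_finsupp_sum c
  simp_rw [← hc, conj_apply] at h1
  rw [h1, Complex.ofReal_eq_zero]
  by_contra h2
  refine h ?_
  rw [← hX.conj_conj χ, ← hiff.1 h2, hX.conj_conj]

theorem integral_mul_conj_ne_zero (hX : IsStrong X) (χ : CharSpace X) :
    ∫ x, χ.fn x * starRingEnd ℂ (χ.fn x) ∂(hgHaar X) ≠ 0 := by
  obtain ⟨c, -, -, hc, hiff⟩ := hX.exists_mul_eq χ (hX.conj χ)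
  have h1 := hX.integral_finsupp_sum c
  simp_rw [← hc, conj_apply] at h1
  rw [h1, Ne, Complex.ofReal_eq_zero]
  exact hiff.2 rfl

end IsStrong

/-! ### The linear span of the characters -/

section Span

variable {X : Type u} [TopologicalSpace X] [CompactSpace X] [T2Space X]
  [MeasurableSpace X] [BorelSpace X] [Hypergroup X]

variable (X) in
/-- The linear combinations of characters. -/
noncomputable def charSpan : Submodule ℂ (X → ℂ) := Submodule.span ℂ (Set.range CharSpace.fn)

theorem CharSpace.fn_mem (χ : CharSpace X) : χ.fn ∈ charSpan X :=
  Submodule.subset_span ⟨χ, rfl⟩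

theorem HGIrrep.ch_mem (π : HGIrrep X) : π.ch ∈ charSpan X := (CharSpace.ofRep π).fn_mem

theorem mem_charSpan_iff {f : X → ℂ} : f ∈ charSpan X ↔
    ∃ c : CharSpace X →₀ ℂ, f = c.sum fun χ a => a • χ.fn := by
  rw [charSpan, Finsupp.mem_span_range_iff_exists_finsupp]
  exact exists_congr fun c => eq_comm

namespace IsStrong

theorem continuous_of_mem (hX : IsStrong X) {f : X → ℂ} (hf : f ∈ charSpan X) : Continuous f := by
  induction hf using Submodule.span_induction with
  | mem f hf => obtain ⟨χ, rfl⟩ := hf; exact hX.continuous_char χ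
  | zero => exact continuous_const
  | add f g _ _ hf hg => exact hf.add hg
  | smul a f _ hf => exact hf.const_smul a

theorem conj_mem (hX : IsStrong X) {f : X → ℂ} (hf : f ∈ charSpan X) :
    (fun x => starRingEnd ℂ (f x)) ∈ charSpan X := by
  induction hf using Submodule.span_induction with
  | mem f hf => obtain ⟨χ, rfl⟩ := hf; exact (hX.conj χ).fn_mem
  | zero => convert (charSpan X).zero_mem using 2; simp
  | add f g _ _ hf hg => convert (charSpan X).add_mem hf hg using 2; simp
  | smul a f _ hf => convert (charSpan X).smul_mem (starRingEnd ℂ a) hf using 2; simp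

variable [SecondCountableTopology X]

theorem mul_mem (hX : IsStrong X) {f g : X → ℂ} (hf : f ∈ charSpan X) (hg : g ∈ charSpan X) :
    f * g ∈ charSpan X := by
  induction hf, hg using Submodule.span_induction₂ with
  | mem_mem f g hf hg =>
    obtain ⟨χ, rfl⟩ := hf
    obtain ⟨ψ, rfl⟩ := hg
    obtain ⟨c, -, -, hc, -⟩ := hX.exists_mul_eq χ ψ
    have h : χ.fn * ψ.fn = ∑ ρ ∈ c.support, ((c ρ : ℝ) : ℂ) • ρ.fn := by
      ext x
      rw [Pi.mul_apply, hc, Finset.sum_apply]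
      rfl
    rw [h]
    exact Submodule.sum_mem _ fun ρ _ => Submodule.smul_mem _ _ ρ.fn_mem
  | zero_left g _ => rw [zero_mul]; exact Submodule.zero_mem _
  | zero_right f _ => rw [mul_zero]; exact Submodule.zero_mem _
  | add_left f g k _ _ _ h1 h2 => rw [add_mul]; exact Submodule.add_mem _ h1 h2
  | add_right f g k _ _ _ h1 h2 => rw [mul_add]; exact Submodule.add_mem _ h1 h2
  | smul_left a f g _ _ h => rw [smul_mul_assoc]; exact Submodule.smul_mem _ _ h
  | smul_right a f g _ _ h => rw [mul_smul_comm]; exact Submodule.smul_mem _ _ h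

theorem integral_sum_mul_conj (hX : IsStrong X) (c : CharSpace X →₀ ℂ) (ψ : CharSpace X) :
    ∫ x, (c.sum fun χ a => a • χ.fn) x * starRingEnd ℂ (ψ.fn x) ∂(hgHaar X) =
      c ψ * ∫ x, ψ.fn x * starRingEnd ℂ (ψ.fn x) ∂(hgHaar X) := by
  classical
  have hc : ∀ χ : CharSpace X, Continuous fun x => χ.fn x * starRingEnd ℂ (ψ.fn x) := fun χ =>
    (hX.continuous_char χ).mul (Complex.continuous_conj.comp (hX.continuous_char ψ))
  have h : ∀ x, (c.sum fun χ a => a • χ.fn) x * starRingEnd ℂ (ψ.fn x) =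
      ∑ χ ∈ c.support, c χ * (χ.fn x * starRingEnd ℂ (ψ.fn x)) := fun x => by
    rw [Finsupp.sum, Finset.sum_apply, Finset.sum_mul]
    exact Finset.sum_congr rfl fun χ _ => by simp [mul_assoc]
  simp_rw [h]
  rw [integral_finsetSum _ fun χ _ => ((hc χ).const_mul (c χ)).integrable_of_compactSpace _]
  simp_rw [integral_const_mul]
  rw [Finset.sum_eq_single ψ]
  · intro χ _ hχ
    rw [hX.integral_mul_conj_eq_zero hχ, mul_zero]
  · intro h
    rw [Finsupp.notMem_support_iff.1 h, zero_mul]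

theorem eq_zero_of_integral (hX : IsStrong X) {f : X → ℂ} (hf : f ∈ charSpan X)
    (h : ∀ ψ : CharSpace X, ∫ x, f x * starRingEnd ℂ (ψ.fn x) ∂(hgHaar X) = 0) : f = 0 := by
  obtain ⟨c, rfl⟩ := mem_charSpan_iff.1 hf
  have hc : c = 0 := Finsupp.ext fun ψ => by
    have h1 := h ψ
    rw [hX.integral_sum_mul_conj, mul_eq_zero] at h1
    exact h1.resolve_right (hX.integral_mul_conj_ne_zero ψ)
  rw [hc, Finsupp.sum_zero_index]

theorem linearIndependent (hX : IsStrong X) :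
    LinearIndependent ℂ (CharSpace.fn : CharSpace X → X → ℂ) := by
  rw [linearIndependent_iff]
  intro c hc
  refine Finsupp.ext fun ψ => ?_
  have h1 := hX.integral_sum_mul_conj c ψ
  have hc' : (c.sum fun χ a => a • χ.fn) = 0 := hc
  rw [hc'] at h1
  simp only [Pi.zero_apply, zero_mul, integral_zero] at h1
  exact (mul_eq_zero.1 h1.symm).resolve_right (hX.integral_mul_conj_ne_zero ψ)

end IsStrong

end Span

/-! ### Irreducible representations are determined by their characters -/

/-- Burnside's theorem on irreducible algebras of operators. -/
theorem Subalgebra.eq_top_of_irreducible {E : Type*} [AddCommGroup E] [Module ℂ E]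
    [FiniteDimensional ℂ E] [Nontrivial E] (B : Subalgebra ℂ (Module.End ℂ E))
    (hB : ∀ W : Submodule ℂ E, (∀ b ∈ B, ∀ w ∈ W, b w ∈ W) → W = ⊥ ∨ W = ⊤) : B = ⊤ := by
  have hsimple : IsSimpleModule B E := by
    rw [isSimpleModule_iff]
    refine { exists_pair_ne := ⟨⊥, ⊤, bot_ne_top⟩, eq_bot_or_eq_top := fun W => ?_ }
    let W' : Submodule ℂ E := W.restrictScalars ℂ
    rcases hB W' (fun b hb w hw => W.smul_mem (⟨b, hb⟩ : B) hw) with h | h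
    · left
      exact (Submodule.eq_bot_iff _).2 fun w hw => by
        have : w ∈ W' := hw
        rwa [h] at this
    · right
      exact Submodule.eq_top_iff'.2 fun w => by
        have : w ∈ W' := h ▸ Submodule.mem_top
        exact this
  -- Schur's lemma: the commutant consists of scalars
  have hscalar : ∀ f : Module.End B E, ∃ μ : ℂ, ∀ v, f v = μ • v := fun f => by
    let f' : Module.End ℂ E := f.restrictScalars ℂ
    obtain ⟨μ, hμ⟩ := Module.End.exists_eigenvalue f'
    refine ⟨μ, fun v => ?_⟩
    have hinv : ∀ b ∈ B, ∀ w ∈ f'.eigenspace μ, b w ∈ f'.eigenspace μ := fun b hb w hw => by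
      rw [Module.End.mem_eigenspace_iff] at hw ⊢
      have h1 : f ((⟨b, hb⟩ : B) • w) = (⟨b, hb⟩ : B) • f w := f.map_smul _ _
      change f (b w) = μ • b w
      change f (b w) = b (f' w) at h1
      rw [h1, hw, map_smul]
    have htop := (hB _ hinv).resolve_left hμ
    exact Module.End.mem_eigenspace_iff.1 (htop ▸ Submodule.mem_top : v ∈ f'.eigenspace μ)
  refine Algebra.eq_top_iff.2 fun T => ?_
  let F : Module.End (Module.End B E) E :=
    { toFun := T
      map_add' := map_add T
      map_smul' := fun f v => by
        obtain ⟨μ, hμ⟩ := hscalar f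
        change T (f v) = f (T v)
        rw [hμ, hμ, map_smul] }
  let b := Module.finBasis ℂ E
  classical
  obtain ⟨r, hr⟩ := jacobson_density F (Finset.univ.image b)
  have : T = r := b.ext fun i => hr (b i) (Finset.mem_image_of_mem _ (Finset.mem_univ i))
  rw [this]
  exact r.2

namespace HGRep

variable {X : Type u} [TopologicalSpace X] [CompactSpace X] [T2Space X]
  [MeasurableSpace X] [BorelSpace X] [Hypergroup X]

theorem continuous_op_norm (π : HGRep X) [FiniteDimensional ℂ π.E] : Continuous π.op := by
  rw [continuous_clm_apply]
  intro v
  have h : ∀ x, π.op x v = ∑ i, ⟪stdOrthonormalBasis ℂ π.E i, π.op x v⟫_ℂ •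
      stdOrthonormalBasis ℂ π.E i := fun x => ((stdOrthonormalBasis ℂ π.E).sum_repr' _).symm
  rw [funext h]
  exact continuous_finsetSum _ fun i _ => (π.continuous_op _ _).smul continuous_const

theorem integral_op (π : HGRep X) [FiniteDimensional ℂ π.E] (x y : X) :
    ∫ z, π.op z ∂(Hypergroup.conv x y) = π.op x * π.op y := by
  have hint := π.continuous_op_norm.integrable_of_compactSpace (Hypergroup.conv x y)
  ext w
  refine ext_inner_left ℂ fun v => ?_
  change _ = ⟪v, π.op x (π.op y w)⟫_ℂ
  rw [← π.op_conv]
  let L : (π.E →L[ℂ] π.E) →L[ℂ] ℂ := (innerSL ℂ v).comp (ContinuousLinearMap.apply ℂ π.E w)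
  exact (L.integral_comp_comm hint).symm

/-- The operators of a pair of representations span an algebra. -/
def pairSpan (π σ : HGRep X) : Submodule ℂ ((π.E →L[ℂ] π.E) × (σ.E →L[ℂ] σ.E)) :=
  Submodule.span ℂ (Set.range fun x => (π.op x, σ.op x))

section Pair

variable {π σ : HGRep X}

theorem op_mem_pairSpan (x : X) : (π.op x, σ.op x) ∈ pairSpan π σ :=
  Submodule.subset_span ⟨x, rfl⟩

theorem one_mem_pairSpan : 1 ∈ pairSpan π σ := by
  have := op_mem_pairSpan (π := π) (σ := σ) e
  rwa [π.op_e, σ.op_e] at this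

theorem star_mem_pairSpan {a : (π.E →L[ℂ] π.E) × (σ.E →L[ℂ] σ.E)} (ha : a ∈ pairSpan π σ) :
    star a ∈ pairSpan π σ := by
  induction ha using Submodule.span_induction with
  | mem a ha =>
    obtain ⟨x, rfl⟩ := ha
    have := op_mem_pairSpan (π := π) (σ := σ) (inv x)
    rwa [π.op_inv, σ.op_inv] at this
  | zero => rw [star_zero]; exact Submodule.zero_mem _
  | add a b _ _ ha hb => rw [star_add]; exact Submodule.add_mem _ ha hb
  | smul c a _ ha => rw [star_smul]; exact Submodule.smul_mem _ _ ha

variable [FiniteDimensional ℂ π.E] [FiniteDimensional ℂ σ.E]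

theorem mul_mem_pairSpan {a b : (π.E →L[ℂ] π.E) × (σ.E →L[ℂ] σ.E)} (ha : a ∈ pairSpan π σ)
    (hb : b ∈ pairSpan π σ) : a * b ∈ pairSpan π σ := by
  induction ha, hb using Submodule.span_induction₂ with
  | mem_mem a b ha hb =>
    obtain ⟨x, rfl⟩ := ha
    obtain ⟨y, rfl⟩ := hb
    have hc : Continuous fun z => (π.op z, σ.op z) :=
      π.continuous_op_norm.prodMk σ.continuous_op_norm
    have h1 : ∫ z, (π.op z, σ.op z) ∂(Hypergroup.conv x y) =
        (π.op x, σ.op x) * (π.op y, σ.op y) := by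
      rw [integral_pair (π.continuous_op_norm.integrable_of_compactSpace _)
        (σ.continuous_op_norm.integrable_of_compactSpace _), π.integral_op, σ.integral_op]
      rfl
    rw [← h1]
    exact ((pairSpan π σ).restrictScalars ℝ).convex.integral_mem
      (pairSpan π σ).closed_of_finiteDimensional (Filter.Eventually.of_forall op_mem_pairSpan)
      (hc.integrable_of_compactSpace _)
  | zero_left g _ => rw [zero_mul]; exact Submodule.zero_mem _
  | zero_right f _ => rw [mul_zero]; exact Submodule.zero_mem _
  | add_left f g k _ _ _ h1 h2 => rw [add_mul]; exact Submodule.add_mem _ h1 h2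
  | add_right f g k _ _ _ h1 h2 => rw [mul_add]; exact Submodule.add_mem _ h1 h2
  | smul_left a f g _ _ h => rw [smul_mul_assoc]; exact Submodule.smul_mem _ _ h
  | smul_right a f g _ _ h => rw [mul_smul_comm]; exact Submodule.smul_mem _ _ h

theorem trace_eq_of_mem_pairSpan (hch : π.ch = σ.ch)
    {a : (π.E →L[ℂ] π.E) × (σ.E →L[ℂ] σ.E)} (ha : a ∈ pairSpan π σ) :
    LinearMap.trace ℂ π.E a.1.toLinearMap / (Module.finrank ℂ π.E : ℂ) =
      LinearMap.trace ℂ σ.E a.2.toLinearMap / (Module.finrank ℂ σ.E : ℂ) := by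
  induction ha using Submodule.span_induction with
  | mem a ha =>
    obtain ⟨x, rfl⟩ := ha
    exact congrFun hch x
  | zero => simp
  | add a b _ _ ha hb => simp [add_div, ha, hb]
  | smul c a _ ha => simp [mul_div_assoc, ha]

end Pair

end HGRep

theorem trace_star_mul_self_eq_zero {E : Type*} [NormedAddCommGroup E] [InnerProductSpace ℂ E]
    [FiniteDimensional ℂ E] {a : E →L[ℂ] E}
    (h : LinearMap.trace ℂ E (star a * a).toLinearMap = 0) : a = 0 := by
  rw [LinearMap.trace_eq_sum_inner _ (stdOrthonormalBasis ℂ E)] at h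
  have h1 : ∀ v : E, ⟪v, (star a * a) v⟫_ℂ = ((‖a v‖ ^ 2 : ℝ) : ℂ) := fun v => by
    change ⟪v, ContinuousLinearMap.adjoint a (a v)⟫_ℂ = _
    rw [ContinuousLinearMap.adjoint_inner_right, inner_self_eq_norm_sq_to_K]
    norm_cast
  have h2 : ∑ i, ((‖a (stdOrthonormalBasis ℂ E i)‖ ^ 2 : ℝ) : ℂ) = 0 := by
    rw [← h]
    exact Finset.sum_congr rfl fun i _ => (h1 _).symm
  rw [← Complex.ofReal_sum, Complex.ofReal_eq_zero,
    Finset.sum_eq_zero_iff_of_nonneg fun i _ => sq_nonneg _] at h2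
  have h3 : a.toLinearMap = 0 := (stdOrthonormalBasis ℂ E).toBasis.ext fun i => by
    have := h2 i (Finset.mem_univ i)
    simpa using this
  ext v
  exact LinearMap.congr_fun h3 v

namespace HGIrrep

variable {X : Type u} [TopologicalSpace X] [CompactSpace X] [T2Space X]
  [MeasurableSpace X] [BorelSpace X] [Hypergroup X]

open HGRep

theorem exists_pairSpan_fst_eq (π σ : HGIrrep X) [FiniteDimensional ℂ π.E]
    [FiniteDimensional ℂ σ.E] (T : π.E →L[ℂ] π.E) :
    ∃ a ∈ pairSpan π.toHGRep σ.toHGRep, a.1 = T := by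
  let B : Subalgebra ℂ (Module.End ℂ π.E) :=
    { carrier := {S | ∃ a ∈ pairSpan π.toHGRep σ.toHGRep, a.1.toLinearMap = S}
      mul_mem' := by
        rintro _ _ ⟨a, ha, rfl⟩ ⟨b, hb, rfl⟩
        exact ⟨a * b, mul_mem_pairSpan ha hb, rfl⟩
      add_mem' := by
        rintro _ _ ⟨a, ha, rfl⟩ ⟨b, hb, rfl⟩
        exact ⟨a + b, Submodule.add_mem _ ha hb, rfl⟩
      algebraMap_mem' := fun c => ⟨c • 1, Submodule.smul_mem _ _ one_mem_pairSpan, by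
        ext v
        rfl⟩ }
  have hB : B = ⊤ := B.eq_top_of_irreducible fun W hW =>
    π.irreducible W W.closed_of_finiteDimensional fun x w hw =>
      hW (π.op x).toLinearMap ⟨_, op_mem_pairSpan x, rfl⟩ w hw
  have hT : T.toLinearMap ∈ B := hB ▸ Algebra.mem_top
  obtain ⟨a, ha, h⟩ := hT
  exact ⟨a, ha, ContinuousLinearMap.coe_injective h⟩

/-- Irreducible representations with the same normalized character are unitarily equivalent: the
operators `(π(x), σ(x))` span the graph of a `*`-isomorphism of operator algebras, and the image of
the projection onto a unit vector `u` is a projection whose range contains a unit vector `u'`;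
then `π(x) u ↦ σ(x) u'` is the required isometry. -/
theorem exists_linearIsometryEquiv (π σ : HGIrrep X) [FiniteDimensional ℂ π.E]
    [FiniteDimensional ℂ σ.E] (hch : π.ch = σ.ch) :
    ∃ V : π.E ≃ₗᵢ[ℂ] σ.E, ∀ x v, V (π.op x v) = σ.op x (V v) := by
  let A := pairSpan π.toHGRep σ.toHGRep
  have hn : (Module.finrank ℂ π.E : ℂ) ≠ 0 := Nat.cast_ne_zero.2 π.finrank_ne_zero
  have hm : (Module.finrank ℂ σ.E : ℂ) ≠ 0 := Nat.cast_ne_zero.2 σ.finrank_ne_zero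
  have h12 : ∀ a ∈ A, a.1 = 0 ↔ a.2 = 0 := fun a ha => by
    have h := trace_eq_of_mem_pairSpan hch (mul_mem_pairSpan (star_mem_pairSpan ha) ha)
    constructor
    · intro h1
      refine trace_star_mul_self_eq_zero ?_
      change _ / _ = LinearMap.trace ℂ σ.E (star a.2 * a.2).toLinearMap / _ at h
      have h3 : (star a * a).1 = 0 := by
        change star a.1 * a.1 = 0
        rw [h1, mul_zero]
      rw [h3] at h
      simpa [hm] using h.symm
    · intro h1
      refine trace_star_mul_self_eq_zero ?_
      change LinearMap.trace ℂ π.E (star a.1 * a.1).toLinearMap / _ = _ at h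
      have h3 : (star a * a).2 = 0 := by
        change star a.2 * a.2 = 0
        rw [h1, mul_zero]
      rw [h3] at h
      simpa [hn] using h
  have h12' : ∀ a ∈ A, ∀ b ∈ A, a.1 = b.1 → a.2 = b.2 := fun a ha b hb h =>
    sub_eq_zero.1 ((h12 (a - b) (Submodule.sub_mem _ ha hb)).1 (sub_eq_zero.2 h))
  obtain ⟨u, hu⟩ := exists_norm_eq π.E zero_le_one
  -- the projection onto the line of `u`
  let P : π.E →L[ℂ] π.E := (innerSL ℂ u).smulRight u
  have hP : ∀ v, P v = ⟪u, v⟫_ℂ • u := fun v => rfl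
  have huu : ⟪u, u⟫_ℂ = 1 := by rw [inner_self_eq_norm_sq_to_K, hu]; simp
  have hPP : P * P = P := by
    ext v
    change P (P v) = P v
    rw [hP (P v), hP v, inner_smul_right, huu, mul_one]
  have hPs : star P = P := by
    refine ((ContinuousLinearMap.eq_adjoint_iff _ _).2 fun v w => ?_).symm
    rw [hP, hP, inner_smul_left, inner_smul_right, inner_conj_symm, mul_comm]
  have hPu : P u = u := by rw [hP, huu, one_smul]
  obtain ⟨p, hpA, hp⟩ := π.exists_pairSpan_fst_eq σ P
  have hpp : p.2 * p.2 = p.2 := h12' (p * p) (mul_mem_pairSpan hpA hpA) p hpA (by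
    change p.1 * p.1 = p.1
    rw [hp, hPP])
  have hps : star p.2 = p.2 := h12' (star p) (star_mem_pairSpan hpA) p hpA (by
    change star p.1 = p.1
    rw [hp, hPs])
  have hp0 : p.2 ≠ 0 := fun h => by
    have h1 := (h12 p hpA).2 h
    rw [hp] at h1
    have h2 : u = 0 := by rw [← hPu, h1]; rfl
    rw [h2, norm_zero] at hu
    exact zero_ne_one hu
  obtain ⟨u', hu', hpu'⟩ : ∃ u' : σ.E, ‖u'‖ = 1 ∧ p.2 u' = u' := by
    obtain ⟨w, hw⟩ : ∃ w, p.2 w ≠ 0 := by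
      by_contra! h
      exact hp0 (ContinuousLinearMap.ext h)
    refine ⟨((‖p.2 w‖⁻¹ : ℝ) : ℂ) • p.2 w, ?_, ?_⟩
    · rw [norm_smul, Complex.norm_real, norm_inv, norm_norm,
        inv_mul_cancel₀ (norm_ne_zero_iff.2 hw)]
    · rw [map_smul]
      congr 1
      exact DFunLike.congr_fun hpp w
  have hnorm : ∀ a ∈ A, ‖a.2 u'‖ = ‖a.1 u‖ := fun a ha => by
    have h1 : (p * (star a * a) * p).2 = (((‖a.1 u‖ ^ 2 : ℝ) : ℂ) • p).2 := by
      refine h12' _ (mul_mem_pairSpan (mul_mem_pairSpan hpA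
        (mul_mem_pairSpan (star_mem_pairSpan ha) ha)) hpA) _ (Submodule.smul_mem _ _ hpA) ?_
      change p.1 * (star a.1 * a.1) * p.1 = ((‖a.1 u‖ ^ 2 : ℝ) : ℂ) • p.1
      rw [hp]
      ext v
      change P (star a.1 (a.1 (P v))) = ((‖a.1 u‖ ^ 2 : ℝ) : ℂ) • P v
      rw [hP v, map_smul, map_smul, map_smul, hP, smul_comm, ContinuousLinearMap.star_eq_adjoint,
        ContinuousLinearMap.adjoint_inner_right, inner_self_eq_norm_sq_to_K]
      norm_cast
    have h2 : ⟪u', (p * (star a * a) * p).2 u'⟫_ℂ = ((‖a.2 u'‖ ^ 2 : ℝ) : ℂ) := by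
      change ⟪u', p.2 (star a.2 (a.2 (p.2 u')))⟫_ℂ = _
      have h3 : ∀ w, ⟪u', p.2 w⟫_ℂ = ⟪u', w⟫_ℂ := fun w => by
        conv_rhs => rw [← hpu', ← hps]
        rw [ContinuousLinearMap.star_eq_adjoint, ContinuousLinearMap.adjoint_inner_left]
      rw [h3, hpu', ContinuousLinearMap.star_eq_adjoint,
        ContinuousLinearMap.adjoint_inner_right, inner_self_eq_norm_sq_to_K]
      norm_cast
    rw [h1] at h2
    change ⟪u', ((‖a.1 u‖ ^ 2 : ℝ) : ℂ) • p.2 u'⟫_ℂ = _ at h2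
    rw [hpu', inner_smul_right, inner_self_eq_norm_sq_to_K, hu'] at h2
    simp only [map_one, one_pow, mul_one, Complex.ofReal_inj] at h2
    exact ((sq_eq_sq₀ (norm_nonneg _) (norm_nonneg _)).1 (by simpa using h2)).symm
  -- the isometry `a.1 u ↦ a.2 u'`
  let f : A →ₗ[ℂ] π.E :=
    { toFun := fun a => a.1.1 u, map_add' := fun a b => rfl, map_smul' := fun c a => rfl }
  let g : A →ₗ[ℂ] σ.E :=
    { toFun := fun a => a.1.2 u', map_add' := fun a b => rfl, map_smul' := fun c a => rfl }
  have hf : Function.Surjective f := fun v => by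
    obtain ⟨a, ha, hav⟩ := π.exists_pairSpan_fst_eq σ ((innerSL ℂ u).smulRight v)
    refine ⟨⟨a, ha⟩, ?_⟩
    change a.1 u = v
    rw [hav]
    change ⟪u, u⟫_ℂ • v = v
    rw [huu, one_smul]
  obtain ⟨s, hs⟩ := f.exists_rightInverse_of_surjective (LinearMap.range_eq_top.2 hf)
  have hs' : ∀ v, f (s v) = v := fun v => LinearMap.congr_fun hs v
  have hfg : ∀ a : A, ‖g a‖ = ‖f a‖ := fun a => hnorm a.1 a.2
  have hgs : ∀ a : A, g (s (f a)) = g a := fun a => by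
    rw [← sub_eq_zero, ← map_sub, ← norm_eq_zero, hfg, map_sub, hs', sub_self, norm_zero]
  let V₀ : π.E →ₗᵢ[ℂ] σ.E :=
    { toLinearMap := g.comp s
      norm_map' := fun v => by
        change ‖g (s v)‖ = ‖v‖
        rw [hfg, hs'] }
  have hV : ∀ x v, V₀ (π.op x v) = σ.op x (V₀ v) := fun x v => by
    obtain ⟨a, rfl⟩ := hf v
    change g (s _) = σ.op x (g (s (f a)))
    rw [hgs]
    exact hgs ⟨_, mul_mem_pairSpan (op_mem_pairSpan x) a.2⟩
  have hsurj : Function.Surjective V₀ := by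
    have h1 := σ.irreducible (LinearMap.range V₀.toLinearMap)
      (Submodule.closed_of_finiteDimensional _) (by
        rintro x _ ⟨v, rfl⟩
        exact ⟨π.op x v, hV x v⟩)
    refine LinearMap.range_eq_top.1 (h1.resolve_left fun h2 => ?_)
    have h3 : V₀ u ∈ LinearMap.range V₀.toLinearMap := ⟨u, rfl⟩
    rw [h2, Submodule.mem_bot] at h3
    have h4 := V₀.norm_map u
    rw [h3, norm_zero, hu] at h4
    exact zero_ne_one h4
  exact ⟨LinearIsometryEquiv.ofSurjective V₀ hsurj, hV⟩

end HGIrrep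

/-! ### Complete reducibility -/

namespace HGRep

variable {X : Type u} [TopologicalSpace X] [CompactSpace X] [T2Space X]
  [MeasurableSpace X] [BorelSpace X] [Hypergroup X]

/-- A subspace is invariant if it is mapped to itself by all operators. -/
def Invariant (π : HGRep X) (W : Submodule ℂ π.E) : Prop := ∀ x, ∀ w ∈ W, π.op x w ∈ W

theorem Invariant.inf_orthogonal {π : HGRep X} {V W : Submodule ℂ π.E} (hV : π.Invariant V)
    (hW : π.Invariant W) : π.Invariant (V ⊓ Wᗮ) := fun x w hw =>
  ⟨hV x w hw.1, (W.mem_orthogonal _).2 fun v hv => by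
    rw [← Hypergroup.inv_inv x, ← π.inner_op_left]
    exact (W.mem_orthogonal _).1 hw.2 _ (hW _ v hv)⟩

/-- The restriction of a finite-dimensional representation to an invariant subspace. -/
noncomputable def sub (π : HGRep X) [FiniteDimensional ℂ π.E] (W : Submodule ℂ π.E)
    (hW : π.Invariant W) : HGRep X where
  E := W
  separable := by
    have : ProperSpace W := FiniteDimensional.proper ℂ W
    infer_instance
  op x := ((π.op x).comp W.subtypeL).codRestrict W fun w => hW x w w.2
  op_e := by
    ext w
    change π.op e (w : π.E) = w
    rw [π.op_e]
    rfl
  op_inv x := by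
    rw [ContinuousLinearMap.eq_adjoint_iff]
    intro v w
    change ⟪π.op (inv x) (v : π.E), (w : π.E)⟫_ℂ = ⟪(v : π.E), π.op x w⟫_ℂ
    rw [π.inner_op_left, Hypergroup.inv_inv]
  op_conv x y v w := π.op_conv x y (v : π.E) w
  continuous_op v w := π.continuous_op (v : π.E) w

/-- A finite-dimensional representation is an orthogonal sum of irreducible invariant subspaces:
split off a nonzero invariant subspace of minimal dimension. -/
theorem exists_finset_irreducible (π : HGRep X) [FiniteDimensional ℂ π.E] (n : ℕ) :
    ∀ V : Submodule ℂ π.E, π.Invariant V → Module.finrank ℂ V = n →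
      ∃ s : Finset (Submodule ℂ π.E), (∀ W ∈ s, π.Invariant W ∧ W ≠ ⊥ ∧
        ∀ U, π.Invariant U → U ≤ W → U = ⊥ ∨ U = W) ∧
        (s : Set (Submodule ℂ π.E)).Pairwise (· ⟂ ·) ∧ s.sup id = V := by
  classical
  induction n using Nat.strong_induction_on with
  | _ n ih =>
    intro V hV hn
    by_cases hbot : V = ⊥
    · exact ⟨∅, by simp, by simp, by simp [hbot]⟩
    obtain ⟨W, ⟨hW, hWV, hW0⟩, hmin⟩ := WellFounded.has_min (measure
      fun U : Submodule ℂ π.E => Module.finrank ℂ U).wf {U | π.Invariant U ∧ U ≤ V ∧ U ≠ ⊥}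
      ⟨V, hV, le_rfl, hbot⟩
    have hWirr : ∀ U, π.Invariant U → U ≤ W → U = ⊥ ∨ U = W := fun U hU hUW => by
      by_contra! h
      exact hmin U ⟨hU, hUW.trans hWV, h.1⟩
        (Submodule.finrank_lt_finrank_of_lt (lt_of_le_of_ne hUW h.2))
    have hlt : V ⊓ Wᗮ < V := lt_of_le_of_ne inf_le_left fun h => hW0 <| by
      rw [Submodule.eq_bot_iff]
      intro w hw
      have h1 : w ∈ Wᗮ := (h.ge (hWV hw)).2
      exact inner_self_eq_zero.1 ((W.mem_orthogonal w).1 h1 w hw)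
    obtain ⟨s, hs, hpair, hsup⟩ := ih _ (hn ▸ Submodule.finrank_lt_finrank_of_lt hlt) _
      (hV.inf_orthogonal hW) rfl
    refine ⟨insert W s, ?_, ?_, ?_⟩
    · intro U hU
      rcases Finset.mem_insert.1 hU with rfl | hU
      · exact ⟨hW, hW0, hWirr⟩
      · exact hs U hU
    · rw [Finset.coe_insert, Set.pairwise_insert]
      refine ⟨hpair, fun U hU _ => ?_⟩
      have h1 : U ≤ V ⊓ Wᗮ := hsup ▸ Finset.le_sup (f := id) hU
      have h2 : U ⟂ W := Submodule.isOrtho_iff_le.2 (h1.trans inf_le_right)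
      exact ⟨h2.symm, h2⟩
    · rw [Finset.sup_insert, hsup, id, inf_comm]
      exact Submodule.sup_orthogonal_inf_of_hasOrthogonalProjection hWV

/-- The irreducible constituent on a minimal invariant subspace. -/
noncomputable def subIrrep (π : HGRep X) [FiniteDimensional ℂ π.E] (W : Submodule ℂ π.E)
    (hW : π.Invariant W ∧ W ≠ ⊥ ∧ ∀ U, π.Invariant U → U ≤ W → U = ⊥ ∨ U = W) : HGIrrep X where
  toHGRep := π.sub W hW.1
  nontrivial := Submodule.nontrivial_iff_ne_bot.2 hW.2.1
  irreducible U _ hU := by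
    let U : Submodule ℂ W := U
    have h1 : π.Invariant (U.map W.subtype) := by
      rintro x _ ⟨w, hw, rfl⟩
      exact ⟨_, hU x w hw, rfl⟩
    rcases hW.2.2 _ h1 (Submodule.map_subtype_le W U) with h | h
    · left
      refine (Submodule.eq_bot_iff U).2 fun w hw => ?_
      have h2 : W.subtype w ∈ U.map W.subtype := ⟨w, hw, rfl⟩
      rw [h, Submodule.mem_bot] at h2
      exact Subtype.ext h2
    · right
      refine Submodule.eq_top_iff'.2 fun w => ?_
      have h2 : W.subtype w ∈ U.map W.subtype := h.ge w.2
      obtain ⟨w', hw', he⟩ := h2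
      rwa [← Subtype.ext he]

theorem exists_decomposition (π : HGRep X) [FiniteDimensional ℂ π.E] :
    ∃ (m : ℕ) (ρ : Fin m → HGIrrep X) (T : PiLp 2 (fun j => (ρ j).E) ≃ₗᵢ[ℂ] π.E),
      (∀ j, FiniteDimensional ℂ (ρ j).E) ∧
      ∀ x (v : PiLp 2 (fun j => (ρ j).E)),
        T (WithLp.toLp 2 fun j => (ρ j).op x (v j)) = π.op x (T v) := by
  classical
  obtain ⟨s, hs, hpair, hsup⟩ := π.exists_finset_irreducible _ ⊤ (fun x w _ => Submodule.mem_top) rfl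
  let ε : Fin s.card ≃ s := s.equivFin.symm
  let W : Fin s.card → Submodule ℂ π.E := fun j => ε j
  have hfam : OrthogonalFamily ℂ (fun j => W j) fun j => (W j).subtypeₗᵢ := by
    refine OrthogonalFamily.of_pairwise fun i j hij => ?_
    exact hpair (ε i).2 (ε j).2 fun h => hij (ε.injective (Subtype.ext h))
  have hint : DirectSum.IsInternal W := by
    rw [hfam.isInternal_iff, Submodule.orthogonal_eq_bot_iff, ← hsup, eq_comm]
    refine le_antisymm (Finset.sup_le fun U hU => ?_) (iSup_le fun j => ?_)
    · have : U = W (ε.symm ⟨U, hU⟩) := by simp [W]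
      rw [this]
      exact le_iSup W _
    · exact Finset.le_sup (f := id) (ε j).2
  refine ⟨s.card, fun j => π.subIrrep (W j) (hs _ (ε j).2),
    (hint.isometryL2OfOrthogonalFamily hfam).symm, fun j => ?_, fun x v => ?_⟩
  · change FiniteDimensional ℂ (W j)
    infer_instance
  · refine (hint.isometryL2OfOrthogonalFamily_symm_apply hfam _).trans ?_
    refine Eq.trans ?_ (congrArg (π.op x)
      (hint.isometryL2OfOrthogonalFamily_symm_apply hfam v).symm)
    rw [map_sum]
    rfl

/-- The character of a finite-dimensional representation is the mean of those of its irreducible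
constituents, weighted by their dimensions. -/
theorem ch_eq_sum_constituents (π : HGRep X) [FiniteDimensional ℂ π.E] {m : ℕ}
    (ρ : Fin m → HGIrrep X) [∀ j, FiniteDimensional ℂ (ρ j).E]
    (T : PiLp 2 (fun j => (ρ j).E) ≃ₗᵢ[ℂ] π.E)
    (hT : ∀ x (v : PiLp 2 (fun j => (ρ j).E)),
      T (WithLp.toLp 2 fun j => (ρ j).op x (v j)) = π.op x (T v)) (x : X) :
    π.ch x = ∑ j, ((Module.finrank ℂ (ρ j).E : ℂ) / Module.finrank ℂ π.E) * (ρ j).ch x := by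
  classical
  let b := Pi.orthonormalBasis fun j => stdOrthonormalBasis ℂ (ρ j).E
  rw [π.ch_eq_sum (b.map T), Fintype.sum_sigma, Finset.sum_div]
  refine Finset.sum_congr rfl fun j _ => ?_
  have hj : (Module.finrank ℂ (ρ j).E : ℂ) ≠ 0 := Nat.cast_ne_zero.2 (ρ j).finrank_ne_zero
  rw [(ρ j).toHGRep.ch_eq_sum (stdOrthonormalBasis ℂ (ρ j).E), div_mul_div_comm, mul_comm,
    mul_div_mul_right _ _ hj]
  congr 1
  refine Finset.sum_congr rfl fun i _ => ?_
  rw [OrthonormalBasis.map_apply, ← hT, T.inner_map_map, PiLp.inner_apply]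
  rw [Finset.sum_eq_single j]
  · simp [b]
  · intro k _ hk
    simp [b, hk]
  · simp

end HGRep

/-! ### The cone of characters and restriction -/

section Cone

variable {X : Type u} [TopologicalSpace X] [CompactSpace X] [T2Space X]
  [MeasurableSpace X] [BorelSpace X] [Hypergroup X]

variable (X) in
/-- The linear combinations of characters with nonnegative coefficients. -/
noncomputable def charCone : Submodule NNReal (X → ℂ) :=
  Submodule.span NNReal (Set.range CharSpace.fn)

theorem CharSpace.fn_mem_cone (χ : CharSpace X) : χ.fn ∈ charCone X :=
  Submodule.subset_span ⟨χ, rfl⟩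

theorem charCone.sum_mem {ι : Type*} (s : Finset ι) (a : ι → ℝ) (ha : ∀ i ∈ s, 0 ≤ a i)
    (f : ι → X → ℂ) (hf : ∀ i ∈ s, f i ∈ charCone X) :
    (∑ i ∈ s, ((a i : ℝ) : ℂ) • f i) ∈ charCone X := by
  refine Submodule.sum_mem _ fun i hi => ?_
  have h : ((a i : ℝ) : ℂ) • f i = (a i).toNNReal • f i := by
    ext x
    rw [Pi.smul_apply, Pi.smul_apply, NNReal.smul_def, smul_eq_mul, Complex.real_smul,
      Real.coe_toNNReal _ (ha i hi)]
  rw [h]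
  exact Submodule.smul_mem _ _ (hf i hi)

theorem charCone.mem_charSpan {f : X → ℂ} (hf : f ∈ charCone X) : f ∈ charSpan X := by
  induction hf using Submodule.span_induction with
  | mem f hf => exact Submodule.subset_span hf
  | zero => exact Submodule.zero_mem _
  | add f g _ _ hf hg => exact Submodule.add_mem _ hf hg
  | smul a f _ hf =>
    have h : a • f = ((a : ℝ) : ℂ) • f := by
      ext x
      rw [Pi.smul_apply, Pi.smul_apply, NNReal.smul_def, smul_eq_mul, Complex.real_smul]
    rw [h]
    exact Submodule.smul_mem _ _ hf

theorem charCone.exists_finsupp {f : X → ℂ} (hf : f ∈ charCone X) :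
    ∃ c : CharSpace X →₀ ℝ, (∀ χ, 0 ≤ c χ) ∧ ∀ x, f x = c.sum fun χ a => a • χ.fn x := by
  rw [charCone, Finsupp.mem_span_range_iff_exists_finsupp] at hf
  obtain ⟨c, rfl⟩ := hf
  refine ⟨c.mapRange NNReal.toReal NNReal.coe_zero, fun χ => by simp, fun x => ?_⟩
  refine Eq.trans ?_ (Finsupp.sum_mapRange_index fun χ => zero_smul ℝ (χ.fn x)).symm
  rw [Finsupp.sum, Finset.sum_apply]
  rfl

theorem IsStrong.mul_mem_cone [SecondCountableTopology X] (hX : IsStrong X) {f g : X → ℂ}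
    (hf : f ∈ charCone X) (hg : g ∈ charCone X) : f * g ∈ charCone X := by
  induction hf, hg using Submodule.span_induction₂ with
  | mem_mem f g hf hg =>
    obtain ⟨χ, rfl⟩ := hf
    obtain ⟨ψ, rfl⟩ := hg
    obtain ⟨c, hc0, -, hc, -⟩ := hX.exists_mul_eq χ ψ
    have h : χ.fn * ψ.fn = ∑ ρ ∈ c.support, ((c ρ : ℝ) : ℂ) • ρ.fn := by
      ext x
      rw [Pi.mul_apply, hc, Finset.sum_apply]
      rfl
    rw [h]
    exact charCone.sum_mem _ _ (fun ρ _ => hc0 ρ) _ fun ρ _ => ρ.fn_mem_cone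
  | zero_left g _ => rw [zero_mul]; exact Submodule.zero_mem _
  | zero_right f _ => rw [mul_zero]; exact Submodule.zero_mem _
  | add_left f g k _ _ _ h1 h2 => rw [add_mul]; exact Submodule.add_mem _ h1 h2
  | add_right f g k _ _ _ h1 h2 => rw [mul_add]; exact Submodule.add_mem _ h1 h2
  | smul_left a f g _ _ h => rw [smul_mul_assoc]; exact Submodule.smul_mem _ _ h
  | smul_right a f g _ _ h => rw [mul_smul_comm]; exact Submodule.smul_mem _ _ h

end Cone

namespace Subhypergroup

variable {H : Type u} [TopologicalSpace H] [CompactSpace H] [T2Space H]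
  [MeasurableSpace H] [BorelSpace H] [Hypergroup H] {S : Subhypergroup H}

/-- The restriction of a representation to a subhypergroup. -/
noncomputable def resRep (S : Subhypergroup H) (π : HGRep H) : HGRep S where
  E := π.E
  op h := π.op h
  op_e := π.op_e
  op_inv h := π.op_inv h
  op_conv x y v w :=
    (S.integral_subConv x y fun z => ⟪v, π.op z w⟫_ℂ).trans (π.op_conv x y v w)
  continuous_op v w := (π.continuous_op v w).comp continuous_subtype_val

/-- The restriction of an irreducible representation is completely reducible. -/
theorem res_fn_mem_cone (hH : IsStrong H) (χ : CharSpace H) :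
    res (S := S) χ.fn ∈ charCone S := by
  obtain ⟨π, rfl⟩ := χ.exists_ofRep
  have := hH.finiteDimensional π
  let σ := S.resRep π.toHGRep
  have hσ : FiniteDimensional ℂ σ.E := this
  obtain ⟨m, ρ, T, hfin, hT⟩ := σ.exists_decomposition
  have h : res (S := S) (CharSpace.ofRep π).fn = ∑ j : Fin m,
      (((Module.finrank ℂ (ρ j).E : ℝ) / Module.finrank ℂ σ.E : ℝ) : ℂ) •
        (CharSpace.ofRep (ρ j)).fn := by
    ext y
    rw [Finset.sum_apply]
    refine (σ.ch_eq_sum_constituents ρ T hT y).trans (Finset.sum_congr rfl fun j _ => ?_)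
    rw [Pi.smul_apply, smul_eq_mul]
    push_cast
    rfl
  rw [h]
  exact charCone.sum_mem _ _ (fun j _ => by positivity) _ fun j _ => CharSpace.fn_mem_cone _

theorem res_mem (hH : IsStrong H) {f : H → ℂ} (hf : f ∈ charSpan H) :
    res (S := S) f ∈ charSpan S := by
  induction hf using Submodule.span_induction with
  | mem f hf => obtain ⟨χ, rfl⟩ := hf; exact charCone.mem_charSpan (res_fn_mem_cone hH χ)
  | zero => exact Submodule.zero_mem (charSpan S)
  | add f g _ _ hf hg => exact Submodule.add_mem _ hf hg
  | smul a f _ hf => exact Submodule.smul_mem _ a hf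

/-! ### Induction of characters is well defined and linear -/

variable [SecondCountableTopology H]

theorem coeFn_compLp_mem_indSpace {τ τ' : HGRep S} (V : τ.E ≃ₗᵢ[ℂ] τ'.E)
    (hV : ∀ h v, V (τ.op h v) = τ'.op h (V v)) {ξ : Lp τ.E 2 (hgHaar H)} (hξ : ξ ∈ indSpace τ) :
    (V : τ.E →L[ℂ] τ'.E).compLp ξ ∈ indSpace τ' := by
  intro h
  have hae := (V : τ.E →L[ℂ] τ'.E).coeFn_compLp ξ
  have hae2 : ∀ᵐ x ∂(hgHaar H), ∀ᵐ z ∂(conv (h : H) x),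
      (V : τ.E →L[ℂ] τ'.E).compLp ξ z = V (ξ z) :=
    ae_ae_conv_left (h : H) hae
  filter_upwards [hξ h, hae, hae2] with x h1 h2 h3
  rw [integral_congr_ae h3, h2]
  change ∫ z, V.toContinuousLinearEquiv (ξ z) ∂(conv (h : H) x) = τ'.op h (V (ξ x))
  rw [ContinuousLinearEquiv.integral_comp_comm, h1, ← hV]
  rfl

theorem IsIndDecomposition.congr {τ τ' : HGRep S} (V : τ.E ≃ₗᵢ[ℂ] τ'.E)
    (hV : ∀ h v, V (τ.op h v) = τ'.op h (V v)) {m : ℕ} {π : Fin m → HGIrrep H}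
    (hπ : IsIndDecomposition τ π) : IsIndDecomposition τ' π := by
  obtain ⟨T, hrange, hT⟩ := hπ
  let L : τ.E →L[ℂ] τ'.E := V
  have hae : ∀ ξ : Lp τ.E 2 (hgHaar H), ∀ᵐ x ∂(hgHaar H), L.compLp ξ x = V (ξ x) :=
    fun ξ => L.coeFn_compLp ξ
  let T' : PiLp 2 (fun j => (π j).E) →ₗᵢ[ℂ] Lp τ'.E 2 (hgHaar H) :=
    { toLinearMap := (L.compLpₗ 2 (hgHaar H)).comp T.toLinearMap
      norm_map' := fun v => by
        rw [← T.norm_map v]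
        change ‖L.compLp (T v)‖ = ‖T v‖
        rw [Lp.norm_def, Lp.norm_def]
        congr 1
        refine eLpNorm_congr_norm_ae ?_
        filter_upwards [hae (T v)] with x hx
        rw [hx, V.norm_map] }
  have hT' : ∀ v, T' v = L.compLp (T v) := fun v => rfl
  refine ⟨T', ?_, fun h v => ?_⟩
  · ext ξ
    constructor
    · rintro ⟨v, rfl⟩
      exact coeFn_compLp_mem_indSpace V hV (hrange ▸ ⟨v, rfl⟩ : T v ∈ indSpace τ)
    · intro hξ
      have hV' : ∀ h v, V.symm (τ'.op h v) = τ.op h (V.symm v) := fun h v => by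
        rw [LinearIsometryEquiv.symm_apply_eq, hV, V.apply_symm_apply]
      have h1 := coeFn_compLp_mem_indSpace V.symm hV' hξ
      rw [← hrange] at h1
      obtain ⟨v, hv⟩ := h1
      refine ⟨v, Lp.ext ?_⟩
      rw [hT', hv]
      filter_upwards [hae ((V.symm : τ'.E →L[ℂ] τ.E).compLp ξ),
        (V.symm : τ'.E →L[ℂ] τ.E).coeFn_compLp ξ] with x h1 h2
      rw [h1, h2]
      exact V.apply_symm_apply _
  · have h1 : ∀ᵐ x ∂(hgHaar H), ∀ᵐ z ∂(conv x h), L.compLp (T v) z = V (T v z) :=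
      ae_ae_conv_right h (hae (T v))
    filter_upwards [hT h v, h1, hae (T (WithLp.toLp 2 fun j => (π j).op h (v j)))] with x h2 h3 h4
    rw [hT', h4, h2, hT', integral_congr_ae h3]
    exact (V.toContinuousLinearEquiv.integral_comp_comm _).symm

/-- Irreducible representations with equal characters are equivalent, so that the representations
induced from them have the same decompositions. -/
theorem indCh_congr (hS : IsStrong S) {τ τ' : HGIrrep S} (h : τ.ch = τ'.ch) :
    indCh τ = indCh τ' := by
  have := hS.finiteDimensional τ
  have := hS.finiteDimensional τ'
  obtain ⟨V, hV⟩ := τ.exists_linearIsometryEquiv τ' h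
  have hV' : ∀ h v, V.symm (τ'.op h v) = τ.op h (V.symm v) := fun h v => by
    rw [LinearIsometryEquiv.symm_apply_eq, hV, V.apply_symm_apply]
  have hiff : (fun D : (m : ℕ) × (Fin m → HGIrrep H) => IsIndDecomposition τ.toHGRep D.2) =
      fun D => IsIndDecomposition τ'.toHGRep D.2 :=
    funext fun D => propext ⟨IsIndDecomposition.congr V hV, IsIndDecomposition.congr V.symm hV'⟩
  have key : ∀ P Q : ((m : ℕ) × (Fin m → HGIrrep H)) → Prop, P = Q → ∀ (hP : ∃ D, P D)
      (hQ : ∃ D, Q D), hP.choose = hQ.choose := by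
    rintro P _ rfl _ _
    rfl
  ext x
  unfold indCh
  by_cases hD : ∃ D : (m : ℕ) × (Fin m → HGIrrep H), IsIndDecomposition τ.toHGRep D.2
  · have hD' : ∃ D : (m : ℕ) × (Fin m → HGIrrep H), IsIndDecomposition τ'.toHGRep D.2 := by
      simpa only [← congrFun hiff] using hD
    rw [dif_pos hD, dif_pos hD', key _ _ hiff hD hD']
  · have hD' : ¬ ∃ D : (m : ℕ) × (Fin m → HGIrrep H), IsIndDecomposition τ'.toHGRep D.2 := by
      simpa only [← congrFun hiff] using hD
    rw [dif_neg hD, dif_neg hD']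

/-- The characters being linearly independent, the induction of functions is the linear extension
of the induction of characters. -/
theorem exists_linearMap_ind (hS : IsStrong S) [SecondCountableTopology S] :
    ∃ L : charSpan S →ₗ[ℂ] (H → ℂ), (∀ f (hf : f ∈ charSpan S), ind f = L ⟨f, hf⟩) ∧
      ∀ τ : HGIrrep S, L ⟨τ.ch, τ.ch_mem⟩ = indCh τ := by
  let b : Module.Basis (CharSpace S) ℂ (charSpan S) := Module.Basis.span hS.linearIndependent
  have hb : ∀ χ, (b χ : S → ℂ) = χ.fn := fun χ =>
    congrArg Subtype.val (Module.Basis.span_apply hS.linearIndependent χ)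
  let L : charSpan S →ₗ[ℂ] (H → ℂ) :=
    b.constr ℂ fun χ : CharSpace S => indCh χ.exists_ofRep.choose
  have hL : ∀ τ : HGIrrep S, L ⟨τ.ch, τ.ch_mem⟩ = indCh τ := fun τ => by
    have h1 : (⟨τ.ch, τ.ch_mem⟩ : charSpan S) = b (CharSpace.ofRep τ) :=
      Subtype.ext (hb (CharSpace.ofRep τ)).symm
    rw [h1, Module.Basis.constr_basis]
    refine indCh_congr hS ?_
    exact congrArg CharSpace.fn (CharSpace.ofRep τ).exists_ofRep.choose_spec.symm
  refine ⟨L, fun f hf => ?_, hL⟩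
  have hD : ∃ D : (m : ℕ) × (Fin m → ℂ) × (Fin m → HGIrrep S),
      ∀ y, f y = ∑ k, D.2.1 k * (D.2.2 k).ch y := by
    obtain ⟨c, rfl⟩ := mem_charSpan_iff.1 hf
    let ε := c.support.equivFin.symm
    refine ⟨⟨c.support.card, fun k => c (ε k), fun k => (ε k).1.exists_ofRep.choose⟩, fun y => ?_⟩
    have h1 : ∀ k, ((ε k).1.exists_ofRep.choose).ch = (ε k).1.fn := fun k =>
      congrArg CharSpace.fn (ε k).1.exists_ofRep.choose_spec.symm
    simp only [h1]
    rw [ε.sum_comp fun χ : c.support => c χ * χ.1.fn y, Finsupp.sum, Finset.sum_apply,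
      ← Finset.sum_coe_sort]
    rfl
  have h1 : (⟨f, hf⟩ : charSpan S) =
      ∑ k, hD.choose.2.1 k • ⟨(hD.choose.2.2 k).ch, (hD.choose.2.2 k).ch_mem⟩ := by
    refine Subtype.ext (funext fun y => ?_)
    rw [Submodule.coe_sum, Finset.sum_apply]
    exact hD.choose_spec y
  ext x
  rw [ind, dif_pos hD, h1, map_sum, Finset.sum_apply]
  refine Finset.sum_congr rfl fun k _ => ?_
  rw [map_smul, hL]
  rfl

end Subhypergroup

/-! ### The trivial character in an induced character -/

section Hyperdim

variable {X : Type u} [TopologicalSpace X] [CompactSpace X] [T2Space X]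
  [SecondCountableTopology X] [MeasurableSpace X] [BorelSpace X] [Hypergroup X]

theorem HGIrrep.hyperdim_pos (π : HGIrrep X) [FiniteDimensional ℂ π.E] : 0 < π.hyperdim := by
  let b := stdOrthonormalBasis ℂ π.E
  have h : ∀ x, (LinearMap.trace ℂ π.E
      (ContinuousLinearMap.adjoint (π.op x) * π.op x).toLinearMap).re =
        ∑ i, ‖π.op x (b i)‖ ^ 2 := fun x => by
    rw [LinearMap.trace_eq_sum_inner _ b, Complex.re_sum]
    refine Finset.sum_congr rfl fun i _ => ?_
    change (⟪b i, ContinuousLinearMap.adjoint (π.op x) (π.op x (b i))⟫_ℂ).re = _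
    rw [ContinuousLinearMap.adjoint_inner_right]
    exact (norm_sq_eq_re_inner (𝕜 := ℂ) _).symm
  have hc : Continuous fun x => ∑ i, ‖π.op x (b i)‖ ^ 2 :=
    continuous_finsetSum _ fun i _ =>
      ((π.toHGRep.continuous_op_norm.clm_apply continuous_const).norm).pow 2
  have hpos : 0 < ∫ x, ∑ i, ‖π.op x (b i)‖ ^ 2 ∂(hgHaar X) := by
    refine hc.integral_pos_of_hasCompactSupport_nonneg_nonzero (HasCompactSupport.of_compactSpace _)
      (fun x => Finset.sum_nonneg fun i _ => sq_nonneg _) (x := e) ?_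
    rw [π.op_e]
    simpa using π.finrank_ne_zero
  rw [hyperdim]
  simp_rw [h]
  have := π.finrank_ne_zero
  positivity

/-- A square integrable function invariant under right translations is constant. -/
theorem ae_eq_const_of_translation_invariant {E : Type*} [NormedAddCommGroup E]
    [InnerProductSpace ℂ E] [CompleteSpace E] (ξ : Lp E 2 (hgHaar X))
    (h : ∀ h : X, ∀ᵐ x ∂(hgHaar X), ξ x = ∫ z, ξ z ∂(conv x h)) :
    ∃ u : E, ∀ᵐ x ∂(hgHaar X), ξ x = u := by
  have hint : Integrable ξ (hgHaar X) := (Lp.memLp ξ).integrable one_le_two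
  have hξ : StronglyMeasurable ξ := Lp.stronglyMeasurable ξ
  have hF : StronglyMeasurable fun p : X × X => ∫ z, ξ z ∂(conv p.1 p.2) :=
    hξ.integral_kernel (κ := convKernel X)
  refine ⟨∫ z, ξ z ∂(hgHaar X), ?_⟩
  have h1 : ∀ᵐ x ∂(hgHaar X), ∀ᵐ y ∂(hgHaar X), ξ x = ∫ z, ξ z ∂(conv x y) := by
    rw [Measure.ae_ae_comm]
    · exact Filter.Eventually.of_forall h
    · exact (hξ.comp_measurable measurable_fst).measurableSet_eq_fun hF
  filter_upwards [h1] with x hx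
  rw [← integral_hgHaar_left hint x, ← integral_congr_ae hx]
  simp

end Hyperdim

namespace Subhypergroup

variable {H : Type u} [TopologicalSpace H] [CompactSpace H] [T2Space H]
  [SecondCountableTopology H] [MeasurableSpace H] [BorelSpace H] [Hypergroup H]
  {S : Subhypergroup H}

/-- The trivial representation occurs in an induced representation only if this is induced from the
trivial representation. -/
theorem IsIndDecomposition.ch_eq_one {τ : HGIrrep S} {m : ℕ} {π : Fin m → HGIrrep H}
    (hπ : IsIndDecomposition τ.toHGRep π) {j : Fin m} (hj : ∀ x, (π j).op x = 1)
    (hτ : Module.finrank ℂ τ.E ≠ 0) : τ.ch = 1 := by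
  classical
  obtain ⟨T, hrange, hT⟩ := hπ
  obtain ⟨w, hw⟩ := exists_ne (0 : (π j).E)
  let v : PiLp 2 (fun j => (π j).E) := PiLp.single 2 j w
  have hv0 : v ≠ 0 := fun h => hw (by
    have := congrArg (fun v : PiLp 2 (fun j => (π j).E) => v j) h
    simpa [v] using this)
  have hfix : ∀ h, (WithLp.toLp 2 fun i => (π i).op h (v i)) = v := fun h => by
    ext i
    change (π i).op h (v i) = v i
    by_cases hij : i = j
    · subst hij
      rw [hj]
      rfl
    · have : v i = 0 := by simp [v, hij]
      rw [this, map_zero]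
  obtain ⟨u, hu⟩ := ae_eq_const_of_translation_invariant (T v) fun h => by
    have := hT h v
    rwa [hfix] at this
  have hu0 : u ≠ 0 := by
    rintro rfl
    refine hv0 (T.injective ?_)
    rw [map_zero]
    exact (Lp.eq_zero_iff_ae_eq_zero).2 hu
  refine τ.toHGRep.ch_eq_one_of_op_eq_one hτ (τ.op_eq_one_of_fixed hu0 fun h => ?_)
  have hmem : T v ∈ indSpace τ.toHGRep := hrange ▸ ⟨v, rfl⟩
  obtain ⟨x, h1, h2, h3⟩ := ((hmem h).and ((ae_ae_conv_left (h : H) hu).and hu)).exists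
  rw [integral_congr_ae h2, h3] at h1
  simpa using h1.symm

theorem indCh_eq_zero_or_exists (τ : HGIrrep S) :
    indCh τ = 0 ∨ ∃ (m : ℕ) (π : Fin m → HGIrrep H), IsIndDecomposition τ.toHGRep π ∧
      indCh τ = ∑ j, (((π j).hyperdim / ∑ i, (π i).hyperdim : ℝ) : ℂ) • (π j).ch := by
  by_cases h : ∃ D : (m : ℕ) × (Fin m → HGIrrep H), IsIndDecomposition τ.toHGRep D.2
  · refine Or.inr ⟨h.choose.1, h.choose.2, h.choose_spec, ?_⟩
    ext x
    rw [indCh, dif_pos h, Finset.sum_apply]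
    rfl
  · left
    ext x
    rw [indCh, dif_neg h]
    rfl

theorem indCh_mem_cone (hH : IsStrong H) (τ : HGIrrep S) : indCh τ ∈ charCone H := by
  rcases indCh_eq_zero_or_exists τ with h | ⟨m, π, -, h⟩
  · rw [h]
    exact Submodule.zero_mem _
  · have hpos : ∀ j, 0 ≤ (π j).hyperdim := fun j => by
      have := hH.finiteDimensional (π j)
      exact (π j).hyperdim_pos.le
    rw [h]
    exact charCone.sum_mem _ _
      (fun j _ => div_nonneg (hpos j) (Finset.sum_nonneg fun i _ => hpos i)) _
      fun j _ => (CharSpace.ofRep (π j)).fn_mem_cone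

theorem integral_ch_eq_zero_or_one (hH : IsStrong H) (π : HGIrrep H) :
    ∫ x, π.ch x ∂(hgHaar H) = 0 ∧ (¬ ∀ x, π.op x = 1) ∨
      ∫ x, π.ch x ∂(hgHaar H) = 1 ∧ ∀ x, π.op x = 1 := by
  have := hH.finiteDimensional π
  by_cases h : π.ch = 1
  · right
    have htriv : FiniteDimensional ℂ (HGIrrep.trivial H).E := inferInstanceAs
      (FiniteDimensional ℂ ℂ)
    obtain ⟨V, hV⟩ := (HGIrrep.trivial H).exists_linearIsometryEquiv π (by
      rw [h]; exact HGRep.trivial_ch)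
    refine ⟨by rw [h]; simp, fun x => ?_⟩
    ext w
    have h1 := hV x (V.symm w)
    rw [V.apply_symm_apply] at h1
    exact h1.symm.trans (V.apply_symm_apply w)
  · exact Or.inl ⟨π.integral_ch_eq_zero h, fun h1 =>
      h (π.toHGRep.ch_eq_one_of_op_eq_one π.finrank_ne_zero h1)⟩

theorem integral_indCh (hH : IsStrong H) {m : ℕ} (π : Fin m → HGIrrep H) (a : Fin m → ℝ) :
    ∫ x, (∑ j, ((a j : ℝ) : ℂ) • (π j).ch) x ∂(hgHaar H) =
      ∑ j, ((a j : ℝ) : ℂ) * ∫ x, (π j).ch x ∂(hgHaar H) := by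
  have h : ∀ x, (∑ j, ((a j : ℝ) : ℂ) • (π j).ch) x = ∑ j, ((a j : ℝ) : ℂ) * (π j).ch x :=
    fun x => by rw [Finset.sum_apply]; rfl
  simp_rw [h]
  rw [integral_finsetSum _ fun j _ => ?_]
  · simp_rw [integral_const_mul]
  · exact ((hH.continuous_of_mem (π j).ch_mem).integrable_of_compactSpace _).const_mul _

theorem integral_indCh_eq_zero (hH : IsStrong H) (hS : IsStrong S) (τ : HGIrrep S)
    (hτ : τ.ch ≠ 1) : ∫ x, indCh τ x ∂(hgHaar H) = 0 := by
  rcases indCh_eq_zero_or_exists τ with h | ⟨m, π, hπ, h⟩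
  · rw [h]
    simp
  · rw [h, integral_indCh hH]
    refine Finset.sum_eq_zero fun j _ => ?_
    rcases integral_ch_eq_zero_or_one hH (π j) with h1 | h1
    · rw [h1.1, mul_zero]
    · exact absurd (hπ.ch_eq_one h1.2 (hS.finrank_ne_zero τ)) hτ

/-- If the representation induced from the trivial one decomposes, then the trivial representation
occurs in it, on the constant functions. -/
theorem indCh_trivial (hH : IsStrong H)
    (hex : ∃ (m : ℕ) (π : Fin m → HGIrrep H),
      IsIndDecomposition (HGIrrep.trivial S).toHGRep π) :
    indCh (HGIrrep.trivial S) e = 1 ∧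
      ∃ c : ℝ, 0 < c ∧ ∫ x, indCh (HGIrrep.trivial S) x ∂(hgHaar H) = c := by
  have hD : ∃ D : (m : ℕ) × (Fin m → HGIrrep H),
      IsIndDecomposition (HGIrrep.trivial S).toHGRep D.2 := by
    obtain ⟨m, π, h⟩ := hex
    exact ⟨⟨m, π⟩, h⟩
  obtain ⟨m, π, hπ, hind⟩ : ∃ (m : ℕ) (π : Fin m → HGIrrep H),
      IsIndDecomposition (HGIrrep.trivial S).toHGRep π ∧ indCh (HGIrrep.trivial S) =
        ∑ j, (((π j).hyperdim / ∑ i, (π i).hyperdim : ℝ) : ℂ) • (π j).ch := by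
    refine ⟨hD.choose.1, hD.choose.2, hD.choose_spec, ?_⟩
    ext x
    rw [indCh, dif_pos hD, Finset.sum_apply]
    rfl
  have hpos : ∀ j, 0 < (π j).hyperdim := fun j => by
    have := hH.finiteDimensional (π j)
    exact (π j).hyperdim_pos
  obtain ⟨j, hj⟩ : ∃ j, ∀ x, (π j).op x = 1 := by
    obtain ⟨T, hrange, hT⟩ := hπ
    let ξ : Lp ℂ 2 (hgHaar H) := Lp.const 2 (hgHaar H) (1 : ℂ)
    have hξ : ∀ᵐ x ∂(hgHaar H), ξ x = 1 := Lp.coeFn_const _ _ _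
    have hmem : ξ ∈ indSpace (HGIrrep.trivial S).toHGRep := fun h => by
      filter_upwards [hξ, ae_ae_conv_left (h : H) hξ] with x h1 h2
      refine (integral_congr_ae h2).trans ?_
      refine Eq.trans ?_ h1.symm
      simp
    rw [← hrange] at hmem
    obtain ⟨v, hv⟩ := hmem
    have hv0 : v ≠ 0 := fun h => by
      rw [h, map_zero] at hv
      have h0 : ∀ᵐ x ∂(hgHaar H), ξ x = 0 := by
        rw [← hv]
        exact Lp.coeFn_zero _ _ _
      obtain ⟨x, h1, h2⟩ := (hξ.and h0).exists
      rw [h1] at h2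
      exact one_ne_zero h2
    have hfix : ∀ h, (WithLp.toLp 2 fun i => (π i).op h (v i)) = v := fun h => by
      refine T.injective (Lp.ext ?_)
      rw [hv]
      refine (hT h v).trans ?_
      rw [hv]
      filter_upwards [hξ, ae_ae_conv_right h hξ] with x h1 h2
      refine (integral_congr_ae h2).trans ?_
      refine Eq.trans ?_ h1.symm
      simp
    obtain ⟨j, hj⟩ : ∃ j, v j ≠ 0 := by
      by_contra! h
      exact hv0 (by ext i; exact h i)
    exact ⟨j, (π j).op_eq_one_of_fixed hj fun h =>
      congrArg (fun v : PiLp 2 (fun j => (π j).E) => v j) (hfix h)⟩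
  have hsum : 0 < ∑ i, (π i).hyperdim := Finset.sum_pos (fun i _ => hpos i) ⟨j, Finset.mem_univ j⟩
  constructor
  · rw [hind, Finset.sum_apply]
    have h1 : ∀ i, ((((π i).hyperdim / ∑ i, (π i).hyperdim : ℝ) : ℂ) • (π i).ch) e =
        (((π i).hyperdim / ∑ i, (π i).hyperdim : ℝ) : ℂ) := fun i => by
      rw [Pi.smul_apply, (π i).toHGRep.ch_e (hH.finrank_ne_zero _), smul_eq_mul, mul_one]
    simp_rw [h1]
    rw [← Complex.ofReal_sum, ← Finset.sum_div, div_self hsum.ne', Complex.ofReal_one]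
  · rw [hind, integral_indCh hH]
    have h1 : ∀ i, ∃ b : ℝ, 0 ≤ b ∧ ((∀ x, (π i).op x = 1) → b = 1) ∧
        ∫ x, (π i).ch x ∂(hgHaar H) = b := fun i => by
      rcases integral_ch_eq_zero_or_one hH (π i) with h1 | h1
      · exact ⟨0, le_rfl, fun h => absurd h h1.2, by rw [h1.1]; simp⟩
      · exact ⟨1, zero_le_one, fun _ => rfl, by rw [h1.1]; simp⟩
    choose b hb0 hb1 hb using h1
    refine ⟨∑ i, ((π i).hyperdim / ∑ i, (π i).hyperdim) * b i, ?_, ?_⟩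
    · refine Finset.sum_pos' (fun i _ => mul_nonneg (div_nonneg (hpos i).le hsum.le) (hb0 i))
        ⟨j, Finset.mem_univ j, ?_⟩
      rw [hb1 j hj, mul_one]
      exact div_pos (hpos j) hsum
    · simp_rw [hb]
      push_cast
      rfl

end Subhypergroup

/-! ### Cosets of a subhypergroup of finite index -/

namespace Subhypergroup

variable {H : Type u} [TopologicalSpace H] [CompactSpace H] [T2Space H]
  [MeasurableSpace H] [BorelSpace H] [Hypergroup H] {S : Subhypergroup H}

/-- A map onto a finite set whose fibres are the cosets `H₀ * x` of the subhypergroup `H₀`. -/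
structure CosetMap (S : Subhypergroup H) (n : ℕ) where
  /-- The index of a coset. -/
  toFun : H → Fin n
  continuous : Continuous toFun
  surjective : Function.Surjective toFun
  eq_iff : ∀ x y, toFun x = toFun y ↔ x ∈ mulRight S.carrier y

theorem mem_mulRight_self (S : Subhypergroup H) (x : H) : x ∈ mulRight S.carrier x :=
  Set.mem_biUnion S.e_mem (by rw [e_supp]; rfl)

theorem mem_mulRight_trans {x y z : H} (hxy : x ∈ mulRight S.carrier y)
    (hyz : y ∈ mulRight S.carrier z) : x ∈ mulRight S.carrier z := by
  obtain ⟨s, hs, hx⟩ := Set.mem_iUnion₂.1 hxy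
  obtain ⟨t, ht, hy⟩ := Set.mem_iUnion₂.1 hyz
  have h : x ∈ mulLeft s (supp t z) := Set.mem_biUnion hy hx
  rw [← mulRight_supp] at h
  obtain ⟨r, hr, hx⟩ := Set.mem_iUnion₂.1 h
  exact Set.mem_biUnion (S.support_subset s hs t ht hr) hx

theorem mem_mulRight_symm {x y : H} (hxy : x ∈ mulRight S.carrier y) :
    y ∈ mulRight S.carrier x := by
  obtain ⟨s, hs, hx⟩ := Set.mem_iUnion₂.1 hxy
  exact Set.mem_biUnion (S.inv_mem s hs) (mem_supp_left.1 hx)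

theorem mem_mulRight_iff {x y : H} :
    x ∈ mulRight S.carrier y ↔ mulRight S.carrier x = mulRight S.carrier y :=
  ⟨fun h => Set.ext fun _ => ⟨fun hz => mem_mulRight_trans hz h,
    fun hz => mem_mulRight_trans hz (mem_mulRight_symm h)⟩,
    fun h => h ▸ S.mem_mulRight_self x⟩

/-- The involution exchanges the cosets `x * H₀` and `H₀ * x`. -/
theorem HasFiniteQuotient.finite_range (hfin : S.HasFiniteQuotient) :
    (Set.range fun x : H => mulRight S.carrier x).Finite := by
  refine (hfin.image fun A => Hypergroup.inv ⁻¹' A).subset ?_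
  rintro _ ⟨x, rfl⟩
  refine ⟨_, ⟨Hypergroup.inv x, rfl⟩, ?_⟩
  ext z
  simp only [Set.mem_preimage, mulRight, Set.mem_iUnion, exists_prop]
  constructor
  · rintro ⟨h, hh, hz⟩
    refine ⟨_, S.inv_mem h hh, ?_⟩
    rw [mem_supp_inv, Hypergroup.inv_inv]
    exact hz
  · rintro ⟨h, hh, hz⟩
    exact ⟨_, S.inv_mem h hh, mem_supp_inv.1 hz⟩

/-- The cosets `H₀ * x` are closed and form a partition, so that they are open if there are finitely
many of them. -/
theorem HasFiniteQuotient.exists_cosetMap (hfin : S.HasFiniteQuotient) :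
    ∃ n, Nonempty (S.CosetMap n) := by
  have := hfin.finite_range.to_subtype
  obtain ⟨n, ⟨ε⟩⟩ := Finite.exists_equiv_fin (Set.range fun x : H => mulRight S.carrier x)
  let κ : H → Fin n := fun x => ε ⟨_, x, rfl⟩
  have hκ : ∀ x y, κ x = κ y ↔ x ∈ mulRight S.carrier y := fun x y => by
    rw [mem_mulRight_iff]
    exact ε.apply_eq_iff_eq.trans Subtype.ext_iff
  refine ⟨n, ⟨κ, ?_, fun i => ?_, hκ⟩⟩
  · refine continuous_iff_isClosed.2 fun A _ => ?_
    have h : κ ⁻¹' A = ⋃ i ∈ A, κ ⁻¹' {i} := by ext; simp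
    rw [h]
    refine Set.Finite.isClosed_biUnion A.toFinite fun i _ => ?_
    obtain ⟨⟨_, y, rfl⟩, rfl⟩ := ε.surjective i
    convert isClosed_mulRight S.isClosed y using 1
    ext x
    exact hκ x y
  · obtain ⟨⟨_, y, rfl⟩, rfl⟩ := ε.surjective i
    exact ⟨y, rfl⟩

/-- A continuous function which is a mean of its left translates by elements of `H₀` is constant on
the cosets of `H₀`: its maximum on a coset propagates to the whole coset. -/
theorem eq_of_left_invariant {G : H → ℝ} (hG : Continuous G)
    (h : ∀ s ∈ S.carrier, ∀ z, ∫ t, G t ∂(conv s z) = G z) {x y : H}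
    (hxy : x ∈ mulRight S.carrier y) : G x = G y := by
  obtain ⟨m, hm, hmax⟩ := (isClosed_mulRight S.isClosed y).isCompact.exists_isMaxOn
    ⟨y, S.mem_mulRight_self y⟩ hG.continuousOn
  have key : ∀ t ∈ mulRight S.carrier y, G t = G m := fun t ht => by
    obtain ⟨s, hs, hts⟩ := Set.mem_iUnion₂.1 (mem_mulRight_trans ht (mem_mulRight_symm hm))
    have hc : Continuous fun t => max (G m - G t) 0 := (continuous_const.sub hG).max continuous_const
    have hle : ∀ u ∈ supp s m, 0 ≤ G m - G u := fun u hu =>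
      sub_nonneg.2 (hmax (mem_mulRight_trans (Set.mem_biUnion hs hu) hm))
    have h0 : ∫ t, max (G m - G t) 0 ∂(conv s m) = 0 := by
      have h1 : ∫ t, max (G m - G t) 0 ∂(conv s m) = ∫ t, (G m - G t) ∂(conv s m) :=
        integral_congr_ae ((ae_mem_supp s m).mono fun u hu => max_eq_left (hle u hu))
      rw [h1, integral_sub (integrable_const _) (hG.integrable_of_compactSpace _), h s hs]
      simp
    have h1 := (integral_eq_zero_iff_support _ (conv_compl_supp s m) hc
      fun _ => le_max_right _ _).1 h0 t hts
    rw [max_eq_left (hle t hts)] at h1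
    linarith
  rw [key x hxy, key y (S.mem_mulRight_self y)]

namespace CosetMap

variable {n : ℕ} (κ : S.CosetMap n)

instance : CoeFun (S.CosetMap n) fun _ => H → Fin n := ⟨toFun⟩

theorem measurable : Measurable κ := κ.continuous.measurable

theorem isClopen (i : Fin n) : IsClopen (κ ⁻¹' {i}) := (isClopen_discrete {i}).preimage κ.continuous

theorem integral_eq {E : Type*} [NormedAddCommGroup E] [NormedSpace ℝ E] [CompleteSpace E] (μ : Measure H)
    [IsFiniteMeasure μ] (φ : Fin n → E) :
    ∫ t, φ (κ t) ∂μ = ∑ i, μ.real (κ ⁻¹' {i}) • φ i := by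
  rw [← integral_map κ.measurable.aemeasurable (f := φ)
    (continuous_of_discreteTopology.aestronglyMeasurable), integral_fintype .of_finite]
  refine Finset.sum_congr rfl fun i _ => ?_
  rw [map_measureReal_apply κ.measurable (measurableSet_singleton i)]

theorem integral_conv_left {E : Type*} [NormedAddCommGroup E] [NormedSpace ℝ E] [CompleteSpace E]
    (φ : Fin n → E)
    {s : H} (hs : s ∈ S.carrier) (u : H) : ∫ t, φ (κ t) ∂(conv s u) = φ (κ u) := by
  have h : ∀ᵐ t ∂(conv s u), φ (κ t) = φ (κ u) := (ae_mem_supp s u).mono fun t ht =>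
    congrArg φ ((κ.eq_iff t u).2 (Set.mem_biUnion hs ht))
  rw [integral_congr_ae h, integral_const, probReal_univ, one_smul]

/-- The mass that `ε_x * ε_h` gives to the `j`-th coset, for `x` in the `i`-th coset. -/
noncomputable def transition (h : H) (i j : Fin n) : ℝ :=
  (conv (κ.surjective i).choose h).real (κ ⁻¹' {j})

theorem conv_real_preimage (x h : H) (j : Fin n) :
    (conv x h).real (κ ⁻¹' {j}) = ∫ t, (Pi.single j 1 : Fin n → ℝ) (κ t) ∂(conv x h) := by
  rw [κ.integral_eq, Finset.sum_eq_single j]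
  · simp
  · intro i _ hij
    simp [hij]
  · simp

theorem continuous_comp {E : Type*} [TopologicalSpace E] (φ : Fin n → E) :
    Continuous fun t => φ (κ t) :=
  continuous_of_discreteTopology.comp κ.continuous

theorem conv_real_eq {x y : H} (hxy : κ x = κ y) (h : H) (j : Fin n) :
    (conv x h).real (κ ⁻¹' {j}) = (conv y h).real (κ ⁻¹' {j}) := by
  let φ : Fin n → ℝ := Pi.single j 1
  have hc := κ.continuous_comp φ
  rw [conv_real_preimage, conv_real_preimage]
  refine eq_of_left_invariant (S := S) (G := fun x => ∫ t, φ (κ t) ∂(conv x h))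
    (continuous_integral_conv_real_comp hc continuous_id continuous_const) (fun s hs z => ?_)
    ((κ.eq_iff x y).1 hxy)
  rw [assoc_real _ _ _ hc]
  simp_rw [κ.integral_conv_left φ hs]

theorem transition_apply (h x : H) (j : Fin n) :
    κ.transition h (κ x) j = (conv x h).real (κ ⁻¹' {j}) :=
  κ.conv_real_eq (κ.surjective (κ x)).choose_spec h j

theorem integral_conv_right {E : Type*} [NormedAddCommGroup E] [NormedSpace ℝ E] [CompleteSpace E]
    (φ : Fin n → E)
    (x h : H) : ∫ t, φ (κ t) ∂(conv x h) = ∑ j, κ.transition h (κ x) j • φ j := by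
  rw [κ.integral_eq]
  simp_rw [transition_apply]

theorem continuous_transition (i j : Fin n) : Continuous fun h => κ.transition h i j := by
  simp_rw [transition, conv_real_preimage]
  exact continuous_integral_conv_real_comp (κ.continuous_comp _) continuous_const continuous_id

theorem transition_e (i j : Fin n) : κ.transition e i j = if i = j then 1 else 0 := by
  obtain ⟨x, rfl⟩ := κ.surjective i
  rw [transition_apply, conv_real_preimage, conv_e, integral_dirac]
  simp [Pi.single_apply]

theorem integral_transition (x y : H) (i j : Fin n) :
    ∫ z, κ.transition z i j ∂(conv x y) = ∑ k, κ.transition x i k * κ.transition y k j := by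
  obtain ⟨a, rfl⟩ := κ.surjective i
  simp_rw [transition_apply κ _ a, conv_real_preimage]
  rw [← assoc_real _ _ _ (κ.continuous_comp _)]
  simp_rw [← conv_real_preimage, ← transition_apply]
  rw [κ.integral_conv_right (fun k => κ.transition y k j)]
  simp_rw [smul_eq_mul]

/-- The mass of `ε_x * ε_{x⁻}` on `H₀`, for `x` in the `i`-th coset. -/
noncomputable def returnMass (i : Fin n) : ℝ :=
  (conv (κ.surjective i).choose (inv (κ.surjective i).choose)).real (κ ⁻¹' {κ e})

theorem preimage_e : κ ⁻¹' {κ e} = S.carrier := by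
  ext x
  rw [Set.mem_preimage, Set.mem_singleton_iff, κ.eq_iff, mulRight]
  simp [supp_e]

theorem conv_inv_symm (x y : H) :
    (conv x (inv y)).real (κ ⁻¹' {κ e}) = (conv y (inv x)).real (κ ⁻¹' {κ e}) := by
  have h1 : conv y (inv x) = (conv x (inv y)).map inv := by
    rw [map_inv_conv, Hypergroup.inv_inv]
  have h2 : Hypergroup.inv ⁻¹' (κ ⁻¹' {κ e}) = κ ⁻¹' {κ (e : H)} := by
    rw [preimage_e]
    ext z
    exact ⟨fun hz => by simpa [Hypergroup.inv_inv] using S.inv_mem _ hz, fun hz => S.inv_mem z hz⟩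
  rw [h1, map_measureReal_apply Hypergroup.continuous_inv.measurable
    (κ.isClopen _).isClosed.measurableSet, h2]

theorem conv_inv_real (x y : H) : (conv x (inv y)).real (κ ⁻¹' {κ e}) =
    if κ x = κ y then κ.returnMass (κ x) else 0 := by
  split_ifs with h
  · have h1 := (κ.surjective (κ x)).choose_spec
    rw [returnMass, κ.conv_real_eq h1 _, κ.conv_inv_symm x (κ.surjective (κ x)).choose,
      κ.conv_real_eq h1, κ.conv_inv_symm x y]
    exact (κ.conv_real_eq h _ _).symm
  · rw [measureReal_eq_zero_iff, preimage_e]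
    refine measure_mono_null (Set.subset_compl_iff_disjoint_right.2
      (Set.disjoint_left.2 fun s hs hs' => h ?_)) (conv_compl_supp x (inv y))
    have h2 := mem_supp_right.1 hs'
    rw [Hypergroup.inv_inv] at h2
    exact (κ.eq_iff x y).2 (Set.mem_biUnion hs h2)

theorem returnMass_pos (i : Fin n) : 0 < κ.returnMass i := by
  have h : e ∈ supp (κ.surjective i).choose (inv (κ.surjective i).choose) :=
    (e_mem_support_iff _ _).2 rfl
  have h2 := (Measure.mem_support_iff_forall _).1 h _ ((κ.isClopen (κ e)).isOpen.mem_nhds rfl)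
  exact ENNReal.toReal_pos h2.ne' (measure_ne_top _ _)

/-- Both sides are the mass of `ε_x * ε_h * ε_{y⁻}` on `H₀`, for `x` in the `i`-th and `y` in the
`j`-th coset. -/
theorem returnMass_mul_transition (h : H) (i j : Fin n) :
    κ.returnMass j * κ.transition h i j = κ.returnMass i * κ.transition (inv h) j i := by
  obtain ⟨x, rfl⟩ := κ.surjective i
  obtain ⟨y, rfl⟩ := κ.surjective j
  have key : ∀ a b c : H, ∫ w, (conv w (inv b)).real (κ ⁻¹' {κ e}) ∂(conv a c) =
      κ.returnMass (κ b) * κ.transition c (κ a) (κ b) := fun a b c => by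
    simp_rw [conv_inv_real]
    rw [κ.integral_conv_right (fun k => if k = κ b then κ.returnMass k else 0)]
    simp [mul_comm]
  rw [← key, ← key]
  have hc := κ.continuous_comp (Pi.single (κ e) 1 : Fin n → ℝ)
  have h1 : conv h (inv y) = (conv y (inv h)).map inv := by
    rw [map_inv_conv, Hypergroup.inv_inv]
  simp_rw [conv_real_preimage]
  have hc' : Continuous fun w => ∫ t, (Pi.single (κ e) 1 : Fin n → ℝ) (κ t) ∂(conv x w) :=
    continuous_integral_conv_real_comp hc continuous_const continuous_id
  rw [assoc_real _ _ _ hc, h1, integral_map Hypergroup.continuous_inv.aemeasurable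
    hc'.aestronglyMeasurable]
  simp_rw [← conv_real_preimage]
  simp_rw [κ.conv_inv_symm x]

end CosetMap

end Subhypergroup

/-! ### The representation induced from the trivial one -/

namespace Subhypergroup

variable {H : Type u} [TopologicalSpace H] [CompactSpace H] [T2Space H]
  [SecondCountableTopology H] [MeasurableSpace H] [BorelSpace H] [Hypergroup H]
  {S : Subhypergroup H}

namespace CosetMap

variable {n : ℕ} (κ : S.CosetMap n)

/-- The Haar measure of the `i`-th coset. -/
noncomputable def weight (i : Fin n) : ℝ := (hgHaar H).real (κ ⁻¹' {i})

theorem weight_pos (i : Fin n) : 0 < κ.weight i := by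
  obtain ⟨x, hx⟩ := κ.surjective i
  exact ENNReal.toReal_pos ((κ.isClopen i).isOpen.measure_pos _ ⟨x, hx⟩).ne' (measure_ne_top _ _)

theorem weight_mul_returnMass (i : Fin n) :
    κ.weight i * κ.returnMass i = κ.weight (κ e) := by
  obtain ⟨y, rfl⟩ := κ.surjective i
  have h1 : ∫ x, (conv x (inv y)).real (κ ⁻¹' {κ e}) ∂(hgHaar H) =
      κ.weight (κ y) * κ.returnMass (κ y) := by
    simp_rw [conv_inv_real]
    rw [κ.integral_eq _ (fun k => if k = κ y then κ.returnMass k else 0)]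
    simp [weight]
  have hc := κ.continuous_comp (Pi.single (κ e) 1 : Fin n → ℝ)
  rw [← h1]
  simp_rw [conv_real_preimage]
  have h2 := integral_bind_kernel (kernelRight (inv y)) (hgHaar H)
    (hc.integrable_of_compactSpace _)
  rw [bind_kernelRight_hgHaar, κ.integral_eq _ (Pi.single (κ e) 1 : Fin n → ℝ),
    Finset.sum_eq_single (κ e) (fun _ _ hi => by simp [hi]) (by simp)] at h2
  refine Eq.trans h2.symm ?_
  simp [weight]

/-- Detailed balance of the coset walk with respect to the Haar measure. -/
theorem weight_mul_transition (h : H) (i j : Fin n) :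
    κ.weight i * κ.transition h i j = κ.weight j * κ.transition (inv h) j i := by
  have h1 := κ.returnMass_mul_transition h i j
  have h2 := κ.weight_mul_returnMass i
  have h3 := κ.weight_mul_returnMass j
  have h4 := κ.returnMass_pos i
  have h5 := κ.returnMass_pos j
  have h6 : (κ.returnMass i * κ.returnMass j) * (κ.weight i * κ.transition h i j) =
      (κ.returnMass i * κ.returnMass j) * (κ.weight j * κ.transition (inv h) j i) := by
    linear_combination (κ.weight i * κ.returnMass i) * h1 +
      (κ.returnMass i * κ.transition (inv h) j i) * (h2 - h3)
  exact mul_left_cancel₀ (mul_pos h4 h5).ne' h6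

/-- The matrix of the right translation by `h` on functions constant on cosets, in the basis of the
normalized indicator functions of the cosets. -/
noncomputable def matrix (h : H) : Matrix (Fin n) (Fin n) ℂ := fun i j =>
  ((√(κ.weight i) * κ.transition h i j / √(κ.weight j) : ℝ) : ℂ)

theorem sqrt_weight_ne_zero (i : Fin n) : √(κ.weight i) ≠ 0 :=
  (Real.sqrt_pos.2 (κ.weight_pos i)).ne'

theorem matrix_e : κ.matrix e = 1 := by
  ext i j
  rw [matrix, transition_e, Matrix.one_apply]
  split_ifs with h
  · subst h
    rw [mul_one, div_self (κ.sqrt_weight_ne_zero i), Complex.ofReal_one]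
  · simp

theorem matrix_inv (h : H) : κ.matrix (inv h) = star (κ.matrix h) := by
  ext i j
  rw [Matrix.star_apply, matrix, matrix, Complex.star_def, Complex.conj_ofReal, Complex.ofReal_inj,
    div_eq_div_iff (κ.sqrt_weight_ne_zero _) (κ.sqrt_weight_ne_zero _)]
  have h1 := κ.weight_mul_transition h j i
  have h2 := Real.mul_self_sqrt (κ.weight_pos i).le
  have h3 := Real.mul_self_sqrt (κ.weight_pos j).le
  linear_combination (-1 : ℝ) * h1 + κ.transition (inv h) i j * h2 - κ.transition h j i * h3

theorem continuous_matrix (i j : Fin n) : Continuous fun h => κ.matrix h i j :=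
  Complex.continuous_ofReal.comp
    ((continuous_const.mul (κ.continuous_transition i j)).div_const _)

theorem integral_matrix (x y : H) (i j : Fin n) :
    ∫ z, κ.matrix z i j ∂(conv x y) = (κ.matrix x * κ.matrix y) i j := by
  simp_rw [matrix]
  rw [integral_complex_ofReal, integral_div, integral_const_mul, integral_transition,
    Matrix.mul_apply, Finset.mul_sum, Finset.sum_div, Complex.ofReal_sum]
  refine Finset.sum_congr rfl fun k _ => ?_
  simp only [matrix]
  rw [← Complex.ofReal_mul, Complex.ofReal_inj]
  have := κ.sqrt_weight_ne_zero k
  field_simp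

theorem inner_toEuclideanCLM_eq (A : Matrix (Fin n) (Fin n) ℂ) (v w : EuclideanSpace ℂ (Fin n)) :
    ⟪v, Matrix.toEuclideanCLM (n := Fin n) (𝕜 := ℂ) A w⟫_ℂ =
      ∑ i, ∑ j, A i j * (w j * star (v i)) := by
  rw [PiLp.inner_apply]
  refine Finset.sum_congr rfl fun i _ => ?_
  rw [Matrix.ofLp_toEuclideanCLM, RCLike.inner_apply, Matrix.mulVec, dotProduct, Finset.sum_mul]
  refine Finset.sum_congr rfl fun j _ => ?_
  rw [mul_assoc]
  rfl

/-- The right translations of functions constant on cosets, as a matrix representation. -/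
noncomputable def rep : HGRep H where
  E := EuclideanSpace ℂ (Fin n)
  op h := Matrix.toEuclideanCLM (n := Fin n) (𝕜 := ℂ) (κ.matrix h)
  op_e := by rw [matrix_e, map_one]
  op_inv h := by rw [matrix_inv, map_star, ContinuousLinearMap.star_eq_adjoint]
  op_conv x y v w := by
    rw [← mul_apply_eq_comp, ← map_mul]
    simp_rw [inner_toEuclideanCLM_eq]
    have hint : ∀ i j, Integrable (fun z => κ.matrix z i j * (w j * star (v i))) (conv x y) :=
      fun i j => ((κ.continuous_matrix i j).mul continuous_const).integrable_of_compactSpace _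
    rw [integral_finsetSum _ fun i _ => integrable_finsetSum _ fun j _ => hint i j]
    refine Finset.sum_congr rfl fun i _ => ?_
    rw [integral_finsetSum _ fun j _ => hint i j]
    refine Finset.sum_congr rfl fun j _ => ?_
    rw [integral_mul_const, integral_matrix]
  continuous_op v w := by
    simp_rw [inner_toEuclideanCLM_eq]
    exact continuous_finsetSum _ fun i _ => continuous_finsetSum _ fun j _ =>
      (κ.continuous_matrix i j).mul continuous_const

instance : FiniteDimensional ℂ κ.rep.E :=
  inferInstanceAs (FiniteDimensional ℂ (EuclideanSpace ℂ (Fin n)))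

/-- The values on the cosets of the function with coordinates `v` in the basis of the normalized
indicator functions of the cosets. -/
noncomputable def values (v : EuclideanSpace ℂ (Fin n)) (i : Fin n) : ℂ :=
  v i / (√(κ.weight i) : ℝ)

theorem values_rep_op (h : H) (v : EuclideanSpace ℂ (Fin n)) (i : Fin n) :
    κ.values (κ.rep.op h v) i = ∑ j, κ.transition h i j • κ.values v j := by
  change (Matrix.mulVec (κ.matrix h) v) i / _ = _
  rw [Matrix.mulVec, dotProduct, Finset.sum_div]
  refine Finset.sum_congr rfl fun j _ => ?_
  rw [values, matrix, Complex.real_smul]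
  have h1 : ((√(κ.weight i) : ℝ) : ℂ) ≠ 0 := Complex.ofReal_ne_zero.2 (κ.sqrt_weight_ne_zero i)
  have h2 : ((√(κ.weight j) : ℝ) : ℂ) ≠ 0 := Complex.ofReal_ne_zero.2 (κ.sqrt_weight_ne_zero j)
  push_cast
  field_simp

theorem memLp (φ : Fin n → ℂ) : MemLp (fun x => φ (κ x)) 2 (hgHaar H) :=
  MemLp.of_bound (κ.continuous_comp φ).aestronglyMeasurable (∑ i, ‖φ i‖) (ae_of_all _ fun x =>
    Finset.single_le_sum (f := fun i => ‖φ i‖) (fun _ _ => norm_nonneg _) (Finset.mem_univ (κ x)))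

/-- The isometry onto the square integrable functions constant on cosets. -/
noncomputable def toLp : EuclideanSpace ℂ (Fin n) →ₗᵢ[ℂ] Lp ℂ 2 (hgHaar H) where
  toFun v := (κ.memLp (κ.values v)).toLp _
  map_add' v w := by
    rw [← MemLp.toLp_add]
    congr 1
    ext x
    simp [values, add_div]
  map_smul' a v := by
    rw [RingHom.id_apply, ← MemLp.toLp_const_smul]
    congr 1
    ext x
    simp [values, mul_div_assoc]
  norm_map' v := by
    have h1 : ∀ f : Lp ℂ 2 (hgHaar H), ‖f‖ ^ 2 = ∫ x, ‖f x‖ ^ 2 ∂(hgHaar H) := fun f => by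
      rw [norm_sq_eq_re_inner (𝕜 := ℂ), L2.inner_def, ← integral_re]
      · simp_rw [← norm_sq_eq_re_inner (𝕜 := ℂ)]
      · exact L2.integrable_inner f f
    rw [← sq_eq_sq₀ (norm_nonneg _) (norm_nonneg _), EuclideanSpace.norm_sq_eq]
    refine (h1 _).trans ?_
    have h2 : ∀ᵐ x ∂(hgHaar H), ‖(κ.memLp (κ.values v)).toLp _ x‖ ^ 2 = ‖κ.values v (κ x)‖ ^ 2 :=
      (κ.memLp (κ.values v)).coeFn_toLp.mono fun x hx => by rw [hx]
    refine (integral_congr_ae h2).trans ?_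
    rw [κ.integral_eq _ fun i => ‖κ.values v i‖ ^ 2]
    refine Finset.sum_congr rfl fun i _ => ?_
    change κ.weight i * _ = _
    have h3 := κ.weight_pos i
    rw [values, norm_div, div_pow, Complex.norm_real, Real.norm_of_nonneg (Real.sqrt_nonneg _),
      Real.sq_sqrt h3.le]
    field_simp

theorem coeFn_toLp (v : EuclideanSpace ℂ (Fin n)) :
    ∀ᵐ x ∂(hgHaar H), κ.toLp v x = κ.values v (κ x) :=
  (κ.memLp (κ.values v)).coeFn_toLp

end CosetMap

open ProbabilityTheory in
/-- The measure `ω_{H₀} * ε_x`, as a kernel. -/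
noncomputable def cosetKernel (S : Subhypergroup H) : Kernel H H :=
  convKernel H ∘ₖ ((Kernel.const H ((hgHaar S).map Subtype.val)) ×ₖ Kernel.id)

section

open ProbabilityTheory

instance : IsProbabilityMeasure ((hgHaar S).map (Subtype.val : S → H)) :=
  Measure.isProbabilityMeasure_map measurable_subtype_coe.aemeasurable

instance : IsMarkovKernel S.cosetKernel := by
  rw [cosetKernel]
  infer_instance

theorem integral_cosetKernel {E : Type*} [NormedAddCommGroup E] [NormedSpace ℝ E]
    {f : H → E} {x : H} (hf : Integrable f (S.cosetKernel x)) :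
    ∫ t, f t ∂(S.cosetKernel x) =
      ∫ s, ∫ t, f t ∂(conv s x) ∂((hgHaar S).map (Subtype.val : S → H)) := by
  have h1 : S.cosetKernel x =
      ((hgHaar S).map (Subtype.val : S → H)).bind (kernelRight x) := by
    refine measure_ext_of_continuous fun f hf => ?_
    rw [integral_bind_kernel _ _ (hf.integrable_of_compactSpace _), cosetKernel,
      Kernel.integral_comp (hf.integrable_of_compactSpace _), Kernel.prod_apply, Kernel.const_apply,
      Kernel.id_apply]
    refine (integral_prod _ (Continuous.integrable_of_compactSpace
      (f := fun p : H × H => ∫ z, f z ∂(conv p.1 p.2))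
      (continuous_integral_conv_real hf) _)).trans ?_
    simp only [integral_dirac, kernelRight_apply]
  rw [h1] at hf ⊢
  rw [integral_bind_kernel _ _ hf]
  rfl

theorem cosetKernel_eq {x y : H} (hxy : x ∈ mulRight S.carrier y) :
    S.cosetKernel x = S.cosetKernel y := by
  refine measure_ext_of_continuous fun f hf => ?_
  have hc := continuous_integral_conv_real hf
  have h : ∀ x, ∫ t, f t ∂(S.cosetKernel x) = ∫ s : S, ∫ t, f t ∂(conv (s : H) x) ∂(hgHaar S) :=
    fun x => by
    rw [integral_cosetKernel (hf.integrable_of_compactSpace _),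
      S.mEmb.integral_map]
  have hcx : Continuous fun p : H × S => ∫ t, f t ∂(conv (p.2 : H) p.1) :=
    hc.comp ((continuous_subtype_val.comp continuous_snd).prodMk continuous_fst)
  simp_rw [h]
  refine eq_of_left_invariant (S := S) (G := fun x => ∫ s : S, ∫ t, f t ∂(conv (s : H) x) ∂(hgHaar S))
    (continuous_integral_left (hgHaar S) hcx) (fun r hr z => ?_) hxy
  rw [integral_integral_swap (f := fun (z : H) (s : S) => ∫ t, f t ∂(conv (s : H) z))
    (hcx.integrable_of_compactSpace _)]
  simp_rw [← assoc_real _ _ _ hf]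
  have hg : Continuous fun s : S => ∫ t, f t ∂(conv (s : H) z) :=
    hc.comp (continuous_subtype_val.prodMk continuous_const)
  have h2 := integral_bind_kernel (kernelRight (⟨r, hr⟩ : S)) (hgHaar S)
    (hg.integrable_of_compactSpace _)
  rw [bind_kernelRight_hgHaar] at h2
  rw [h2]
  exact integral_congr_ae (ae_of_all _ fun s =>
    (S.integral_subConv s ⟨r, hr⟩ fun w => ∫ t, f t ∂(conv w z)).symm)

theorem bind_cosetKernel : (hgHaar H).bind S.cosetKernel = hgHaar H := by
  refine measure_ext_of_continuous fun f hf => ?_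
  have hc := continuous_integral_conv_real hf
  rw [integral_bind_kernel _ _ (hf.integrable_of_compactSpace _)]
  simp_rw [integral_cosetKernel (hf.integrable_of_compactSpace _)]
  rw [integral_integral_swap (f := fun x s => ∫ t, f t ∂(conv s x))
    ((hc.comp continuous_swap).integrable_of_compactSpace _)]
  have h1 : ∀ s, ∫ x, ∫ t, f t ∂(conv s x) ∂(hgHaar H) = ∫ x, f x ∂(hgHaar H) := fun s =>
    integral_hgHaar_left (hf.integrable_of_compactSpace _) s
  simp_rw [h1]
  simp

/-- The induced space of the trivial representation consists of the functions constant on cosets: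
averaging over `H₀` makes the invariance under `H₀` simultaneous for almost all `x`. -/
theorem exists_of_mem_indSpace {n : ℕ} (κ : S.CosetMap n) {ξ : Lp ℂ 2 (hgHaar H)}
    (hξ : ∀ s : S, ∀ᵐ x ∂(hgHaar H), ∫ z, ξ z ∂(conv (s : H) x) = ξ x) :
    ∃ φ : Fin n → ℂ, ∀ᵐ x ∂(hgHaar H), ξ x = φ (κ x) := by
  have hint : Integrable ξ (hgHaar H) := (Lp.memLp ξ).integrable one_le_two
  have hm : StronglyMeasurable ξ := Lp.stronglyMeasurable ξ
  have hF : StronglyMeasurable fun p : H × H => ∫ z, ξ z ∂(conv p.1 p.2) :=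
    hm.integral_kernel (κ := convKernel H)
  have h1 : ∀ᵐ x ∂(hgHaar H), ∀ᵐ s ∂((hgHaar S).map (Subtype.val : S → H)),
      ∫ z, ξ z ∂(conv s x) = ξ x := by
    rw [Measure.ae_ae_comm]
    · rw [S.mEmb.ae_map_iff]
      exact Filter.Eventually.of_forall hξ
    · exact (hF.comp_measurable measurable_swap).measurableSet_eq_fun
        (hm.comp_measurable measurable_fst)
  have h2 : ∀ᵐ x ∂(hgHaar H), Integrable ξ (S.cosetKernel x) :=
    Measure.ae_integrable_of_integrable_comp (by rwa [bind_cosetKernel])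
  have h3 : ∀ᵐ x ∂(hgHaar H), ξ x = ∫ t, ξ t ∂(S.cosetKernel x) := by
    filter_upwards [h1, h2] with x hx1 hx2
    rw [integral_cosetKernel hx2, integral_congr_ae hx1]
    simp
  refine ⟨fun i => ∫ t, ξ t ∂(S.cosetKernel (κ.surjective i).choose), ?_⟩
  filter_upwards [h3] with x hx
  rw [hx, cosetKernel_eq ((κ.eq_iff _ _).1 (κ.surjective (κ x)).choose_spec)]

end

theorem HasFiniteQuotient.exists_isIndDecomposition (hfin : S.HasFiniteQuotient) :
    ∃ (m : ℕ) (π : Fin m → HGIrrep H),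
      IsIndDecomposition (HGIrrep.trivial S).toHGRep π := by
  obtain ⟨n, ⟨κ⟩⟩ := hfin.exists_cosetMap
  obtain ⟨m, ρ, T, -, hT⟩ := κ.rep.exists_decomposition
  refine ⟨m, ρ, κ.toLp.comp T.toLinearIsometry, ?_, fun h v => ?_⟩
  · have key : ∀ ξ : Lp ℂ 2 (hgHaar H), (∃ v, κ.toLp (T v) = ξ) ↔
        ∀ s : S, ∀ᵐ x ∂(hgHaar H), ∫ z, ξ z ∂(conv (s : H) x) = ξ x := by
      intro ξ
      constructor
      · rintro ⟨v, rfl⟩ s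
        filter_upwards [κ.coeFn_toLp (T v), ae_ae_conv_left (s : H) (κ.coeFn_toLp (T v))] with x h1 h2
        rw [integral_congr_ae h2, h1, κ.integral_conv_left _ s.2]
      · intro h
        obtain ⟨φ, hφ⟩ := exists_of_mem_indSpace κ h
        refine ⟨T.symm (WithLp.toLp 2 fun i => φ i * (√(κ.weight i) : ℝ)), Lp.ext ?_⟩
        refine Filter.EventuallyEq.trans (Filter.Eventually.of_forall fun x =>
          congrArg (fun v => κ.toLp v x) (T.apply_symm_apply _)) ?_
        filter_upwards [hφ, κ.coeFn_toLp (WithLp.toLp 2 fun i => φ i * (√(κ.weight i) : ℝ))]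
          with x h1 h2
        rw [h1, h2, CosetMap.values]
        exact mul_div_cancel_right₀ _ (Complex.ofReal_ne_zero.2 (κ.sqrt_weight_ne_zero _))
    ext ξ
    exact key ξ
  · have h1 : ∀ᵐ x ∂(hgHaar H), κ.toLp (T (WithLp.toLp 2 fun j => (ρ j).op h (v j))) x =
        ∫ z, κ.toLp (T v) z ∂(conv x h) := by
      rw [hT]
      filter_upwards [κ.coeFn_toLp (κ.rep.op h (T v)),
        ae_ae_conv_right h (κ.coeFn_toLp (T v))] with x h1 h2
      rw [h1, integral_congr_ae h2, κ.integral_conv_right]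
      exact κ.values_rep_op h (T v) (κ x)
    exact h1

end Subhypergroup

/-! ### Discrete hypergroups from structure constants -/

section Discrete

variable {Y : Type*} [TopologicalSpace Y] [DiscreteTopology Y] [MeasurableSpace Y] [BorelSpace Y]

/-- The measure `∑_k c_k ε_k` on a discrete space. -/
noncomputable def Finsupp.toMeasure (c : Y →₀ ℝ) : Measure Y :=
  ∑ k ∈ c.support, ENNReal.ofReal (c k) • Measure.dirac k

theorem Finsupp.toMeasure_apply (c : Y →₀ ℝ) (s : Set Y) [DecidablePred (· ∈ s)] :
    c.toMeasure s = ∑ k ∈ c.support, if k ∈ s then ENNReal.ofReal (c k) else 0 := by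
  simp only [toMeasure, Measure.finsetSum_apply, Measure.smul_apply,
    Measure.dirac_apply' _ (isOpen_discrete s).measurableSet, smul_eq_mul, Set.indicator,
    Pi.one_apply, mul_ite, mul_one, mul_zero]

theorem Finsupp.toMeasure_singleton (c : Y →₀ ℝ) (k : Y) :
    c.toMeasure {k} = ENNReal.ofReal (c k) := by
  classical
  rw [toMeasure_apply]
  simp only [Set.mem_singleton_iff, Finset.sum_ite_eq', Finsupp.mem_support_iff]
  split_ifs with h
  · rfl
  · rw [not_not.1 h, ENNReal.ofReal_zero]

theorem Finsupp.isProbabilityMeasure_toMeasure {c : Y →₀ ℝ} (hc : ∀ k, 0 ≤ c k)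
    (h1 : c.sum (fun _ a => a) = 1) : IsProbabilityMeasure c.toMeasure := ⟨by
  classical
  rw [toMeasure_apply]
  simp only [Set.mem_univ, if_true]
  rw [← ENNReal.ofReal_sum_of_nonneg fun k _ => hc k]
  change ENNReal.ofReal (c.sum fun _ a => a) = 1
  rw [h1, ENNReal.ofReal_one]⟩

theorem Finsupp.regular_toMeasure (c : Y →₀ ℝ) : c.toMeasure.Regular := by
  classical
  have hfin : IsFiniteMeasure c.toMeasure := ⟨by
    rw [toMeasure_apply]
    exact ENNReal.sum_lt_top.2 fun k _ => by simp⟩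
  refine { lt_top_of_isCompact := fun K _ => measure_lt_top _ _,
           outerRegular := fun A _ r hr => ⟨A, subset_rfl, isOpen_discrete _, hr⟩,
           innerRegular := fun U _ r hr => ?_ }
  refine ⟨U ∩ (c.support : Set Y), Set.inter_subset_left,
    (c.support.finite_toSet.inter_of_right _).isCompact, ?_⟩
  convert hr using 1
  rw [toMeasure_apply, toMeasure_apply]
  exact Finset.sum_congr rfl fun k hk => by simp [Finsupp.mem_support_iff.1 hk]

theorem Finsupp.mem_support_toMeasure {c : Y →₀ ℝ} (hc : ∀ k, 0 ≤ c k) {k : Y} :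
    k ∈ c.toMeasure.support ↔ c k ≠ 0 := by
  rw [Measure.mem_support_iff_discrete, toMeasure_singleton, Ne, ENNReal.ofReal_eq_zero, not_le]
  exact ⟨fun h => h.ne', fun h => (hc k).lt_of_ne' h⟩

theorem Finsupp.integral_toMeasure {E : Type*} [NormedAddCommGroup E] [NormedSpace ℝ E]
    [CompleteSpace E] {c : Y →₀ ℝ} (hc : ∀ k, 0 ≤ c k) (f : Y → E) :
    ∫ k, f k ∂c.toMeasure = linearCombination ℝ f c := by
  rw [toMeasure, integral_finsetSum_measure]
  · refine Finset.sum_congr rfl fun k _ => ?_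
    rw [integral_smul_measure, integral_dirac, ENNReal.toReal_ofReal (hc k)]
    rfl
  · exact fun k _ => (integrable_dirac (by simp)).smul_measure ENNReal.ofReal_ne_top

theorem Finsupp.toMeasure_single (k : Y) : (single k (1 : ℝ)).toMeasure = Measure.dirac k := by
  rw [toMeasure, support_single _ one_ne_zero]
  simp

theorem Finsupp.map_toMeasure (c : Y →₀ ℝ) {ι : Y → Y} (hι : Function.Injective ι) :
    c.toMeasure.map ι = (c.mapDomain ι).toMeasure := by
  classical
  have hm : Measurable ι := continuous_of_discreteTopology.measurable
  rw [toMeasure, Measure.map_finset_sum hm.aemeasurable, toMeasure,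
    mapDomain_support_of_injective hι, Finset.sum_image fun a _ b _ h => hι h]
  refine Finset.sum_congr rfl fun k _ => ?_
  rw [Measure.map_smul, Measure.map_dirac' hm, mapDomain_apply hι]

/-- A discrete hypergroup given by its structure constants: the convolution of `a` and `b` is
`∑_k m(a, b)_k ε_k`. -/
@[reducible]
noncomputable def Hypergroup.ofStructureConstants (m : Y → Y → Y →₀ ℝ) (o : Y) (ι : Y → Y)
    (nonneg : ∀ x y k, 0 ≤ m x y k) (mass : ∀ x y, (m x y).sum (fun _ a => a) = 1)
    (assoc : ∀ x y z, Finsupp.linearCombination ℝ (fun w => m w z) (m x y) =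
      Finsupp.linearCombination ℝ (fun w => m x w) (m y z))
    (m_o : ∀ x, m x o = Finsupp.single x 1) (o_m : ∀ x, m o x = Finsupp.single x 1)
    (ι_ι : ∀ x, ι (ι x) = x) (o_mem : ∀ x y, m x y o ≠ 0 ↔ y = ι x)
    (map_m : ∀ x y, (m x y).mapDomain ι = m (ι y) (ι x)) : Hypergroup Y where
  conv x y := (m x y).toMeasure
  e := o
  inv := ι
  isProbabilityMeasure x y := Finsupp.isProbabilityMeasure_toMeasure (nonneg x y) (mass x y)
  regular x y := Finsupp.regular_toMeasure _
  isCompact_support x y := by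
    refine ((m x y).support.finite_toSet.subset fun k hk => ?_).isCompact
    exact Finsupp.mem_support_iff.2 ((Finsupp.mem_support_toMeasure (nonneg x y)).1 hk)
  weaklyContinuous f := continuous_of_discreteTopology
  assoc x y z f := by
    simp_rw [Finsupp.integral_toMeasure (nonneg _ _)]
    have h1 := Finsupp.apply_linearCombination ℝ (Finsupp.linearCombination ℝ (f : Y → ℝ))
      (fun w => m w z) (m x y)
    have h2 := Finsupp.apply_linearCombination ℝ (Finsupp.linearCombination ℝ (f : Y → ℝ))
      (fun w => m x w) (m y z)
    exact h1.symm.trans ((congrArg _ (assoc x y z)).trans h2)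
  conv_e x := by rw [m_o, Finsupp.toMeasure_single]
  e_conv x := by rw [o_m, Finsupp.toMeasure_single]
  continuous_inv := continuous_of_discreteTopology
  inv_inv := ι_ι
  e_mem_support_iff x y := by rw [Finsupp.mem_support_toMeasure (nonneg x y), o_mem]
  map_inv_conv x y := by
    rw [Finsupp.map_toMeasure _ (Function.LeftInverse.injective ι_ι), map_m]
  continuous_support := @continuous_of_discreteTopology _ _ _ _ (TopologicalSpace.vietoris Y) _

/-- The structure constants of a discrete hypergroup. -/
theorem Hypergroup.exists_structureConstants (K : Hypergroup Y) :
    ∃ m : Y → Y → Y →₀ ℝ,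
      (∀ {E : Type} [NormedAddCommGroup E] [NormedSpace ℝ E] [CompleteSpace E] (x y : Y)
        (f : Y → E), ∫ k, f k ∂(K.conv x y) = Finsupp.linearCombination ℝ f (m x y)) ∧
      ∀ x y z, Finsupp.linearCombination ℝ (fun w => m w z) (m x y) =
        Finsupp.linearCombination ℝ (fun w => m x w) (m y z) := by
  classical
  have h : ∀ x y, ∃ c : Y →₀ ℝ, ∀ {E : Type} [NormedAddCommGroup E] [NormedSpace ℝ E]
      [CompleteSpace E] (f : Y → E), ∫ k, f k ∂(K.conv x y) = Finsupp.linearCombination ℝ f c := by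
    intro x y
    have := K.isProbabilityMeasure x y
    have := K.regular x y
    obtain ⟨c, -, -, hc⟩ := exists_finsupp_of_discrete (K.conv x y) (K.isCompact_support x y)
    exact ⟨c, hc⟩
  choose m hm using h
  refine ⟨m, fun {E} _ _ _ x y f => hm x y f, fun x y z => Finsupp.ext fun k => ?_⟩
  let f : Y →ᵇ ℝ := BoundedContinuousFunction.ofNormedAddCommGroupDiscrete
    (fun y => if y = k then 1 else 0) 1 fun y => by split_ifs <;> simp
  have hfy : ∀ y, f y = if y = k then 1 else 0 := fun _ => rfl
  have hf : ∀ c : Y →₀ ℝ, Finsupp.linearCombination ℝ (f : Y → ℝ) c = c k := fun c => by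
    rw [Finsupp.linearCombination_apply, Finsupp.sum_eq_single k]
    · rw [hfy, if_pos rfl, smul_eq_mul, mul_one]
    · intro b _ hb
      rw [hfy, if_neg hb, smul_zero]
    · simp
  have h1 := K.assoc x y z f
  simp_rw [hm] at h1
  have h2 := Finsupp.apply_linearCombination ℝ (Finsupp.linearCombination ℝ (f : Y → ℝ))
    (fun w => m w z) (m x y)
  have h3 := Finsupp.apply_linearCombination ℝ (Finsupp.linearCombination ℝ (f : Y → ℝ))
    (fun w => m x w) (m y z)
  rw [← hf, ← hf]
  exact h2.trans (h1.trans h3.symm)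

end Discrete

/-- Structure constants realizing a bilinear product on linearly independent vectors are associative
exactly if the product is associative on these vectors. -/
theorem structureConstants_assoc_iff {Y P : Type*} [AddCommGroup P] [Module ℝ P] {ev : Y → P}
    (hev : LinearIndependent ℝ ev) (B : P →ₗ[ℝ] P →ₗ[ℝ] P) {m : Y → Y → Y →₀ ℝ}
    (hm : ∀ x y, Finsupp.linearCombination ℝ ev (m x y) = B (ev x) (ev y)) (x y z : Y) :
    Finsupp.linearCombination ℝ (fun w => m w z) (m x y) =
        Finsupp.linearCombination ℝ (fun w => m x w) (m y z) ↔
      B (B (ev x) (ev y)) (ev z) = B (ev x) (B (ev y) (ev z)) := by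
  have h1 : Finsupp.linearCombination ℝ ev (Finsupp.linearCombination ℝ (fun w => m w z) (m x y)) =
      B (B (ev x) (ev y)) (ev z) := by
    rw [Finsupp.apply_linearCombination]
    have : (Finsupp.linearCombination ℝ ev ∘ fun w => m w z) = B.flip (ev z) ∘ ev :=
      funext fun w => hm w z
    rw [this, ← Finsupp.apply_linearCombination, hm]
    rfl
  have h2 : Finsupp.linearCombination ℝ ev (Finsupp.linearCombination ℝ (fun w => m x w) (m y z)) =
      B (ev x) (B (ev y) (ev z)) := by
    rw [Finsupp.apply_linearCombination]
    have : (Finsupp.linearCombination ℝ ev ∘ fun w => m x w) = B (ev x) ∘ ev :=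
      funext fun w => hm x w
    rw [this, ← Finsupp.apply_linearCombination, hm]
  rw [← h1, ← h2]
  exact (LinearIndependent.finsuppLinearCombination_injective hev).eq_iff.symm

/-! ### Induction on the span of the characters -/

namespace Subhypergroup

variable {H : Type u} [TopologicalSpace H] [CompactSpace H] [T2Space H]
  [SecondCountableTopology H] [MeasurableSpace H] [BorelSpace H] [Hypergroup H]
  {S : Subhypergroup H}

/-- A linear map on all functions that agrees with the induction of characters on the span of the
characters (its values elsewhere play no role). -/
structure IsInduction (I : (S → ℂ) →ₗ[ℂ] (H → ℂ)) : Prop where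
  ind_eq : ∀ f ∈ charSpan S, ind f = I f
  ch_eq : ∀ τ : HGIrrep S, I τ.ch = indCh τ

theorem exists_isInduction (hS : IsStrong S) : ∃ I : (S → ℂ) →ₗ[ℂ] (H → ℂ), IsInduction I := by
  obtain ⟨L, hL, hch⟩ := exists_linearMap_ind hS
  obtain ⟨I, hI⟩ := LinearMap.exists_extend L
  have h : ∀ f (hf : f ∈ charSpan S), I f = L ⟨f, hf⟩ := fun f hf => DFunLike.congr_fun hI ⟨f, hf⟩
  exact ⟨I, fun f hf => (hL f hf).trans (h f hf).symm, fun τ => (h _ τ.ch_mem).trans (hch τ)⟩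

namespace IsInduction

variable {I : (S → ℂ) →ₗ[ℂ] (H → ℂ)} (hI : IsInduction I)
include hI

theorem mem_cone (hH : IsStrong H) {f : S → ℂ} (hf : f ∈ charCone S) : I f ∈ charCone H := by
  induction hf using Submodule.span_induction with
  | mem f hf =>
    obtain ⟨χ, rfl⟩ := hf
    obtain ⟨τ, rfl⟩ := χ.exists_ofRep
    exact (hI.ch_eq τ).symm ▸ indCh_mem_cone hH τ
  | zero => rw [map_zero]; exact Submodule.zero_mem _
  | add f g _ _ hf hg => rw [map_add]; exact Submodule.add_mem _ hf hg
  | smul a f _ hf => rw [LinearMap.map_smul_of_tower]; exact Submodule.smul_mem _ a hf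

theorem mem_charSpan (hH : IsStrong H) {f : S → ℂ} (hf : f ∈ charSpan S) : I f ∈ charSpan H := by
  induction hf using Submodule.span_induction with
  | mem f hf =>
    obtain ⟨χ, rfl⟩ := hf
    exact charCone.mem_charSpan (hI.mem_cone hH χ.fn_mem_cone)
  | zero => rw [map_zero]; exact Submodule.zero_mem _
  | add f g _ _ hf hg => rw [map_add]; exact Submodule.add_mem _ hf hg
  | smul a f _ hf => rw [map_smul]; exact Submodule.smul_mem _ a hf

theorem isAdmissiblePair_iff (hH : IsStrong H) (hS : IsStrong S) : S.IsAdmissiblePair ↔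
    (∀ (χ : CharSpace H) (σ : CharSpace S), I (res χ.fn * σ.fn) = χ.fn * I σ.fn) ∧
      ∀ σ : CharSpace S, res (S := S) (I σ.fn) = σ.fn * res (I 1) := by
  have h1 : ind (HGIrrep.trivial S).ch = I 1 := by
    rw [hI.ind_eq _ (HGIrrep.trivial S).ch_mem, HGRep.trivial_ch]
  refine and_congr ⟨fun h χ σ => ?_, fun h π τ => ?_⟩ ⟨fun h σ => ?_, fun h τ => ?_⟩
  · obtain ⟨π, rfl⟩ := χ.exists_ofRep
    obtain ⟨τ, rfl⟩ := σ.exists_ofRep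
    have h2 := h π τ
    rwa [hI.ind_eq _ (hS.mul_mem (res_mem hH π.ch_mem) τ.ch_mem), hI.ind_eq _ τ.ch_mem] at h2
  · rw [hI.ind_eq _ (hS.mul_mem (res_mem hH π.ch_mem) τ.ch_mem), hI.ind_eq _ τ.ch_mem]
    exact h (CharSpace.ofRep π) (CharSpace.ofRep τ)
  · obtain ⟨τ, rfl⟩ := σ.exists_ofRep
    have h2 := h τ
    rwa [h1, hI.ind_eq _ τ.ch_mem] at h2
  · rw [h1, hI.ind_eq _ τ.ch_mem]
    exact h (CharSpace.ofRep τ)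

/-- Frobenius reciprocity for the trivial character. -/
theorem exists_integral_eq (hH : IsStrong H) (hS : IsStrong S) (hfin : S.HasFiniteQuotient) :
    ∃ c : ℝ, 0 < c ∧ ∀ f ∈ charSpan S,
      ∫ x, I f x ∂(hgHaar H) = c * ∫ y, f y ∂(hgHaar S) := by
  obtain ⟨-, c, hc, hint⟩ := indCh_trivial hH hfin.exists_isIndDecomposition
  refine ⟨c, hc, fun f hf => ?_⟩
  induction hf using Submodule.span_induction with
  | mem f hf =>
    obtain ⟨χ, rfl⟩ := hf
    by_cases h : χ = CharSpace.triv S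
    · subst h
      have h1 : I (CharSpace.triv S).fn = indCh (HGIrrep.trivial S) := by
        rw [← hI.ch_eq, HGRep.trivial_ch]
        rfl
      rw [h1, hint]
      simp [CharSpace.triv_fn]
    · rw [hS.integral_char χ h, mul_zero]
      obtain ⟨τ, rfl⟩ := χ.exists_ofRep
      have h1 : I (CharSpace.ofRep τ).fn = indCh τ := hI.ch_eq τ
      rw [h1, integral_indCh_eq_zero hH hS τ fun h2 => h (Subtype.ext h2)]
  | zero => simp
  | add f g hf hg hf' hg' =>
    rw [map_add]
    simp only [Pi.add_apply]
    rw [integral_add ((hH.continuous_of_mem (hI.mem_charSpan hH hf)).integrable_of_compactSpace _)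
        ((hH.continuous_of_mem (hI.mem_charSpan hH hg)).integrable_of_compactSpace _),
      integral_add ((hS.continuous_of_mem hf).integrable_of_compactSpace _)
        ((hS.continuous_of_mem hg).integrable_of_compactSpace _), hf', hg', mul_add]
  | smul a f _ hf =>
    rw [map_smul]
    simp only [Pi.smul_apply]
    rw [integral_smul, integral_smul, hf, smul_eq_mul, smul_eq_mul, mul_left_comm]

end IsInduction

/-- The relations of an admissible pair, extended from characters to their linear combinations. -/
structure IsAdmissibleInduction (I : (S → ℂ) →ₗ[ℂ] (H → ℂ)) : Prop extends IsInduction I where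
  ind_res_mul : ∀ f ∈ charSpan H, ∀ g ∈ charSpan S, I (res f * g) = f * I g
  res_ind : ∀ g ∈ charSpan S, res (S := S) (I g) = g * res (I 1)

theorem IsInduction.isAdmissibleInduction {I : (S → ℂ) →ₗ[ℂ] (H → ℂ)} (hI : IsInduction I)
    (hH : IsStrong H) (hS : IsStrong S) (h : S.IsAdmissiblePair) : IsAdmissibleInduction I where
  toIsInduction := hI
  ind_res_mul f hf g hg := by
    induction hf, hg using Submodule.span_induction₂ with
    | mem_mem f g hf hg =>
      obtain ⟨χ, rfl⟩ := hf
      obtain ⟨σ, rfl⟩ := hg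
      exact ((hI.isAdmissiblePair_iff hH hS).1 h).1 χ σ
    | zero_left g _ =>
      change I (0 * g) = _
      rw [zero_mul, map_zero, zero_mul]
    | zero_right f _ => simp
    | add_left f g k _ _ _ h1 h2 =>
      rw [add_mul, ← h1, ← h2, ← map_add, ← add_mul]
      rfl
    | add_right f g k _ _ _ h1 h2 => rw [mul_add, map_add, map_add, h1, h2, mul_add]
    | smul_left a f g _ _ h =>
      rw [smul_mul_assoc, ← h, ← map_smul, ← smul_mul_assoc]
      rfl
    | smul_right a f g _ _ h => rw [mul_smul_comm, map_smul, map_smul, h, mul_smul_comm]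
  res_ind g hg := by
    induction hg using Submodule.span_induction with
    | mem g hg =>
      obtain ⟨σ, rfl⟩ := hg
      exact ((hI.isAdmissiblePair_iff hH hS).1 h).2 σ
    | zero => rw [map_zero, zero_mul]; rfl
    | add f g _ _ hf hg => rw [map_add, add_mul, ← hf, ← hg]; rfl
    | smul a f _ hf => rw [map_smul, smul_mul_assoc, ← hf]; rfl

namespace IsAdmissibleInduction

variable {I : (S → ℂ) →ₗ[ℂ] (H → ℂ)} (hI : IsAdmissibleInduction I)
include hI

theorem apply_e (hH : IsStrong H) (hfin : S.HasFiniteQuotient) {f : S → ℂ}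
    (hf : f ∈ charSpan S) : I f e = f e := by
  have h1 : I 1 e = 1 := by
    have h2 := hI.ch_eq (HGIrrep.trivial S)
    rw [HGRep.trivial_ch] at h2
    rw [h2, (indCh_trivial hH hfin.exists_isIndDecomposition).1]
  have h3 := congrFun (hI.res_ind f hf) e
  refine h3.trans ?_
  change f e * I 1 e = f e
  rw [h1, mul_one]

/-- Both sides have the same Fourier coefficients, by reciprocity for the trivial character. -/
theorem conj_apply (hH : IsStrong H) (hS : IsStrong S) (hfin : S.HasFiniteQuotient) {f : S → ℂ}
    (hf : f ∈ charSpan S) : I (star f) = star (I f) := by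
  obtain ⟨c, -, hc⟩ := hI.exists_integral_eq hH hS hfin
  have hf' : star f ∈ charSpan S := hS.conj_mem hf
  have h1 : I (star f) ∈ charSpan H := hI.mem_charSpan hH hf'
  have h2 : star (I f) ∈ charSpan H := hH.conj_mem (hI.mem_charSpan hH hf)
  rw [← sub_eq_zero]
  refine hH.eq_zero_of_integral (Submodule.sub_mem _ h1 h2) fun ψ => ?_
  have hψ : star ψ.fn ∈ charSpan H := (hH.conj ψ).fn_mem
  have key : ∀ g ∈ charSpan S, ∀ k ∈ charSpan H, ∫ x, I g x * k x ∂(hgHaar H) =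
      c * ∫ y : S, k y * g y ∂(hgHaar S) := fun g hg k hk => by
    have h3 := hc _ (hS.mul_mem (res_mem hH hk) hg)
    rw [hI.ind_res_mul k hk g hg] at h3
    simp only [Pi.mul_apply] at h3
    simp_rw [mul_comm (I g _)]
    exact h3
  have h3 : ∀ x, (I (star f) - star (I f)) x * starRingEnd ℂ (ψ.fn x) =
      I (star f) x * (star ψ.fn) x - starRingEnd ℂ (I f x * ψ.fn x) := fun x => by
    rw [map_mul, Pi.sub_apply, sub_mul]
    rfl
  have hi1 : Integrable (fun x => I (star f) x * (star ψ.fn) x) (hgHaar H) :=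
    (hH.continuous_of_mem (hH.mul_mem h1 hψ)).integrable_of_compactSpace _
  have hi2 : Integrable (fun x => starRingEnd ℂ (I f x * ψ.fn x)) (hgHaar H) :=
    (hH.continuous_of_mem (hH.conj_mem (hH.mul_mem (hI.mem_charSpan hH hf)
      ψ.fn_mem))).integrable_of_compactSpace _
  simp_rw [h3]
  rw [integral_sub hi1 hi2, integral_conj, key _ hf' _ hψ, key _ hf _ ψ.fn_mem, map_mul,
    Complex.conj_ofReal, ← integral_conj, sub_eq_zero]
  congr 2
  ext y
  rw [map_mul]
  rfl

end IsAdmissibleInduction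

/-! ### The twisted product -/

/-- The bilinear extension of the twisted product to pairs of functions. -/
noncomputable def twistedMul (q : ℝ) (I : (S → ℂ) →ₗ[ℂ] (H → ℂ)) :
    (H → ℂ) × (S → ℂ) →ₗ[ℝ] (H → ℂ) × (S → ℂ) →ₗ[ℝ] (H → ℂ) × (S → ℂ) :=
  LinearMap.mk₂ ℝ (fun p r => (p.1 * r.1 + (q : ℂ) • I (p.2 * r.2),
      res p.1 * r.2 + p.2 * res r.1 + (1 - q : ℂ) • (p.2 * r.2)))
    (fun p p' r => by
      refine Prod.ext (funext fun x => ?_) (funext fun y => ?_)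
      · simp only [Prod.fst_add, Prod.snd_add, add_mul, map_add, smul_add, Pi.add_apply]
        ring
      · simp only [Prod.fst_add, Prod.snd_add, Pi.add_apply, Pi.mul_apply, Pi.smul_apply, res,
          smul_eq_mul]
        ring)
    (fun a p r => by
      refine Prod.ext (funext fun x => ?_) (funext fun y => ?_)
      · simp only [Prod.smul_fst, Prod.smul_snd, smul_mul_assoc, LinearMap.map_smul_of_tower,
          Pi.add_apply, Pi.smul_apply, smul_eq_mul, Complex.real_smul]
        ring
      · simp only [Prod.smul_fst, Prod.smul_snd, Pi.add_apply, Pi.mul_apply, Pi.smul_apply, res,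
          smul_eq_mul, Complex.real_smul]
        ring)
    (fun p r r' => by
      refine Prod.ext (funext fun x => ?_) (funext fun y => ?_)
      · simp only [Prod.fst_add, Prod.snd_add, mul_add, map_add, smul_add, Pi.add_apply]
        ring
      · simp only [Prod.fst_add, Prod.snd_add, Pi.add_apply, Pi.mul_apply, Pi.smul_apply, res,
          smul_eq_mul]
        ring)
    (fun a p r => by
      refine Prod.ext (funext fun x => ?_) (funext fun y => ?_)
      · simp only [Prod.smul_fst, Prod.smul_snd, mul_smul_comm, LinearMap.map_smul_of_tower,
          Pi.add_apply, Pi.smul_apply, smul_eq_mul, Complex.real_smul]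
        ring
      · simp only [Prod.smul_fst, Prod.smul_snd, Pi.add_apply, Pi.mul_apply, Pi.smul_apply, res,
          smul_eq_mul, Complex.real_smul]
        ring)

theorem twistedMul_apply (q : ℝ) (I : (S → ℂ) →ₗ[ℂ] (H → ℂ)) (p r : (H → ℂ) × (S → ℂ)) :
    twistedMul q I p r = (p.1 * r.1 + (q : ℂ) • I (p.2 * r.2),
      res p.1 * r.2 + p.2 * res r.1 + (1 - q : ℂ) • (p.2 * r.2)) := rfl

theorem twistedMul_comm (q : ℝ) (I : (S → ℂ) →ₗ[ℂ] (H → ℂ)) (p r : (H → ℂ) × (S → ℂ)) :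
    twistedMul q I p r = twistedMul q I r p := by
  rw [twistedMul_apply, twistedMul_apply, mul_comm p.1, mul_comm p.2 r.2, mul_comm (res p.1),
    mul_comm p.2, add_comm (r.2 * _)]

theorem IsAdmissibleInduction.twistedMul_assoc (hS : IsStrong S) {I : (S → ℂ) →ₗ[ℂ] (H → ℂ)}
    (hI : IsAdmissibleInduction I) (q : ℝ) {p r t : (H → ℂ) × (S → ℂ)} (hp1 : p.1 ∈ charSpan H)
    (hp2 : p.2 ∈ charSpan S) (hr1 : r.1 ∈ charSpan H) (hr2 : r.2 ∈ charSpan S)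
    (ht1 : t.1 ∈ charSpan H) (ht2 : t.2 ∈ charSpan S) :
    twistedMul q I (twistedMul q I p r) t = twistedMul q I p (twistedMul q I r t) := by
  have h1 := hI.ind_res_mul _ hp1 _ (hS.mul_mem hr2 ht2)
  have h2 := hI.ind_res_mul _ hr1 _ (hS.mul_mem hp2 ht2)
  have h3 := hI.ind_res_mul _ ht1 _ (hS.mul_mem hp2 hr2)
  have h4 := hI.res_ind _ (hS.mul_mem hp2 hr2)
  have h5 := hI.res_ind _ (hS.mul_mem hr2 ht2)
  simp only [twistedMul_apply]
  refine Prod.ext ?_ ?_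
  · have e1 : (res p.1 * r.2 + p.2 * res r.1 + (1 - q : ℂ) • (p.2 * r.2)) * t.2 =
        res p.1 * (r.2 * t.2) + res r.1 * (p.2 * t.2) + (1 - q : ℂ) • (p.2 * r.2 * t.2) := by
      rw [add_mul, add_mul, smul_mul_assoc]
      ring
    have e2 : p.2 * (res r.1 * t.2 + r.2 * res t.1 + (1 - q : ℂ) • (r.2 * t.2)) =
        res r.1 * (p.2 * t.2) + res t.1 * (p.2 * r.2) + (1 - q : ℂ) • (p.2 * r.2 * t.2) := by
      rw [mul_add, mul_add, mul_smul_comm, ← mul_assoc p.2 r.2 t.2]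
      ring
    simp only [e1, e2, map_add, h1, h2, h3]
    ext x
    simp only [Pi.add_apply, Pi.mul_apply, Pi.smul_apply, smul_eq_mul]
    ring
  · ext y
    have h4' := congrFun h4 y
    have h5' := congrFun h5 y
    simp only [Pi.add_apply, Pi.mul_apply, Pi.smul_apply, smul_eq_mul, res] at h4' h5' ⊢
    linear_combination (q : ℂ) * t.2 y * h4' - (q : ℂ) * p.2 y * h5'

theorem IsAdmissibleInduction.star_twistedMul (hH : IsStrong H) (hS : IsStrong S)
    (hfin : S.HasFiniteQuotient) {I : (S → ℂ) →ₗ[ℂ] (H → ℂ)}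
    (hI : IsAdmissibleInduction I) (q : ℝ) {p r : (H → ℂ) × (S → ℂ)}
    (hp : p.2 ∈ charSpan S) (hr : r.2 ∈ charSpan S) :
    star (twistedMul q I p r) = twistedMul q I (star p) (star r) := by
  have h := hI.conj_apply hH hS hfin (hS.mul_mem hp hr)
  rw [star_mul', eq_comm] at h
  simp only [twistedMul_apply]
  refine Prod.ext (funext fun x => ?_) (funext fun y => ?_)
  · have h' := congrFun h x
    simp only [Prod.fst_star, Prod.snd_star, Pi.star_apply, Pi.add_apply, Pi.mul_apply,
      Pi.smul_apply, smul_eq_mul, star_add, star_mul', Complex.star_def, Complex.conj_ofReal]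
      at h' ⊢
    rw [h']
  · simp [res]

namespace TwistedSpace

/-- The pair of functions of an element of `K(Ĥ ∪ Ĥ₀, ℤ_q(2))`. -/
def pair (k : S.TwistedSpace) : (H → ℂ) × (S → ℂ) := (k.circ, k.bullet)

/-- The elements `(χ, ∘)`. -/
def ofCirc (χ : CharSpace H) : S.TwistedSpace := Sum.inl χ

/-- The elements `(σ, •)`. -/
def ofBullet (σ : CharSpace S) : S.TwistedSpace := Sum.inr σ

theorem pair_ofCirc (χ : CharSpace H) : (ofCirc χ : S.TwistedSpace).pair = (χ.fn, 0) := rfl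

theorem pair_ofBullet (σ : CharSpace S) : (ofBullet σ : S.TwistedSpace).pair = (0, σ.fn) := rfl

theorem cases (k : S.TwistedSpace) : (∃ χ, k = ofCirc χ) ∨ ∃ σ, k = ofBullet σ := by
  rcases k with χ | σ
  · exact Or.inl ⟨χ, rfl⟩
  · exact Or.inr ⟨σ, rfl⟩

theorem circ_mem (k : S.TwistedSpace) : k.pair.1 ∈ charCone H := by
  rcases k.cases with ⟨χ, rfl⟩ | ⟨σ, rfl⟩
  · exact χ.fn_mem_cone
  · exact Submodule.zero_mem _

theorem bullet_mem (k : S.TwistedSpace) : k.pair.2 ∈ charCone S := by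
  rcases k.cases with ⟨χ, rfl⟩ | ⟨σ, rfl⟩
  · exact Submodule.zero_mem (charCone S)
  · exact σ.fn_mem_cone

theorem linearIndependent_pair (hH : IsStrong H) (hS : IsStrong S) :
    LinearIndependent ℝ (pair : S.TwistedSpace → (H → ℂ) × (S → ℂ)) := by
  have h := linearIndependent_inl_union_inr' hH.linearIndependent hS.linearIndependent
  have h2 : LinearIndependent ℂ (pair : S.TwistedSpace → (H → ℂ) × (S → ℂ)) := by
    have he : (Sum.elim (LinearMap.inl ℂ (H → ℂ) (S → ℂ) ∘ CharSpace.fn)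
        (LinearMap.inr ℂ (H → ℂ) (S → ℂ) ∘ CharSpace.fn)) =
        fun k : CharSpace H ⊕ CharSpace S => pair (S := S) k :=
      funext fun k => by rcases k with χ | σ <;> rfl
    rw [he] at h
    exact h
  exact h2.restrict_scalars fun a b hab => by simpa using hab

theorem twistedProd_eq (hS : IsStrong S) {I : (S → ℂ) →ₗ[ℂ] (H → ℂ)} (hI : IsInduction I) (q : ℝ)
    (a b : S.TwistedSpace) : twistedProd q a b = twistedMul q I a.pair b.pair := by
  have h0 : res (S := S) (0 : H → ℂ) = 0 := rfl
  rcases a.cases with ⟨χ, rfl⟩ | ⟨σ, rfl⟩ <;> rcases b.cases with ⟨ψ, rfl⟩ | ⟨ρ, rfl⟩ <;>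
    rw [twistedMul_apply] <;> simp only [pair_ofCirc, pair_ofBullet, zero_mul, mul_zero, map_zero,
      smul_zero, add_zero, zero_add, h0]
  · rfl
  · rfl
  · rfl
  · rw [← hI.ind_eq _ (hS.mul_mem σ.fn_mem ρ.fn_mem)]
    rfl

/-- The expansion of a pair of nonnegative combinations of characters. -/
theorem exists_expansion {p : (H → ℂ) × (S → ℂ)} (h1 : p.1 ∈ charCone H) (h2 : p.2 ∈ charCone S) :
    ∃ c : S.TwistedSpace →₀ ℝ, (∀ k, 0 ≤ c k) ∧ Finsupp.linearCombination ℝ pair c = p := by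
  obtain ⟨c, hc0, hc⟩ := charCone.exists_finsupp h1
  obtain ⟨d, hd0, hd⟩ := charCone.exists_finsupp h2
  let c' : S.TwistedSpace →₀ ℝ := Finsupp.sumElim c d
  refine ⟨c', fun k => ?_, ?_⟩
  · rcases k with χ | σ
    · exact hc0 χ
    · exact hd0 σ
  · have h3 : Finsupp.linearCombination ℝ pair c' =
        c.sum (fun χ a => a • (χ.fn, (0 : S → ℂ))) + d.sum fun σ a => a • ((0 : H → ℂ), σ.fn) := by
      rw [Finsupp.linearCombination_apply]
      exact Finsupp.sum_sumElim _ _ _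
    rw [h3]
    refine Prod.ext (funext fun x => ?_) (funext fun y => ?_)
    · rw [hc]
      simp [Finsupp.sum, Prod.fst_sum]
    · rw [hd]
      simp [Finsupp.sum, Prod.snd_sum]

end TwistedSpace

end Subhypergroup

/-! ### The twisted hypergroup -/

namespace Subhypergroup

variable {H : Type u} [TopologicalSpace H] [CompactSpace H] [T2Space H]
  [SecondCountableTopology H] [MeasurableSpace H] [BorelSpace H] [Hypergroup H]
  {S : Subhypergroup H}

theorem _root_.charCone.smul_mem {X : Type u} [TopologicalSpace X] [CompactSpace X] [T2Space X]
    [MeasurableSpace X] [BorelSpace X] [Hypergroup X] {a : ℝ} (ha : 0 ≤ a) {f : X → ℂ}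
    (hf : f ∈ charCone X) : (a : ℂ) • f ∈ charCone X := by
  have h := charCone.sum_mem {()} (fun _ => a) (fun _ _ => ha) (fun _ => f) fun _ _ => hf
  rwa [Finset.sum_singleton] at h

theorem res_mem_cone (hH : IsStrong H) {f : H → ℂ} (hf : f ∈ charCone H) :
    res (S := S) f ∈ charCone S := by
  induction hf using Submodule.span_induction with
  | mem f hf => obtain ⟨χ, rfl⟩ := hf; exact res_fn_mem_cone hH χ
  | zero => exact Submodule.zero_mem (charCone S)
  | add f g _ _ hf hg => exact Submodule.add_mem _ hf hg
  | smul a f _ hf => exact Submodule.smul_mem _ a hf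

theorem IsInduction.twistedMul_mem_cone (hH : IsStrong H) (hS : IsStrong S)
    {I : (S → ℂ) →ₗ[ℂ] (H → ℂ)} (hI : IsInduction I) {q : ℝ} (hq0 : 0 ≤ q) (hq1 : q ≤ 1)
    {p r : (H → ℂ) × (S → ℂ)} (hp1 : p.1 ∈ charCone H) (hp2 : p.2 ∈ charCone S)
    (hr1 : r.1 ∈ charCone H) (hr2 : r.2 ∈ charCone S) :
    (twistedMul q I p r).1 ∈ charCone H ∧ (twistedMul q I p r).2 ∈ charCone S := by
  have h := hS.mul_mem_cone hp2 hr2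
  have h1 := charCone.smul_mem (sub_nonneg.2 hq1) h
  push_cast at h1
  exact ⟨Submodule.add_mem _ (hH.mul_mem_cone hp1 hr1) (charCone.smul_mem hq0 (hI.mem_cone hH h)),
    Submodule.add_mem _ (Submodule.add_mem _ (hS.mul_mem_cone (res_mem_cone hH hp1) hr2)
      (hS.mul_mem_cone hp2 (res_mem_cone hH hr1))) h1⟩

namespace TwistedSpace

theorem linearCombination_pair_fst (c : S.TwistedSpace →₀ ℝ) (x : H) :
    (Finsupp.linearCombination ℝ pair c).1 x =
      Finsupp.linearCombination ℝ (fun k : S.TwistedSpace => k.circ x) c :=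
  Finsupp.apply_linearCombination ℝ
    ((LinearMap.proj x).comp (LinearMap.fst ℝ (H → ℂ) (S → ℂ))) pair c

theorem linearCombination_pair_snd (c : S.TwistedSpace →₀ ℝ) (y : S) :
    (Finsupp.linearCombination ℝ pair c).2 y =
      Finsupp.linearCombination ℝ (fun k : S.TwistedSpace => k.bullet y) c :=
  Finsupp.apply_linearCombination ℝ
    ((LinearMap.proj y).comp (LinearMap.snd ℝ (H → ℂ) (S → ℂ))) pair c

theorem integral_linearCombination_pair (hH : IsStrong H) (c : S.TwistedSpace →₀ ℝ) :
    ∫ x, (Finsupp.linearCombination ℝ pair c).1 x ∂(hgHaar H) = c (ofCirc (CharSpace.triv H)) := by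
  have hcont : ∀ k : S.TwistedSpace, Continuous k.circ := fun k =>
    hH.continuous_of_mem (charCone.mem_charSpan k.circ_mem)
  simp_rw [linearCombination_pair_fst, Finsupp.linearCombination_apply, Finsupp.sum]
  rw [integral_finsetSum (f := fun (k : S.TwistedSpace) x => c k • k.circ x) _ fun k _ =>
    ((hcont k).const_smul (c k)).integrable_of_compactSpace _]
  simp_rw [integral_smul]
  rw [Finset.sum_eq_single (ofCirc (CharSpace.triv H))]
  · have h : ∀ x, (ofCirc (CharSpace.triv H) : S.TwistedSpace).circ x = 1 := fun _ => rfl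
    simp [h]
  · intro k _ hk
    rcases k.cases with ⟨χ, rfl⟩ | ⟨σ, rfl⟩
    · have h := hH.integral_char χ fun h => hk (by rw [h])
      exact (congrArg _ h).trans (smul_zero _)
    · have h : ∀ x, (ofBullet σ : S.TwistedSpace).circ x = 0 := fun _ => rfl
      simp [h]
  · intro h
    rw [Finsupp.notMem_support_iff.1 h, zero_smul]

/-- The involution of the twisted hypergroup, by complex conjugation of characters. -/
noncomputable def conj (hH : IsStrong H) (hS : IsStrong S) : S.TwistedSpace → S.TwistedSpace
  | .inl χ => ofCirc (hH.conj χ)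
  | .inr σ => ofBullet (hS.conj σ)

theorem conj_ofCirc (hH : IsStrong H) (hS : IsStrong S) (χ : CharSpace H) :
    conj hH hS (ofCirc χ) = ofCirc (hH.conj χ) := rfl

theorem conj_ofBullet (hH : IsStrong H) (hS : IsStrong S) (σ : CharSpace S) :
    conj hH hS (ofBullet σ) = ofBullet (hS.conj σ) := rfl

theorem conj_conj (hH : IsStrong H) (hS : IsStrong S) (k : S.TwistedSpace) :
    conj hH hS (conj hH hS k) = k := by
  rcases k.cases with ⟨χ, rfl⟩ | ⟨σ, rfl⟩
  · rw [conj_ofCirc, conj_ofCirc, hH.conj_conj]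
  · rw [conj_ofBullet, conj_ofBullet, hS.conj_conj]

theorem pair_conj (hH : IsStrong H) (hS : IsStrong S) (k : S.TwistedSpace) :
    (conj hH hS k).pair = star k.pair := by
  rcases k.cases with ⟨χ, rfl⟩ | ⟨σ, rfl⟩
  · exact Prod.ext rfl (star_zero (S → ℂ)).symm
  · exact Prod.ext (star_zero (H → ℂ)).symm rfl

theorem ofCirc_injective : Function.Injective (ofCirc : CharSpace H → S.TwistedSpace) :=
  Sum.inl_injective

theorem ofBullet_injective : Function.Injective (ofBullet : CharSpace S → S.TwistedSpace) :=
  Sum.inr_injective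

theorem ofCirc_ne_ofBullet (χ : CharSpace H) (σ : CharSpace S) :
    (ofCirc χ : S.TwistedSpace) ≠ ofBullet σ := Sum.inl_ne_inr

/-- The `∘`-component of a product contains the trivial character exactly if the factors are
conjugate to each other. -/
theorem integral_twistedMul_ne_zero_iff (hH : IsStrong H) (hS : IsStrong S)
    (hfin : S.HasFiniteQuotient) {I : (S → ℂ) →ₗ[ℂ] (H → ℂ)} (hI : IsInduction I) {q : ℝ}
    (hq : 0 < q) (a b : S.TwistedSpace) :
    ∫ x, (twistedMul q I a.pair b.pair).1 x ∂(hgHaar H) ≠ 0 ↔ b = conj hH hS a := by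
  have key : ∀ {X : Type u} [TopologicalSpace X] [CompactSpace X] [T2Space X]
      [MeasurableSpace X] [BorelSpace X] [Hypergroup X] [SecondCountableTopology X]
      (hX : IsStrong X) (χ ψ : CharSpace X),
      ∫ x, χ.fn x * ψ.fn x ∂(hgHaar X) ≠ 0 ↔ ψ = hX.conj χ := by
    intro X _ _ _ _ _ _ _ hX χ ψ
    obtain ⟨c, -, -, hc, hiff⟩ := hX.exists_mul_eq χ ψ
    rw [← hiff]
    simp_rw [hc]
    rw [hX.integral_finsupp_sum, Ne, Complex.ofReal_eq_zero]
  have h1 : ∀ x, (twistedMul q I a.pair b.pair).1 x =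
      a.pair.1 x * b.pair.1 x + q * I (a.pair.2 * b.pair.2) x := fun _ => rfl
  simp_rw [h1]
  rcases a.cases with ⟨χ, rfl⟩ | ⟨σ, rfl⟩ <;> rcases b.cases with ⟨ψ, rfl⟩ | ⟨ρ, rfl⟩
  · simp only [pair_ofCirc, mul_zero, map_zero, Pi.zero_apply, add_zero]
    rw [key hH, conj_ofCirc, ofCirc_injective.eq_iff]
  · simp only [pair_ofCirc, pair_ofBullet, mul_zero, zero_mul, map_zero, Pi.zero_apply, add_zero,
      integral_zero, ne_eq, not_true_eq_false, false_iff]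
    rw [conj_ofCirc]
    exact (ofCirc_ne_ofBullet _ _).symm
  · simp only [pair_ofCirc, pair_ofBullet, mul_zero, zero_mul, map_zero, Pi.zero_apply, add_zero,
      integral_zero, ne_eq, not_true_eq_false, false_iff]
    rw [conj_ofBullet]
    exact ofCirc_ne_ofBullet _ _
  · simp only [pair_ofBullet, zero_mul, Pi.zero_apply, zero_add]
    obtain ⟨c, hc, hint⟩ := hI.exists_integral_eq hH hS hfin
    rw [integral_const_mul, hint _ (hS.mul_mem σ.fn_mem ρ.fn_mem), conj_ofBullet,
      ofBullet_injective.eq_iff, ← key hS, ← mul_assoc]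
    exact mul_ne_zero_iff_left (mul_ne_zero (Complex.ofReal_ne_zero.2 hq.ne')
      (Complex.ofReal_ne_zero.2 hc.ne'))

end TwistedSpace

open TwistedSpace

/-- The expansions of the twisted products of characters are the structure constants of a commutative
hypergroup. -/
theorem exists_hypergroup_of_isAdmissiblePair (hH : IsStrong H) (hS : IsStrong S)
    (hfin : S.HasFiniteQuotient) {q : ℝ} (hq0 : 0 < q) (hq1 : q ≤ 1) (h : S.IsAdmissiblePair) :
    ∃ K : Hypergroup S.TwistedSpace, IsTwistedConvolution q K.conv := by
  obtain ⟨I, hI'⟩ := exists_isInduction hS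
  have hI := hI'.isAdmissibleInduction hH hS h
  have hex : ∀ a b : S.TwistedSpace, ∃ c : S.TwistedSpace →₀ ℝ, (∀ k, 0 ≤ c k) ∧
      Finsupp.linearCombination ℝ pair c = twistedMul q I a.pair b.pair := fun a b => by
    have h := hI'.twistedMul_mem_cone hH hS hq0.le hq1 a.circ_mem a.bullet_mem b.circ_mem
      b.bullet_mem
    exact exists_expansion h.1 h.2
  choose m hm0 hm using hex
  have hinj := LinearIndependent.finsuppLinearCombination_injective
    (linearIndependent_pair hH hS (S := S))
  have h1 : ∀ k : S.TwistedSpace, k.pair.1 ∈ charSpan H := fun k =>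
    charCone.mem_charSpan k.circ_mem
  have h2 : ∀ k : S.TwistedSpace, k.pair.2 ∈ charSpan S := fun k =>
    charCone.mem_charSpan k.bullet_mem
  have hunit : ∀ p : (H → ℂ) × (S → ℂ),
      twistedMul q I p (ofCirc (CharSpace.triv H) : S.TwistedSpace).pair = p := fun p => by
    rw [twistedMul_apply, pair_ofCirc]
    refine Prod.ext ?_ ?_
    · simp only [mul_zero, map_zero, smul_zero, add_zero]
      exact mul_one p.1
    · simp only [mul_zero, smul_zero, add_zero, zero_add]
      exact mul_one p.2
  have hcomm : ∀ a b, m a b = m b a := fun a b => hinj (by rw [hm, hm, twistedMul_comm])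
  have hmo : ∀ a, m a (ofCirc (CharSpace.triv H)) = Finsupp.single a 1 := fun a => hinj (by
    rw [hm, hunit, Finsupp.linearCombination_single, one_smul])
  let K := Hypergroup.ofStructureConstants m (ofCirc (CharSpace.triv H))
    (TwistedSpace.conj hH hS) hm0 (fun a b => ?_)
    (fun x y z => (structureConstants_assoc_iff (linearIndependent_pair hH hS) _ hm x y z).2
      (hI.twistedMul_assoc hS q (h1 x) (h2 x) (h1 y) (h2 y) (h1 z) (h2 z)))
    hmo (fun a => by rw [hcomm, hmo]) (TwistedSpace.conj_conj hH hS) (fun a b => ?_) fun a b => ?_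
  · refine ⟨K, fun a b => ⟨fun x => ?_, fun y => ?_⟩⟩
    · rw [twistedProd_eq hS hI', ← hm, linearCombination_pair_fst]
      exact Finsupp.integral_toMeasure (hm0 a b) _
    · rw [twistedProd_eq hS hI', ← hm, linearCombination_pair_snd]
      exact Finsupp.integral_toMeasure (hm0 a b) _
  · -- the sum of the values of both components at the neutral element is `1` on characters
    let ℓ : (H → ℂ) × (S → ℂ) →ₗ[ℝ] ℂ :=
      (LinearMap.proj e).comp (LinearMap.fst ℝ (H → ℂ) (S → ℂ)) +
        (LinearMap.proj e).comp (LinearMap.snd ℝ (H → ℂ) (S → ℂ))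
    have hℓ : ∀ p, ℓ p = p.1 e + p.2 e := fun _ => rfl
    have hℓ1 : ℓ ∘ pair = fun _ : S.TwistedSpace => (1 : ℂ) := funext fun k => by
      rw [Function.comp_apply, hℓ]
      rcases k.cases with ⟨χ, rfl⟩ | ⟨σ, rfl⟩
      · exact (add_zero (χ.fn e)).trans (hH.char_e χ)
      · exact (zero_add (σ.fn e)).trans (hS.char_e σ)
    have hsum := Finsupp.apply_linearCombination ℝ ℓ pair (m a b)
    have hval : ℓ (twistedMul q I a.pair b.pair) = ℓ a.pair * ℓ b.pair := by
      have he := hI.apply_e hH hfin (hS.mul_mem (h2 a) (h2 b))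
      simp only [hℓ, twistedMul_apply, Pi.add_apply, Pi.smul_apply, smul_eq_mul, he, Pi.mul_apply]
      change _ + (a.pair.1 e * b.pair.2 e + a.pair.2 e * b.pair.1 e + _) = _
      ring
    have hpair : ∀ k : S.TwistedSpace, ℓ k.pair = 1 := fun k => congrFun hℓ1 k
    rw [hm, hval, hpair, hpair, hℓ1, mul_one, Finsupp.linearCombination_apply, Finsupp.sum] at hsum
    have := congrArg Complex.re hsum
    simpa [Finsupp.sum] using this.symm
  · rw [← integral_twistedMul_ne_zero_iff hH hS hfin hI' hq0, ← hm,
      integral_linearCombination_pair hH, Ne, Ne, Complex.ofReal_eq_zero]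
  · refine hinj ?_
    have hstar : ∀ c : S.TwistedSpace →₀ ℝ, Finsupp.linearCombination ℝ
        ((pair : S.TwistedSpace → _) ∘ TwistedSpace.conj hH hS) c =
          star (Finsupp.linearCombination ℝ pair c) := fun c => by
      rw [Finsupp.linearCombination_apply, Finsupp.linearCombination_apply, Finsupp.sum,
        Finsupp.sum, star_sum]
      refine Finset.sum_congr rfl fun k _ => ?_
      rw [star_smul, star_trivial, Function.comp_apply, pair_conj]
    rw [Finsupp.linearCombination_mapDomain, hstar, hm, hm,
      hI.star_twistedMul hH hS hfin q (h2 a) (h2 b), twistedMul_comm, pair_conj, pair_conj]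

/-- Associativity of the twisted product, for a triple of type `∘`, `•`, `•` in the first component,
and for a triple of type `•`, `•`, `•` in the second one. -/
theorem isAdmissiblePair_of_hypergroup (hH : IsStrong H) (hS : IsStrong S) {q : ℝ} (hq0 : 0 < q)
    (K : Hypergroup S.TwistedSpace) (hK : IsTwistedConvolution q K.conv) :
    S.IsAdmissiblePair := by
  obtain ⟨I, hI⟩ := exists_isInduction hS
  obtain ⟨m, hint, hassoc⟩ := Hypergroup.exists_structureConstants K
  have hm : ∀ a b, Finsupp.linearCombination ℝ pair (m a b) = twistedMul q I a.pair b.pair := by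
    intro a b
    rw [← twistedProd_eq hS hI]
    refine Prod.ext (funext fun x => ?_) (funext fun y => ?_)
    · rw [← (hK a b).1 x, linearCombination_pair_fst, hint]
    · rw [← (hK a b).2 y, linearCombination_pair_snd, hint]
  have key : ∀ a b c : S.TwistedSpace, twistedMul q I (twistedMul q I a.pair b.pair) c.pair =
      twistedMul q I a.pair (twistedMul q I b.pair c.pair) := fun a b c =>
    (structureConstants_assoc_iff (linearIndependent_pair hH hS) _ hm a b c).1 (hassoc a b c)
  have hq : (q : ℂ) ≠ 0 := Complex.ofReal_ne_zero.2 hq0.ne'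
  have h1 : (CharSpace.triv S).fn = 1 := rfl
  have h0 : res (S := S) (0 : H → ℂ) = 0 := rfl
  refine (hI.isAdmissiblePair_iff hH hS).2 ⟨fun χ σ => ?_, fun σ => ?_⟩
  · have h2 := congrArg Prod.fst (key (ofCirc χ) (ofBullet σ) (ofBullet (CharSpace.triv S)))
    simp only [pair_ofCirc, pair_ofBullet, twistedMul_apply, h1, h0, mul_one, mul_zero, zero_mul,
      map_zero, smul_zero, add_zero, zero_add, mul_smul_comm] at h2
    exact smul_right_injective _ hq h2
  · have h2 := congrArg Prod.snd (key (ofBullet σ) (ofBullet (CharSpace.triv S))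
      (ofBullet (CharSpace.triv S)))
    simp only [pair_ofBullet, twistedMul_apply, h1, h0, mul_one, mul_zero, zero_mul,
      smul_zero, add_zero, zero_add, mul_smul_comm] at h2
    have h3 := add_right_cancel h2
    refine smul_right_injective _ hq ?_
    change (q : ℂ) • res (S := S) (I σ.fn) = (q : ℂ) • (σ.fn * res (I 1))
    rw [← mul_smul_comm]
    exact h3

end Subhypergroup

theorem theorem3p8 {H : Type u} [TopologicalSpace H] [CompactSpace H] [T2Space H]
    [SecondCountableTopology H] [MeasurableSpace H] [BorelSpace H] [Hypergroup H]
    (hH : IsStrong H) (H₀ : Subhypergroup H) (hH₀ : IsStrong H₀)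
    (hfin : H₀.HasFiniteQuotient) (q : ℝ) (hq₀ : 0 < q) (hq₁ : q ≤ 1) :
    (∃ K : Hypergroup H₀.TwistedSpace, Subhypergroup.IsTwistedConvolution q K.conv) ↔
      H₀.IsAdmissiblePair :=
  ⟨fun ⟨K, hK⟩ => Subhypergroup.isAdmissiblePair_of_hypergroup hH hH₀ hq₀ K hK,
    Subhypergroup.exists_hypergroup_of_isAdmissiblePair hH hH₀ hfin hq₀ hq₁⟩
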